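/- **Setting.** Fix $A_\mu\in[-1,1]$, $A_\rho\in\mathbb R$, $A_\sigma>0$, and (at a fixed time) a length $L=L(t)>0$ and a weight $\nu=\nu(t)\ge 0$. For $2\pi$-periodic continuous $f:\mathbb R\to\mathbb R$ put $\hat f(k)=\frac1{2\pi}\int_{-\pi}^{\pi}f(\alpha)e^{-ik\alpha}d\alpha$, $$\|f\|_{\mathcal F^{0,1}_\nu}=\sum_{k\in\mathbb Z}e^{\nu|k|}|\hat f(k)|,\qquad \|f\|_{\dot{\mathcal F}^{s,1}_\nu}=\sum_{k\ne0}e^{\nu|k|}|k|^s|\hat f(k)|,$$ and say that $f$ belongs to the space if the sum is finite. Let $\vartheta\in\dot{\mathcal F}^{2,1}_\nu$ and $\theta=\vartheta-\hat\vartheta(0)$. The interface has tangent vector $z_\alpha(\alpha)=\frac{L}{2\pi}e^{i(\alpha+\vartheta(\alpha))}$. Its vorticity strength is a real $2\pi$-periodic mean-zero function $\omega$ with absolutely convergent Fourier series such that $$\omega(\alpha)=2A_\mu\tfrac{L}{2\pi}\mathcal D(\omega)(\alpha)+2A_\sigma\tfrac{2\pi}{L}\vartheta_{\alpha\alpha}(\alpha)-2A_\rho\tfrac{L}{2\pi}\sin(\alpha+\vartheta(\alpha)),$$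 where $\mathcal D(\omega)=-\mathrm{Re}\big(\overline{BR}(\omega)\,e^{i(\alpha+\vartheta(\alpha))}\big)$ and $$\overline{BR}(\omega)(\alpha)=\frac1{iL}\,\mathrm{pv}\!\int_{-\pi}^{\pi}\frac{\omega(\alpha-\beta)}{\int_0^1e^{i(\alpha+(r-1)\beta)}e^{i\vartheta(\alpha+(r-1)\beta)}dr}\frac{d\beta}{\beta}.$$ Let $\mathcal H(f)(\alpha)=\frac1{2\pi}\mathrm{pv}\!\int_{-\pi}^{\pi}\frac{f(\alpha-\beta)}{\tan(\beta/2)}d\beta$, let $E_q(\alpha,\beta)=\sum_{m\ge q}\frac{i^m}{m!}\int_0^1e^{i(r-1)\beta}\theta(\alpha+(r-1)\beta)^m\,dr$, and let $$\mathcal R(f)(\alpha)=\frac i\pi\,\mathrm{pv}\!\int_{-\pi}^{\pi}\frac{f(\alpha-\beta)}{\beta}\frac{\beta^2}{(1-e^{-i\beta})^2}\int_0^1e^{i(r-1)\beta}\theta(\alpha+(r-1)\beta)\,dr\,d\beta,$$ $$\mathcal S(f)(\alpha)=\frac1\pi\sum_{\substack{n,l\ge0\\ n+l\ge2}}\frac{(-1)^ni^{l+n+1}\theta(\alpha)^l}{l!}\,\mathrm{pv}\!\int_{-\pi}^{\pi}\frac{f(\alpha-\beta)\beta^{n+1}}{\beta(1-e^{-i\beta})^{n+1}}E_1(\alpha,\beta)^n\,d\beta+\frac1\pi\,\mathrm{pv}\!\int_{-\pi}^{\pi}\frac{f(\alpha-\beta)\beta^2}{\beta(1-e^{-i\beta})^2}E_2(\alpha,\beta)\,d\beta.$$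 The parts of $\omega$ of order $0$, $1$ and $\ge2$ in $\theta$ are $$\omega_0=-A_\rho\tfrac L\pi\sin(\alpha+\hat\vartheta(0)),$$ $$\omega_1=A_\mu\tfrac L\pi\mathcal D_1(\omega_0)+2A_\sigma\tfrac{2\pi}L\theta_{\alpha\alpha}-A_\rho\tfrac L\pi\cos(\alpha+\hat\vartheta(0))\,\theta,\qquad \mathcal D_1(\omega_0)=-\tfrac\pi L\big(\theta\,\mathcal H\omega_0+\mathrm{Im}\,\mathcal R(\omega_0)\big),$$ $$\omega_{\ge2}=A_\mu\tfrac L\pi\mathcal D_{\ge2}(\omega)-A_\rho\tfrac L\pi\sin(\alpha+\hat\vartheta(0))\sum_{j\ge1}\tfrac{(-1)^j\theta^{2j}}{(2j)!}-A_\rho\tfrac L\pi\cos(\alpha+\hat\vartheta(0))\sum_{j\ge1}\tfrac{(-1)^j\theta^{1+2j}}{(1+2j)!},$$ $$\mathcal D_{\ge2}(\omega)=-\tfrac\pi L\big(\theta\,\mathcal H(\omega-\omega_0)+\mathrm{Im}\,\mathcal R(\omega-\omega_0)+\mathrm{Im}\,\mathcal S(\omega)\big).$$ **Constants.** Let $x=\|\theta\|_{\mathcal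 F^{0,1}_\nu}$; for $s\ge0$ let $b(n,s)=1$ if $s\le1$ and $b(n,s)=n^{s-1}$ if $s>1$; let $\mathcal V=\frac14\int_{-\pi/2}^{\pi/2}\frac{\beta}{\sin\beta}d\beta$ (Catalan's constant), $\tilde{\mathcal C}=\frac4\pi\mathcal V\sqrt{1+\pi^2/4}$, $C_{\mathcal R}=1+\tilde{\mathcal C}$, $a_n=1+\tilde{\mathcal C}n(\pi/2)^{n-1}$. Put $$\tilde C_1=\tfrac{\pi\tilde{\mathcal C}}2\tfrac{e^x(e^x-1)^2}{x^2}\tfrac{2-\frac\pi2(e^x-1)}{(1-\frac\pi2(e^x-1))^2}+\tfrac{e^x-1-x}{x^2}+(1+\tilde{\mathcal C})\tfrac{(e^x-1)^2}{x^2}+\tfrac{e^x(e^x-1)^2}{x^2(2-e^x)},$$ $$C_6=\tfrac{e^x-1-x}{x^2},\quad C_1=\tilde C_1+C_{\mathcal R}C_6,\quad C_7=1+C_{\mathcal R}+C_1x,\quad C_8=\tfrac1{1-|A_\mu|C_7x},$$ $$C_9=C_7C_8,\qquad C_{10}=|A_\mu|(1+2|A_\mu|)C_7C_8+|A_\mu|C_1C_8+C_6C_8,$$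 $$C_3=\sum_{n+l\ge2}\tfrac{b(l+n+1,s)}{l!}a_nx^{n+l-2}\big(\tfrac{e^x-1}x\big)^n+C_{\mathcal R}\sum_{m\ge0}\tfrac{b(m+3,s)}{(m+2)!}x^m,$$ $$C_4=\sum_{n+l\ge2}\tfrac{b(l+n+1,s)}{l!}a_nx^{n+l-2}\Big(l\big(\tfrac{e^x-1}x\big)^n+n\big(\tfrac{e^x-1}x\big)^{n-1}\sum_{m\ge1}\tfrac{b(m,s)}{(m-1)!}x^{m-1}\Big)+C_{\mathcal R}\sum_{m\ge0}\tfrac{b(m+3,s)}{(m+1)!}x^m$$ (sums over integers $n,l\ge0$), $$C_2=b(2,s)(1+C_{\mathcal R})+C_3x,\quad C_{12}=b(2,s)(1+C_{\mathcal R})+C_4x,\quad \tilde C_8=\tfrac1{1-|A_\mu|C_2x},$$ $$C_{11}=\sum_{j\ge2}\tfrac{b(j+1,s)x^{j-2}}{j!}+\sum_{j\ge1}\tfrac{b(j+2,s)x^{j-1}}{j!},\qquad C_{13}=\tilde C_8\big(C_2+C_{12}+|A_\mu|C_9C_{12}x\big),$$ $$C_{14}=|A_\mu|\tilde C_8\big(C_3+C_4+(1+2|A_\mu|)(2b(2,s)C_2+C_{12})+C_{10}C_{12}x\big)+C_{11}\tilde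 C_8.$$ (At $x=0$ the values of these quotients are irrelevant.) **Proposition.** (1) $\omega_1\in\mathcal F^{0,1}_\nu$ and $$\|\omega_1\|_{\mathcal F^{0,1}_\nu}\le A_\sigma\tfrac{4\pi}{L}\|\theta\|_{\dot{\mathcal F}^{2,1}_\nu}+(1+2|A_\mu|)|A_\rho|\tfrac L\pi e^{\nu}\|\theta\|_{\mathcal F^{0,1}_\nu}.$$ (2) If $s>0$ and $\theta\in\dot{\mathcal F}^{2+s,1}_\nu$, then $\omega_1\in\dot{\mathcal F}^{s,1}_\nu$ and $$\|\omega_1\|_{\dot{\mathcal F}^{s,1}_\nu}\le A_\sigma\tfrac{4\pi}{L}\|\theta\|_{\dot{\mathcal F}^{2+s,1}_\nu}+(1+2|A_\mu|)|A_\rho|\tfrac L\pi\,2b(2,s)\,e^{\nu}\|\theta\|_{\dot{\mathcal F}^{s,1}_\nu}.$$ Let now $\omega$ be a vorticity strength and suppose that $\frac\pi2(e^x-1)<1$. Then $\omega=\omega_0+\omega_1+\omega_{\ge2}$, and: (3) If $|A_\mu|C_7x<1$, then $\omega_{\ge2}\in\mathcal F^{0,1}_\nu$ and $$\|\omega_{\ge2}\|_{\mathcal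 F^{0,1}_\nu}\le|A_\mu|A_\sigma\tfrac{4\pi}LC_9\|\theta\|_{\mathcal F^{0,1}_\nu}\|\theta\|_{\dot{\mathcal F}^{2,1}_\nu}+|A_\rho|\tfrac L\pi e^{\nu}C_{10}\|\theta\|_{\mathcal F^{0,1}_\nu}^2.$$ (4) If $s>0$, $\theta\in\dot{\mathcal F}^{2+s,1}_\nu$ and $|A_\mu|C_2x<1$, then $\omega_{\ge2}\in\dot{\mathcal F}^{s,1}_\nu$ and $$\|\omega_{\ge2}\|_{\dot{\mathcal F}^{s,1}_\nu}\le|A_\mu|A_\sigma\tfrac{4\pi}LC_{13}\|\theta\|_{\mathcal F^{0,1}_\nu}\|\theta\|_{\dot{\mathcal F}^{2+s,1}_\nu}+|A_\rho|\tfrac L\pi e^{\nu}C_{14}\|\theta\|_{\mathcal F^{0,1}_\nu}\|\theta\|_{\dot{\mathcal F}^{s,1}_\nu}.$$ -/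

import Mathlib

noncomputable section

namespace MuskatBubble

/-! Fourier coefficients and the weighted Wiener-type spaces on the circle `[-π, π]`. -/

/-- The Fourier coefficient `(1 / 2π) ∫_{-π}^{π} f(α) e^{-ikα} dα` of a real function. -/
def fhat (f : ℝ → ℝ) (k : ℤ) : ℂ :=
  fourierCoeffOn (neg_lt_self Real.pi_pos) (fun α => (f α : ℂ)) k

/-- The norm of `F^{0,1}_ν`, the sum over all `k` of `e^{ν|k|} |f̂(k)|`. -/
def normF (ν : ℝ) (f : ℝ → ℝ) : ℝ :=
  ∑' k : ℤ, Real.exp (ν * |(k : ℝ)|) * ‖fhat f k‖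

/-- The norm of the homogeneous space `Ḟ^{s,1}_ν`, the sum over `k ≠ 0` of
`e^{ν|k|} |k|^s |f̂(k)|`. -/
def normFdot (ν s : ℝ) (f : ℝ → ℝ) : ℝ :=
  ∑' k : ℤ, if k = 0 then 0 else Real.exp (ν * |(k : ℝ)|) * |(k : ℝ)| ^ s * ‖fhat f k‖

/-- Membership in `F^{0,1}_ν`: continuous `2π`-periodic functions of finite norm. -/
def MemF (ν : ℝ) (f : ℝ → ℝ) : Prop :=
  Continuous f ∧ Function.Periodic f (2 * Real.pi) ∧
    Summable fun k : ℤ => Real.exp (ν * |(k : ℝ)|) * ‖fhat f k‖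

/-- Membership in `Ḟ^{s,1}_ν`: continuous `2π`-periodic functions of finite norm. -/
def MemFdot (ν s : ℝ) (f : ℝ → ℝ) : Prop :=
  Continuous f ∧ Function.Periodic f (2 * Real.pi) ∧
    Summable fun k : ℤ =>
      if k = 0 then 0 else Real.exp (ν * |(k : ℝ)|) * |(k : ℝ)| ^ s * ‖fhat f k‖

/-! Singular integrals. -/

/-- Principal value of `∫_{-π}^{π} g(β) dβ` with the singularity at `β = 0`: the limit of the
integral over `ε < |β| < π` as `ε` decreases to `0`. -/
def pv {E : Type} [NormedAddCommGroup E] [NormedSpace ℝ E] (g : ℝ → E) : E :=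
  Filter.limUnder (nhdsWithin (0 : ℝ) (Set.Ioi 0)) fun ε =>
    (∫ β in (-Real.pi)..(-ε), g β) + ∫ β in ε..Real.pi, g β

/-- The periodic Hilbert transform. -/
def hilbert (f : ℝ → ℝ) (α : ℝ) : ℝ :=
  1 / (2 * Real.pi) * pv fun β => f (α - β) / Real.tan (β / 2)

/-- The complex conjugate of the Birkhoff-Rott integral, for the curve of length `L` whose
tangent vector is `(L / 2π) e^{i(α + ϑ(α))}`. -/
def BRconj (L : ℝ) (ϑ ω : ℝ → ℝ) (α : ℝ) : ℂ :=
  1 / (Complex.I * L) * pv fun β =>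
    (ω (α - β) : ℂ) /
        (∫ s in (0 : ℝ)..1,
          Complex.exp (Complex.I * ((α + (s - 1) * β : ℝ) : ℂ)) *
            Complex.exp (Complex.I * (ϑ (α + (s - 1) * β) : ℂ))) *
      (1 / (β : ℂ))

/-- The operator `𝒟(ω) = - Re (BRconj(ω) e^{i(α + ϑ(α))})`. -/
def opD (L : ℝ) (ϑ ω : ℝ → ℝ) (α : ℝ) : ℝ :=
  -(BRconj L ϑ ω α * Complex.exp (Complex.I * ((α + ϑ α : ℝ) : ℂ))).re

/-- `ω` is the vorticity strength of the interface with tangent angle `α + ϑ(α)` and length `L`: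
a mean-zero `2π`-periodic function with absolutely convergent Fourier series that solves the implicit
vorticity equation. (The vorticity strength is an exact derivative, so it has mean zero; for
`Aμ = -1` the equation alone does not determine the mean.) -/
structure IsVorticityStrength (Aμ Aρ Aσ L : ℝ) (ϑ ω : ℝ → ℝ) : Prop where
  mem : MemF 0 ω
  mean_zero : ∫ α in (-Real.pi)..Real.pi, ω α = 0
  equation : ∀ α : ℝ, ω α =
    2 * Aμ * (L / (2 * Real.pi)) * opD L ϑ ω α
      + 2 * Aσ * (2 * Real.pi / L) * deriv (deriv ϑ) α
      - 2 * Aρ * (L / (2 * Real.pi)) * Real.sin (α + ϑ α)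

/-! The decomposition of the vorticity strength. -/

/-- The mean `ϑ̂(0)`. -/
def mean (ϑ : ℝ → ℝ) : ℝ := 1 / (2 * Real.pi) * ∫ α in (-Real.pi)..Real.pi, ϑ α

/-- `θ = ϑ - ϑ̂(0)`. -/
def theta (ϑ : ℝ → ℝ) (α : ℝ) : ℝ := ϑ α - mean ϑ

/-- The sum over `m ≥ m₀` of `(i^m / m!) ∫_0^1 e^{i(s-1)β} θ(α + (s-1)β)^m ds`. -/
def expTail (m₀ : ℕ) (θ : ℝ → ℝ) (α β : ℝ) : ℂ :=
  ∑' m : ℕ, Complex.I ^ (m + m₀) / ((m + m₀).factorial : ℂ) *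
    ∫ s in (0 : ℝ)..1, Complex.exp (Complex.I * (((s - 1) * β : ℝ) : ℂ)) *
      (θ (α + (s - 1) * β) : ℂ) ^ (m + m₀)

/-- The operator `ℛ`, linear in `θ`. -/
def opR (θ f : ℝ → ℝ) (α : ℝ) : ℂ :=
  Complex.I / (Real.pi : ℂ) * pv fun β =>
    (f (α - β) : ℂ) / (β : ℂ) * ((β : ℂ) ^ 2 / (1 - Complex.exp (-Complex.I * (β : ℂ))) ^ 2) *
      ∫ s in (0 : ℝ)..1, Complex.exp (Complex.I * (((s - 1) * β : ℝ) : ℂ)) *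
        (θ (α + (s - 1) * β) : ℂ)

/-- The operator `𝒮`, of order at least two in `θ`. -/
def opS (θ f : ℝ → ℝ) (α : ℝ) : ℂ :=
  1 / (Real.pi : ℂ) * (∑' p : ℕ × ℕ, if 2 ≤ p.1 + p.2 then
      (-1) ^ p.1 * Complex.I ^ (p.2 + p.1 + 1) * (θ α : ℂ) ^ p.2 / (p.2.factorial : ℂ) *
        pv fun β =>
          (f (α - β) : ℂ) * (β : ℂ) ^ (p.1 + 1) /
              ((β : ℂ) * (1 - Complex.exp (-Complex.I * (β : ℂ))) ^ (p.1 + 1)) *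
            expTail 1 θ α β ^ p.1
      else 0)
  + 1 / (Real.pi : ℂ) * pv fun β =>
      (f (α - β) : ℂ) * (β : ℂ) ^ 2 /
          ((β : ℂ) * (1 - Complex.exp (-Complex.I * (β : ℂ))) ^ 2) *
        expTail 2 θ α β

/-- The zeroth order part of the vorticity strength. -/
def omega0 (Aρ L : ℝ) (ϑ : ℝ → ℝ) (α : ℝ) : ℝ :=
  -Aρ * (L / Real.pi) * Real.sin (α + mean ϑ)

/-- `𝒟₁(ω₀)`. -/
def opD1 (Aρ L : ℝ) (ϑ : ℝ → ℝ) (α : ℝ) : ℝ :=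
  -Real.pi / L * (theta ϑ α * hilbert (omega0 Aρ L ϑ) α
    + (opR (theta ϑ) (omega0 Aρ L ϑ) α).im)

/-- The linear part `ω₁` of the vorticity strength. -/
def omega1 (Aμ Aρ Aσ L : ℝ) (ϑ : ℝ → ℝ) (α : ℝ) : ℝ :=
  Aμ * (L / Real.pi) * opD1 Aρ L ϑ α
    + 2 * Aσ * (2 * Real.pi / L) * deriv (deriv (theta ϑ)) α
    - Aρ * (L / Real.pi) * Real.cos (α + mean ϑ) * theta ϑ α

/-- `𝒟_{≥2}(ω)`, where `ω_{≥1} = ω - ω₀`. -/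
def opDge2 (Aρ L : ℝ) (ϑ ω : ℝ → ℝ) (α : ℝ) : ℝ :=
  -Real.pi / L * (theta ϑ α * hilbert (fun x => ω x - omega0 Aρ L ϑ x) α
    + (opR (theta ϑ) (fun x => ω x - omega0 Aρ L ϑ x) α).im
    + (opS (theta ϑ) ω α).im)

/-- The nonlinear part `ω_{≥2}` of the vorticity strength `ω`. -/
def omegaGe2 (Aμ Aρ L : ℝ) (ϑ ω : ℝ → ℝ) (α : ℝ) : ℝ :=
  Aμ * (L / Real.pi) * opDge2 Aρ L ϑ ω α
    - Aρ * (L / Real.pi) * Real.sin (α + mean ϑ) *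
        ∑' j : ℕ, (-1) ^ (j + 1) * theta ϑ α ^ (2 * (j + 1)) / ((2 * (j + 1)).factorial : ℝ)
    - Aρ * (L / Real.pi) * Real.cos (α + mean ϑ) *
        ∑' j : ℕ, (-1) ^ (j + 1) * theta ϑ α ^ (1 + 2 * (j + 1)) /
          ((1 + 2 * (j + 1)).factorial : ℝ)

/-! The constants. They are functions of `x = ‖θ‖` in `F^{0,1}_ν`, of `Aμ` and of `s`. -/

/-- `b(n, s)` is `1` for `s ≤ 1` and `n^{s-1}` for `s > 1`. -/
def b (n : ℕ) (s : ℝ) : ℝ := if s ≤ 1 then 1 else (n : ℝ) ^ (s - 1)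

/-- Catalan's constant. -/
def catalan : ℝ := 1 / 4 * ∫ β in (-(Real.pi / 2))..(Real.pi / 2), β / Real.sin β

def Ctilde : ℝ := 4 / Real.pi * catalan * √(1 + Real.pi ^ 2 / 4)

def CR : ℝ := 1 + Ctilde

def a (n : ℕ) : ℝ := 1 + Ctilde * n * (Real.pi / 2) ^ (n - 1)

def C1tilde (x : ℝ) : ℝ :=
  Real.pi * Ctilde / 2 * (Real.exp x * (Real.exp x - 1) ^ 2 / x ^ 2) *
      ((2 - Real.pi / 2 * (Real.exp x - 1)) / (1 - Real.pi / 2 * (Real.exp x - 1)) ^ 2)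
    + (Real.exp x - 1 - x) / x ^ 2
    + (1 + Ctilde) * ((Real.exp x - 1) ^ 2 / x ^ 2)
    + Real.exp x * (Real.exp x - 1) ^ 2 / (x ^ 2 * (2 - Real.exp x))

def C1breve (x : ℝ) : ℝ := (Real.exp x - 1 - x) / x ^ 2

def C1 (x : ℝ) : ℝ := C1tilde x + CR * C1breve x

def C6 (x : ℝ) : ℝ := (Real.exp x - 1 - x) / x ^ 2

def C7 (x : ℝ) : ℝ := 1 + CR + C1 x * x

def C8 (Aμ x : ℝ) : ℝ := 1 / (1 - |Aμ| * C7 x * x)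

def C9 (Aμ x : ℝ) : ℝ := C7 x * C8 Aμ x

def C10 (Aμ x : ℝ) : ℝ :=
  |Aμ| * (1 + 2 * |Aμ|) * C7 x * C8 Aμ x + |Aμ| * C1 x * C8 Aμ x + C6 x * C8 Aμ x

def C3tilde (s x : ℝ) : ℝ :=
  ∑' p : ℕ × ℕ, if 2 ≤ p.1 + p.2 then
    b (p.2 + p.1 + 1) s / (p.2.factorial : ℝ) * a p.1 * x ^ (p.1 + p.2 - 2) *
      ((Real.exp x - 1) / x) ^ p.1
  else 0

/-- The factor `C̃₅` inside `C̃₄`, which depends on the summation index `n`. -/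
def C5tilde (n : ℕ) (s x : ℝ) : ℝ :=
  n * ((Real.exp x - 1) / x) ^ (n - 1) *
    ∑' m : ℕ, b (m + 1) s / (m.factorial : ℝ) * x ^ m

def C4tilde (s x : ℝ) : ℝ :=
  ∑' p : ℕ × ℕ, if 2 ≤ p.1 + p.2 then
    b (p.2 + p.1 + 1) s / (p.2.factorial : ℝ) * a p.1 * x ^ (p.1 + p.2 - 2) *
      (p.2 * ((Real.exp x - 1) / x) ^ p.1 + C5tilde p.1 s x)
  else 0

def C3breve (s x : ℝ) : ℝ := ∑' m : ℕ, b (m + 3) s / ((m + 2).factorial : ℝ) * x ^ m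

def C4breve (s x : ℝ) : ℝ := ∑' m : ℕ, b (m + 3) s / ((m + 1).factorial : ℝ) * x ^ m

def C3 (s x : ℝ) : ℝ := C3tilde s x + CR * C3breve s x

def C4 (s x : ℝ) : ℝ := C4tilde s x + CR * C4breve s x

def C2 (s x : ℝ) : ℝ := b 2 s * (1 + CR) + C3 s x * x

def C12 (s x : ℝ) : ℝ := b 2 s * (1 + CR) + C4 s x * x

/-- The sum over `j ≥ 2` of `b(j+1,s) x^{j-2} / j!` plus the sum over `j ≥ 1` of
`b(j+2,s) x^{j-1} / j!`. -/
def C11 (s x : ℝ) : ℝ :=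
  (∑' j : ℕ, b (j + 3) s * x ^ j / ((j + 2).factorial : ℝ))
    + ∑' j : ℕ, b (j + 3) s * x ^ j / ((j + 1).factorial : ℝ)

def C8tilde (Aμ s x : ℝ) : ℝ := 1 / (1 - |Aμ| * C2 s x * x)

def C13 (Aμ s x : ℝ) : ℝ :=
  C8tilde Aμ s x * (C2 s x + C12 s x + |Aμ| * C9 Aμ x * C12 s x * x)

def C14 (Aμ s x : ℝ) : ℝ :=
  |Aμ| * C8tilde Aμ s x *
      (C3 s x + C4 s x + (1 + 2 * |Aμ|) * (2 * b 2 s * C2 s x + C12 s x)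
        + C10 Aμ x * C12 s x * x)
    + C11 s x * C8tilde Aμ s x

end MuskatBubble

end

noncomputable section

namespace MuskatBubble

open scoped ENNReal
open MeasureTheory Filter Topology

/-! In Fourier variables everything becomes a multilinear multiplier estimate. With `U = e^{iθ} -
1`, the denominator of the Birkhoff–Rott integral is `e^{i(α + mean ϑ)}` times `psi 1 β + segAvg U α
β`. Since `kerMul β = iβ/(1 - e^{-iβ})` is the inverse of `psi 1 β`, the integrand becomes a
constant times `ω(α-β) · ker β / (1 + kerMul β · segAvg U α β)`. The hypothesis `(π/2)(e^x - 1) < 1`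
makes the last factor a geometric series, because `|kerMul| ≤ π/2` and the averages of `U` are at
most `e^x - 1` in modulus. Its `n`-th term is the operator `opT n`, linear in `ω` and of degree `n`
in `U`. Multiplying by the power series of `e^{iθ}` and sorting by `n + l` gives `θ𝓗 + Im ℛ + Im 𝒮`
(`BRconj_mul_exp_eq`, `opD_eq`), hence the splitting of `ω`.

The analytic core is the bound `|mult j κ| ≤ π a_n` for the multipliers of `opT n` (`norm_mult_le`).
A factor `kerMul · psi K` with `K ≠ 0` is an average of pure exponentials (`kerMul_mul_psi`), so it
cannot increase a bound valid for all modulations of a kernel. Only the factors with `K = 0` remain,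
contributing `kerMul^c`. Writing `kerMul^c = 1 + (kerMul^c - 1)`, the first part has principal
values `±π`, and the second cancels the singularity of `ker` and has an explicit integral containing
Catalan's constant. On `ω₀`, which has only the frequencies `±1`, the first-order multiplier is at
most `π` (`norm_mult_one_le`); this replaces `C_R` by `1` and produces the factor `1 + 2|A_μ|`.

Norm estimates follow because `e^{ν|k|}` is submultiplicative and `|k|` subadditive, while `(∑
φ_i)^s ≤ b(n,s) ∑ φ_i^s`. Summing over `n` and `l` gives `C₁`, `C₃`, `C₄`; the gravity terms are the
Taylor orders of `e^{iθ}`.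

Finally `ω = ω₀ + ω₁ + ω_{≥2}` is inserted in the bound for `ω_{≥2}`, and the part containing
`ω_{≥2}` is absorbed on the left. Absorption needs a finite norm, whereas `ω` is only known to have
an absolutely convergent Fourier series. Hence it is performed with the truncated gauge `min(|k|,
N)`, with constants independent of `N`, and then `N → ∞`. In order `s`, the product of the norms of
`θ` of orders `s` and `2` is interpolated between orders `0` and `2 + s` (`wn_wpow_mul_le`). -/

/-! ### Absolutely convergent trigonometric expansions -/

/-- The exponential `e^{ikα}`. -/
def mode (k : ℤ) (α : ℝ) : ℂ := Complex.exp (Complex.I * (k : ℂ) * (α : ℂ))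

/-- The Fourier coefficient of a complex function on `[-π, π]`. -/
def fc (G : ℝ → ℂ) (k : ℤ) : ℂ := fourierCoeffOn (neg_lt_self Real.pi_pos) G k

lemma norm_mode (k : ℤ) (α : ℝ) : ‖mode k α‖ = 1 := by
  rw [mode, show Complex.I * (k : ℂ) * (α : ℂ) = ((k * α : ℝ) : ℂ) * Complex.I by push_cast; ring]
  exact Complex.norm_exp_ofReal_mul_I _

lemma mode_add (j k : ℤ) (α : ℝ) : mode (j + k) α = mode j α * mode k α := by
  simp only [mode, ← Complex.exp_add]; congr 1; push_cast; ring

lemma mode_add_right (k : ℤ) (α β : ℝ) : mode k (α + β) = mode k α * mode k β := by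
  simp only [mode, ← Complex.exp_add]; congr 1; push_cast; ring

lemma mode_zero (α : ℝ) : mode 0 α = 1 := by simp [mode]

lemma mode_neg (k : ℤ) (α : ℝ) : mode (-k) α = (starRingEnd ℂ) (mode k α) := by
  simp only [mode, ← Complex.exp_conj]; congr 1; simp

lemma mode_neg_right (k : ℤ) (α : ℝ) : mode k (-α) = mode (-k) α := by
  simp only [mode]; congr 1; push_cast; ring

lemma mode_sum {ι : Type} (s : Finset ι) (κ : ι → ℤ) (α : ℝ) :
    mode (∑ i ∈ s, κ i) α = ∏ i ∈ s, mode (κ i) α := by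
  classical
  induction s using Finset.induction_on with
  | empty => simp [mode_zero]
  | insert i s hi ih => rw [Finset.sum_insert hi, Finset.prod_insert hi, mode_add, ih]

@[fun_prop]
lemma continuous_mode (k : ℤ) : Continuous (mode k) := by unfold mode; fun_prop

lemma mode_periodic (k : ℤ) : Function.Periodic (mode k) (2 * Real.pi) := by
  intro α
  rw [mode_add_right]
  have : mode k (2 * Real.pi) = 1 := by
    rw [mode, Complex.exp_eq_one_iff]
    exact ⟨k, by push_cast; ring⟩
  rw [this, mul_one]

lemma integral_mode (k : ℤ) :
    ∫ α in (-Real.pi)..Real.pi, mode k α = if k = 0 then 2 * (Real.pi : ℂ) else 0 := by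
  split_ifs with h
  · subst h
    simp only [mode_zero, intervalIntegral.integral_const]
    simp; ring
  · have hk : Complex.I * (k : ℂ) ≠ 0 := by simp [h]
    have := integral_exp_mul_complex (a := -Real.pi) (b := Real.pi) hk
    simp only [mode]
    rw [this, div_eq_zero_iff]
    left
    have := mode_periodic k (-Real.pi)
    simp only [mode] at this
    rw [show -Real.pi + 2 * Real.pi = Real.pi by ring] at this
    rw [this, sub_self]

lemma fc_eq (G : ℝ → ℂ) (k : ℤ) :
    fc G k = 1 / (2 * Real.pi : ℂ) * ∫ α in (-Real.pi)..Real.pi, mode (-k) α * G α := by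
  rw [fc, fourierCoeffOn_eq_integral]
  have h : (fun x : ℝ => fourier (-k) (x : AddCircle (Real.pi - -Real.pi)) • G x)
      = fun x => mode (-k) x * G x := by
    ext x
    rw [fourier_coe_apply, smul_eq_mul, mode]
    congr 2
    have : (Real.pi : ℂ) ≠ 0 := by exact_mod_cast Real.pi_ne_zero
    push_cast
    field_simp
    ring
  rw [h, Complex.real_smul]
  congr 1
  push_cast
  ring

/-- `G` is the sum of the absolutely convergent trigonometric series with coefficients `c i` at
the frequencies `k i`. -/
structure HasExp {ι : Type} (c : ι → ℂ) (k : ι → ℤ) (G : ℝ → ℂ) : Prop where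
  summable : Summable fun i => ‖c i‖
  hasSum : ∀ α, HasSum (fun i => c i * mode (k i) α) (G α)

/-- Continuous periodic functions with absolutely convergent Fourier series. -/
structure Wiener (G : ℝ → ℂ) : Prop where
  continuous : Continuous G
  periodic : Function.Periodic G (2 * Real.pi)
  summable : Summable fun k => ‖fc G k‖

/-- The weighted `ℓ¹` norm of the Fourier coefficients. -/
def wn (W : ℤ → ℝ≥0∞) (G : ℝ → ℂ) : ℝ≥0∞ := ∑' m, W m * ‖fc G m‖ₑ

section HasExp

variable {ι ι' : Type} {c : ι → ℂ} {k : ι → ℤ} {G : ℝ → ℂ} {c' : ι' → ℂ} {k' : ι' → ℤ} {G' : ℝ → ℂ}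

lemma HasExp.eq (h : HasExp c k G) (α : ℝ) : G α = ∑' i, c i * mode (k i) α :=
  (h.hasSum α).tsum_eq.symm

lemma HasExp.continuous (h : HasExp c k G) : Continuous G := by
  rw [funext h.eq]
  refine continuous_tsum (fun i => by fun_prop) h.summable fun i α => ?_
  rw [norm_mul, norm_mode, mul_one]

lemma HasExp.periodic (h : HasExp c k G) : Function.Periodic G (2 * Real.pi) := by
  intro α
  rw [h.eq, h.eq]
  exact tsum_congr fun i => by rw [mode_periodic]

/-- Several indices may carry the same frequency, so a Fourier coefficient is the sum over a fibre
of `k`. Termwise integration is dominated by the constants `‖c i‖`. -/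
lemma HasExp.fc_eq [Countable ι] (h : HasExp c k G) (m : ℤ) :
    fc G m = ∑' i, if k i = m then c i else 0 := by
  have key : HasSum (fun i => ∫ α in (-Real.pi)..Real.pi, mode (-m) α * (c i * mode (k i) α))
      (∫ α in (-Real.pi)..Real.pi, mode (-m) α * G α) := by
    refine intervalIntegral.hasSum_integral_of_dominated_convergence (fun i _ => ‖c i‖)
      (fun i => ?_) (fun i => ?_) ?_ ?_ ?_
    · exact (by fun_prop : Continuous fun α => mode (-m) α * (c i * mode (k i) α)).aestronglyMeasurable
    · refine Filter.Eventually.of_forall fun α _ => ?_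
      rw [norm_mul, norm_mul, norm_mode, norm_mode, one_mul, mul_one]
    · exact Filter.Eventually.of_forall fun α _ => h.summable
    · exact intervalIntegrable_const
    · exact Filter.Eventually.of_forall fun α _ => (h.hasSum α).mul_left _
  rw [MuskatBubble.fc_eq, ← key.tsum_eq, ← tsum_mul_left]
  refine tsum_congr fun i => ?_
  have : (fun α => mode (-m) α * (c i * mode (k i) α)) = fun α => c i * mode (k i - m) α := by
    ext α; rw [sub_eq_add_neg, mode_add]; ring
  rw [this, intervalIntegral.integral_const_mul, integral_mode]
  have hpi : (Real.pi : ℂ) ≠ 0 := by exact_mod_cast Real.pi_ne_zero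
  by_cases hk : k i = m
  · simp [hk]; field_simp
  · simp [hk, sub_eq_zero]

/-- The basic tool for norm estimates: any expansion, however redundant, bounds the weighted norm,
by the triangle inequality in each fibre of `k` followed by Tonelli. -/
lemma HasExp.wn_le [Countable ι] (h : HasExp c k G) (W : ℤ → ℝ≥0∞) :
    wn W G ≤ ∑' i, W (k i) * ‖c i‖ₑ := by
  have h1 : ∀ m, W m * ‖fc G m‖ₑ ≤ ∑' i, if k i = m then W m * ‖c i‖ₑ else 0 := by
    intro m
    rw [h.fc_eq m]
    refine (mul_le_mul_right enorm_tsum_le_tsum_enorm _).trans ?_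
    rw [← ENNReal.tsum_mul_left]
    refine ENNReal.tsum_le_tsum fun i => ?_
    split_ifs <;> simp
  refine (ENNReal.tsum_le_tsum h1).trans ?_
  rw [ENNReal.tsum_comm]
  refine ENNReal.tsum_le_tsum fun i => ?_
  rw [tsum_eq_single (k i) (by intro m hm; simp [hm.symm])]
  simp

lemma tsum_enorm_ne_top (h : Summable fun i => ‖c i‖) : ∑' i, ‖c i‖ₑ ≠ ∞ := by
  simp only [← ofReal_norm]
  exact h.tsum_ofReal_ne_top

lemma summable_norm_of_enorm (h : ∑' i, ‖c i‖ₑ ≠ ∞) : Summable fun i => ‖c i‖ := by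
  have := ENNReal.summable_toReal h
  simpa using this

lemma HasExp.wiener [Countable ι] (h : HasExp c k G) : Wiener G where
  continuous := h.continuous
  periodic := h.periodic
  summable := by
    apply summable_norm_of_enorm
    have := h.wn_le (fun _ => 1)
    simp only [wn, one_mul] at this
    exact ne_top_of_le_ne_top (tsum_enorm_ne_top h.summable) this

/-- Fourier inversion: `G` descends to a continuous function on the circle of length `2π`, whose
summable Fourier series converges to it at every point. -/
lemma Wiener.hasExp (h : Wiener G) : HasExp (fc G) id G where
  summable := h.summable
  hasSum := by
    have : Fact (0 < 2 * Real.pi) := ⟨Real.two_pi_pos⟩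
    let g : C(AddCircle (2 * Real.pi), ℂ) := ⟨h.periodic.lift, by
      exact continuous_coinduced_dom.mpr h.continuous⟩
    have hg : ∀ x : ℝ, g x = G x := fun x => rfl
    have hm : ∀ (n : ℤ) (x : ℝ), fourier n (x : AddCircle (2 * Real.pi)) = mode n x := by
      intro n x
      rw [fourier_coe_apply, mode]
      have : (Real.pi : ℂ) ≠ 0 := by exact_mod_cast Real.pi_ne_zero
      congr 1; push_cast; field_simp
    have hc : ∀ n, fourierCoeff g n = fc G n := by
      intro n
      rw [fourierCoeff_eq_intervalIntegral _ _ (-Real.pi), MuskatBubble.fc_eq]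
      simp only [hm, hg, smul_eq_mul]
      rw [show -Real.pi + 2 * Real.pi = Real.pi by ring, Complex.real_smul]
      push_cast; rfl
    intro α
    have hs : Summable (fourierCoeff g) := by
      rw [funext hc]; exact h.summable.of_norm
    have := has_pointwise_sum_fourier_series_of_summable hs α
    simpa only [hc, hm, hg, smul_eq_mul, id] using this

lemma HasExp.congr (h : HasExp c k G) (hG : ∀ α, G' α = G α) : HasExp c k G' := by
  rwa [funext hG]

lemma HasExp.const_mul (h : HasExp c k G) (a : ℂ) : HasExp (fun i => a * c i) k (fun α => a * G α) where
  summable := by simpa only [norm_mul] using h.summable.mul_left _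
  hasSum α := by simpa only [mul_assoc] using (h.hasSum α).mul_left a

lemma HasExp.add (h : HasExp c k G) (h' : HasExp c' k' G') :
    HasExp (Sum.elim c c') (Sum.elim k k') (fun α => G α + G' α) where
  summable := by
    refine Summable.sum _ ?_ ?_
    · exact h.summable
    · exact h'.summable
  hasSum α := by
    refine HasSum.sum (f := fun i => Sum.elim c c' i * mode (Sum.elim k k' i) α) ?_ ?_
    · exact h.hasSum α
    · exact h'.hasSum α

lemma HasExp.mul (h : HasExp c k G) (h' : HasExp c' k' G') :
    HasExp (fun p : ι × ι' => c p.1 * c' p.2) (fun p => k p.1 + k' p.2) (fun α => G α * G' α) where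
  summable := by
    have h3 : Summable fun p : ι × ι' => ‖c p.1‖ * ‖c' p.2‖ :=
      Summable.mul_of_nonneg (f := fun i => ‖c i‖) (g := fun i => ‖c' i‖) h.summable h'.summable
        (fun _ => norm_nonneg _) (fun _ => norm_nonneg _)
    simpa only [norm_mul] using h3
  hasSum α := by
    have h1 : Summable fun i => ‖c i * mode (k i) α‖ := by
      simpa only [norm_mul, norm_mode, mul_one] using h.summable
    have h2 : Summable fun i => ‖c' i * mode (k' i) α‖ := by
      simpa only [norm_mul, norm_mode, mul_one] using h'.summable
    have h3 : Summable fun p : ι × ι' => c p.1 * mode (k p.1) α * (c' p.2 * mode (k' p.2) α) :=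
      summable_mul_of_summable_norm (f := fun i => c i * mode (k i) α)
        (g := fun i => c' i * mode (k' i) α) h1 h2
    have h4 : (fun p : ι × ι' => c p.1 * c' p.2 * mode (k p.1 + k' p.2) α)
        = fun p => c p.1 * mode (k p.1) α * (c' p.2 * mode (k' p.2) α) := by
      ext p; rw [mode_add]; ring
    rw [h4]
    exact HasSum.mul (f := fun i => c i * mode (k i) α) (g := fun i => c' i * mode (k' i) α)
      (h.hasSum α) (h'.hasSum α) h3

lemma HasExp.conj (h : HasExp c k G) :
    HasExp (fun i => (starRingEnd ℂ) (c i)) (fun i => - k i) (fun α => (starRingEnd ℂ) (G α)) where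
  summable := by simpa using h.summable
  hasSum α := by
    have h1 : (fun i => (starRingEnd ℂ) (c i) * mode (-k i) α)
        = fun i => (starRingEnd ℂ) (c i * mode (k i) α) := by
      ext i; rw [mode_neg, map_mul]
    rw [h1]
    exact (h.hasSum α).star

/-- Sum of a family of expansions. -/
lemma HasExp.sigma {ι : Type} {κ : ι → Type} {c : ∀ i, κ i → ℂ} {k : ∀ i, κ i → ℤ}
    {G : ι → ℝ → ℂ} {F : ℝ → ℂ} (h : ∀ i, HasExp (c i) (k i) (G i))
    (hs : Summable fun i => ∑' j, ‖c i j‖) (hF : ∀ α, F α = ∑' i, G i α) :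
    HasExp (fun p : Σ i, κ i => c p.1 p.2) (fun p => k p.1 p.2) F := by
  have hsum : Summable fun p : Σ i, κ i => ‖c p.1 p.2‖ :=
    (summable_sigma_of_nonneg fun _ => norm_nonneg _).2 ⟨fun i => (h i).summable, hs⟩
  refine ⟨hsum, fun α => ?_⟩
  have h1 : Summable fun p : Σ i, κ i => c p.1 p.2 * mode (k p.1 p.2) α := by
    apply Summable.of_norm
    simpa only [norm_mul, norm_mode, mul_one] using hsum
  convert h1.hasSum using 1
  rw [hF, h1.tsum_sigma' fun i => ((h i).hasSum α).summable]
  exact tsum_congr fun i => (h i).eq α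

end HasExp

/-! ### Closure properties of the Wiener algebra -/

section Closure

variable {F G : ℝ → ℂ} (W : ℤ → ℝ≥0∞)

lemma fc_add (hF : Continuous F) (hG : Continuous G) (m : ℤ) :
    fc (fun α => F α + G α) m = fc F m + fc G m := by
  simp only [fc_eq, mul_add]
  rw [intervalIntegral.integral_add, mul_add]
  · exact (by fun_prop : Continuous fun x => mode (-m) x * F x).intervalIntegrable _ _
  · exact (by fun_prop : Continuous fun x => mode (-m) x * G x).intervalIntegrable _ _

lemma fc_const_mul (c : ℂ) (m : ℤ) : fc (fun α => c * G α) m = c * fc G m :=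
  fourierCoeffOn.const_mul _ _ _ _

lemma wn_add_le (hF : Continuous F) (hG : Continuous G) :
    wn W (fun α => F α + G α) ≤ wn W F + wn W G := by
  simp only [wn]
  rw [← ENNReal.tsum_add]
  refine ENNReal.tsum_le_tsum fun m => ?_
  rw [fc_add hF hG, ← mul_add]
  exact mul_le_mul_right (enorm_add_le _ _) _

lemma wn_const_mul (c : ℂ) : wn W (fun α => c * G α) = ‖c‖ₑ * wn W G := by
  simp only [wn]
  rw [← ENNReal.tsum_mul_left]
  refine tsum_congr fun m => ?_
  rw [fc_const_mul, enorm_mul]; ring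

lemma wn_neg : wn W (fun α => -G α) = wn W G := by
  have := wn_const_mul W (G := G) (-1)
  simpa using this

lemma wn_sub_le (hF : Continuous F) (hG : Continuous G) :
    wn W (fun α => F α - G α) ≤ wn W F + wn W G := by
  rw [← wn_neg W (G := G)]
  simp only [sub_eq_add_neg]
  exact wn_add_le W hF (by fun_prop)

lemma Wiener.add (hF : Wiener F) (hG : Wiener G) : Wiener fun α => F α + G α :=
  (hF.hasExp.add hG.hasExp).wiener

lemma Wiener.const_mul (hG : Wiener G) (c : ℂ) : Wiener fun α => c * G α :=
  (hG.hasExp.const_mul c).wiener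

lemma Wiener.neg (hG : Wiener G) : Wiener fun α => -G α := by
  simpa only [neg_one_mul] using hG.const_mul (-1)

lemma Wiener.sub (hF : Wiener F) (hG : Wiener G) : Wiener fun α => F α - G α := by
  simpa only [sub_eq_add_neg] using hF.add hG.neg

lemma Wiener.mul (hF : Wiener F) (hG : Wiener G) : Wiener fun α => F α * G α :=
  (hF.hasExp.mul hG.hasExp).wiener

lemma hasExp_const (c : ℂ) : HasExp (fun _ : Unit => c) (fun _ => 0) (fun _ => c) where
  summable := (hasSum_fintype _).summable
  hasSum _ := by simp [mode_zero]

/-- Conjugation reflects the frequencies, which an even weight does not see. In `Im G = (G - conj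
G)/(2i)` the factor `1/2` then compensates the two terms, so imaginary parts cost no constant. -/
lemma wn_im_le (hW : ∀ k, W (-k) = W k) (hG : Wiener G) :
    Wiener (fun α => ((G α).im : ℂ)) ∧ wn W (fun α => ((G α).im : ℂ)) ≤ wn W G := by
  have hc := hG.hasExp.conj
  have hw := hc.wiener
  have h1 : (fun α => ((G α).im : ℂ)) = fun α => (1 / (2 * Complex.I)) *
      (G α - (starRingEnd ℂ) (G α)) := by
    ext α
    rw [Complex.sub_conj]
    field_simp
    push_cast; ring
  refine ⟨by rw [h1]; exact (hG.sub hw).const_mul _, ?_⟩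
  rw [h1, wn_const_mul]
  have h2 : wn W (fun α => (starRingEnd ℂ) (G α)) ≤ wn W G := by
    refine (hc.wn_le W).trans ?_
    refine le_of_eq (tsum_congr fun i => ?_)
    simp [hW]
  have h3 : ‖(1 / (2 * Complex.I) : ℂ)‖ₑ = 2⁻¹ := by
    rw [← ofReal_norm]
    simp
  rw [h3]
  calc 2⁻¹ * wn W (fun α => G α - (starRingEnd ℂ) (G α))
      ≤ 2⁻¹ * (wn W G + wn W G) := by
        gcongr
        exact (wn_sub_le W hG.continuous hw.continuous).trans (by gcongr)
    _ = wn W G := by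
        rw [← two_mul, ← mul_assoc, ENNReal.inv_mul_cancel (by norm_num) (by norm_num), one_mul]

lemma wn_mono {W W' : ℤ → ℝ≥0∞} (h : ∀ k, W k ≤ W' k) : wn W G ≤ wn W' G :=
  ENNReal.tsum_le_tsum fun _ => mul_le_mul_left (h _) _

end Closure

/-! ### Products of sums -/

lemma tsum_prod_fin (n : ℕ) (g : Fin n → ℤ → ℝ≥0∞) :
    ∑' κ : Fin n → ℤ, ∏ i, g i (κ i) = ∏ i, ∑' k, g i k := by
  induction n with
  | zero => simp
  | succ n ih =>
    rw [← (Fin.consEquiv (fun _ : Fin (n + 1) => ℤ)).tsum_eq, Fin.prod_univ_succ, ← ih,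
      ENNReal.tsum_prod', ← ENNReal.tsum_mul_right]
    refine tsum_congr fun k => ?_
    rw [← ENNReal.tsum_mul_left]
    refine tsum_congr fun κ => ?_
    simp [Fin.prod_univ_succ, Fin.consEquiv]

/-- Powers of an expansion. -/
lemma HasExp.pow {ι : Type} {c : ι → ℂ} {k : ι → ℤ} {G : ℝ → ℂ} (h : HasExp c k G) (n : ℕ) :
    HasExp (fun κ : Fin n → ι => ∏ p, c (κ p)) (fun κ => ∑ p, k (κ p)) (fun α => G α ^ n) := by
  induction n with
  | zero =>
    refine ⟨(hasSum_fintype _).summable, fun α => ?_⟩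
    simp [mode_zero]
  | succ n ih =>
    have h1 := h.mul ih
    let σ := Fin.consEquiv (fun _ : Fin (n + 1) => ι)
    have hc : (fun p : ι × (Fin n → ι) => c p.1 * ∏ q, c (p.2 q))
        = (fun κ : Fin (n + 1) → ι => ∏ p, c (κ p)) ∘ σ := by
      ext p; simp [σ, Fin.consEquiv, Fin.prod_univ_succ]
    have hk : (fun p : ι × (Fin n → ι) => k p.1 + ∑ q, k (p.2 q))
        = (fun κ : Fin (n + 1) → ι => ∑ p, k (κ p)) ∘ σ := by
      ext p; simp [σ, Fin.consEquiv, Fin.sum_univ_succ]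
    rw [hc, hk] at h1
    refine ⟨?_, fun α => ?_⟩
    · have := h1.summable
      rwa [← σ.summable_iff]
    · rw [← σ.hasSum_iff, pow_succ']
      exact h1.hasSum α

/-! ### Weights -/

/-- A submultiplicative even weight `w` with a subadditive even gauge `φ`. -/
structure IsWeight (w φ : ℤ → ℝ≥0∞) : Prop where
  w_zero : w 0 = 1
  w_add : ∀ j k, w (j + k) ≤ w j * w k
  w_neg : ∀ k, w (-k) = w k
  φ_zero : φ 0 = 0
  φ_add : ∀ j k, φ (j + k) ≤ φ j + φ k
  φ_neg : ∀ k, φ (-k) = φ k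

/-- The weight of order `s`. -/
def wpow (w φ : ℤ → ℝ≥0∞) (s : ℝ) (k : ℤ) : ℝ≥0∞ := w k * φ k ^ s

/-- The origin of `b`: for `s ≤ 1` the power is subadditive, and for `s > 1` the power mean
inequality costs the factor `card^(s-1)`. -/
lemma rpow_sum_le_b {ι : Type} (t : Finset ι) (f : ι → ℝ≥0∞) {s : ℝ} (hs : 0 < s) :
    (∑ i ∈ t, f i) ^ s ≤ ENNReal.ofReal (b t.card s) * ∑ i ∈ t, f i ^ s := by
  unfold b
  split_ifs with h
  · rw [ENNReal.ofReal_one, one_mul]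
    classical
    induction t using Finset.induction_on with
    | empty => simp [hs]
    | insert i t hi ih =>
      rw [Finset.sum_insert hi, Finset.sum_insert hi]
      exact (ENNReal.rpow_add_le_add_rpow _ _ hs.le h).trans (by gcongr)
  · push Not at h
    refine (ENNReal.rpow_sum_le_const_mul_sum_rpow t f h.le).trans (le_of_eq ?_)
    congr 1
    rw [← ENNReal.ofReal_rpow_of_nonneg (by positivity) (by linarith), ENNReal.ofReal_natCast]

lemma tsum_prod_const {l : ℕ} (g : ℤ → ℝ≥0∞) :
    ∑' κ : Fin l → ℤ, ∏ i, g (κ i) = (∑' k, g k) ^ l := by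
  rw [tsum_prod_fin l fun _ => g]; simp

/-- A Leibniz rule. The term in which `h` marks position `p` factors into one marked and `l - 1`
unmarked sums, and all `l` positions contribute equally. -/
lemma tsum_prod_mul_sum {l : ℕ} (g h : ℤ → ℝ≥0∞) :
    ∑' κ : Fin l → ℤ, (∏ i, g (κ i)) * ∑ i, h (κ i)
      = l * (∑' k, g k * h k) * (∑' k, g k) ^ (l - 1) := by
  simp_rw [Finset.mul_sum]
  rw [Summable.tsum_finsetSum fun _ _ => ENNReal.summable]
  have h1 : ∀ p : Fin l, ∑' κ : Fin l → ℤ, (∏ i, g (κ i)) * h (κ p)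
      = (∑' k, g k * h k) * (∑' k, g k) ^ (l - 1) := by
    intro p
    have h2 : ∀ κ : Fin l → ℤ, (∏ i, g (κ i)) * h (κ p)
        = ∏ i, (if i = p then fun k => g k * h k else g) (κ i) := by
      intro κ
      rw [← Finset.mul_prod_erase _ _ (Finset.mem_univ p),
        ← Finset.mul_prod_erase _ (fun i => (if i = p then fun k => g k * h k else g) (κ i))
          (Finset.mem_univ p), if_pos rfl,
        Finset.prod_congr rfl (f := fun i => (if i = p then fun k => g k * h k else g) (κ i))
          (g := fun i => g (κ i))]
      · ring
      · intro i hi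
        simp only [if_neg (Finset.ne_of_mem_erase hi)]
    rw [tsum_congr h2, tsum_prod_fin, ← Finset.mul_prod_erase _ _ (Finset.mem_univ p), if_pos rfl,
      Finset.prod_congr rfl (s₁ := Finset.univ.erase p) (g := fun i => ∑' k, g k)]
    · simp
    · intro i hi
      simp only [if_neg (Finset.ne_of_mem_erase hi)]
  rw [Finset.sum_congr rfl fun p _ => h1 p]
  simp [mul_assoc]

lemma tsum_mul_mul {X Y Z : Type} (f : X → ℝ≥0∞) (g : Y → ℝ≥0∞) (h : Z → ℝ≥0∞) :
    ∑' p : X × Y × Z, f p.1 * (g p.2.1 * h p.2.2) = (∑' x, f x) * ((∑' y, g y) * ∑' z, h z) := by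
  rw [ENNReal.tsum_prod', ← ENNReal.tsum_mul_right]
  refine tsum_congr fun x => ?_
  rw [ENNReal.tsum_prod', ← ENNReal.tsum_mul_right, ← ENNReal.tsum_mul_left]
  refine tsum_congr fun y => ?_
  rw [← ENNReal.tsum_mul_left, ← ENNReal.tsum_mul_left]

namespace IsWeight

variable {w φ : ℤ → ℝ≥0∞}

lemma w_sum_le (hw : IsWeight w φ) {ι : Type} (t : Finset ι) (κ : ι → ℤ) :
    w (∑ i ∈ t, κ i) ≤ ∏ i ∈ t, w (κ i) := by
  classical
  induction t using Finset.induction_on with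
  | empty => simp [hw.w_zero]
  | insert i t hi ih =>
    rw [Finset.sum_insert hi, Finset.prod_insert hi]
    exact (hw.w_add _ _).trans (by gcongr)

lemma φ_sum_le (hw : IsWeight w φ) {ι : Type} (t : Finset ι) (κ : ι → ℤ) :
    φ (∑ i ∈ t, κ i) ≤ ∑ i ∈ t, φ (κ i) := by
  classical
  induction t using Finset.induction_on with
  | empty => simp [hw.φ_zero]
  | insert i t hi ih =>
    rw [Finset.sum_insert hi, Finset.sum_insert hi]
    exact (hw.φ_add _ _).trans (by gcongr)

lemma wpow_neg (hw : IsWeight w φ) (s : ℝ) (k : ℤ) : wpow w φ s (-k) = wpow w φ s k := by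
  simp [wpow, hw.w_neg, hw.φ_neg]

lemma φ_rpow_block_le (hw : IsWeight w φ) {s : ℝ} (hs : 0 < s) {l n : ℕ} (lam : Fin l → ℤ) (j : ℤ)
    (κ : Fin n → ℤ) :
    φ (∑ p, lam p + (j + ∑ p, κ p)) ^ s ≤ ENNReal.ofReal (b (l + n + 1) s) *
      (∑ p, φ (lam p) ^ s + (φ j ^ s + ∑ p, φ (κ p) ^ s)) := by
  -- The three blocks of frequencies are merged over one index type, so that `b` is evaluated at
  -- their total number `l + n + 1`.
  have h := hw.φ_sum_le Finset.univ
    (Sum.elim lam (Sum.elim (fun _ : Unit => j) κ) : Fin l ⊕ (Unit ⊕ Fin n) → ℤ)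
  have h2 := rpow_sum_le_b Finset.univ
    (fun i => φ ((Sum.elim lam (Sum.elim (fun _ : Unit => j) κ) : Fin l ⊕ (Unit ⊕ Fin n) → ℤ) i)) hs
  have h3 := (ENNReal.rpow_le_rpow h hs.le).trans h2
  simp only [Fintype.sum_sum_type, Sum.elim_inl, Sum.elim_inr, Finset.card_univ, Fintype.card_sum,
    Fintype.card_fin, Fintype.card_unit, Finset.univ_unique, Finset.sum_singleton] at h3
  rwa [show l + (1 + n) = l + n + 1 by ring] at h3

lemma w_block_le (hw : IsWeight w φ) {l n : ℕ} (lam : Fin l → ℤ) (j : ℤ) (κ : Fin n → ℤ) :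
    w (∑ p, lam p + (j + ∑ p, κ p)) ≤ (∏ p, w (lam p)) * (w j * ∏ p, w (κ p)) := by
  refine (hw.w_add _ _).trans (mul_le_mul' (hw.w_sum_le _ _) ?_)
  exact (hw.w_add _ _).trans (mul_le_mul' le_rfl (hw.w_sum_le _ _))

variable (A F U : ℤ → ℝ≥0∞) (l n : ℕ)

lemma tsum_w_block_le (hw : IsWeight w φ) :
    ∑' p : (Fin l → ℤ) × ℤ × (Fin n → ℤ), w (∑ i, p.1 i + (p.2.1 + ∑ i, p.2.2 i)) *
      ((∏ i, A (p.1 i)) * (F p.2.1 * ∏ i, U (p.2.2 i)))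
    ≤ (∑' k, w k * A k) ^ l * ((∑' k, w k * F k) * (∑' k, w k * U k) ^ n) := by
  rw [← tsum_prod_const, ← tsum_prod_const, ← tsum_mul_mul]
  refine ENNReal.tsum_le_tsum fun p => ?_
  refine (mul_le_mul_left (hw.w_block_le p.1 p.2.1 p.2.2) _).trans (le_of_eq ?_)
  simp only [Finset.prod_mul_distrib]
  ring

/-- The factor `φ^s` falls on the single `F`-frequency, on one of the `l` frequencies of `A`, or on
one of the `n` frequencies of `U`; these are the three summands. -/
lemma tsum_wpow_block_le (hw : IsWeight w φ) {s : ℝ} (hs : 0 < s) :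
    ∑' p : (Fin l → ℤ) × ℤ × (Fin n → ℤ), wpow w φ s (∑ i, p.1 i + (p.2.1 + ∑ i, p.2.2 i)) *
      ((∏ i, A (p.1 i)) * (F p.2.1 * ∏ i, U (p.2.2 i)))
    ≤ ENNReal.ofReal (b (l + n + 1) s) *
      ((∑' k, w k * A k) ^ l * ((∑' k, wpow w φ s k * F k) * (∑' k, w k * U k) ^ n)
      + (l * (∑' k, wpow w φ s k * A k) * (∑' k, w k * A k) ^ (l - 1)) *
          ((∑' k, w k * F k) * (∑' k, w k * U k) ^ n)
      + (∑' k, w k * A k) ^ l * ((∑' k, w k * F k) *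
          (n * (∑' k, wpow w φ s k * U k) * (∑' k, w k * U k) ^ (n - 1)))) := by
  have hA : ∑' k, wpow w φ s k * A k = ∑' k, (w k * A k) * φ k ^ s :=
    tsum_congr fun k => by rw [wpow]; ring
  have hU : ∑' k, wpow w φ s k * U k = ∑' k, (w k * U k) * φ k ^ s :=
    tsum_congr fun k => by rw [wpow]; ring
  rw [hA, hU, ← tsum_prod_mul_sum (fun k => w k * A k) (fun k => φ k ^ s),
    ← tsum_prod_mul_sum (fun k => w k * U k) (fun k => φ k ^ s), ← tsum_prod_const,
    ← tsum_prod_const, ← tsum_mul_mul, ← tsum_mul_mul, ← tsum_mul_mul, ← ENNReal.tsum_add,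
    ← ENNReal.tsum_add, ← ENNReal.tsum_mul_left]
  refine ENNReal.tsum_le_tsum fun p => ?_
  refine (mul_le_mul_left (mul_le_mul' (hw.w_block_le p.1 p.2.1 p.2.2)
    (hw.φ_rpow_block_le hs p.1 p.2.1 p.2.2)) _).trans (le_of_eq ?_)
  simp only [Finset.prod_mul_distrib, wpow]
  ring

end IsWeight

/-! ### Principal values with uniform control -/

/-- The integral over `ε < |β| < π`. -/
def trunc (g : ℝ → ℂ) (ε : ℝ) : ℂ := (∫ β in (-Real.pi)..(-ε), g β) + ∫ β in ε..Real.pi, g β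

/-- The principal value of `g` exists and equals `v`; moreover `g` is `O(1/|β|)` and its truncated
integrals are bounded, both with the constant `C`. -/
structure PVB (g : ℝ → ℂ) (C : ℝ) (v : ℂ) : Prop where
  meas : AEStronglyMeasurable g (volume.restrict (Set.Ioc (-Real.pi) Real.pi))
  bound : ∀ β, β ≠ 0 → |β| ≤ Real.pi → ‖g β‖ ≤ C / |β|
  trunc_le : ∀ ε, 0 < ε → ε < Real.pi → ‖trunc g ε‖ ≤ C
  tendsto : Tendsto (trunc g) (𝓝[>] 0) (𝓝 v)

lemma eventually_lt_pi : ∀ᶠ ε : ℝ in 𝓝[>] 0, 0 < ε ∧ ε < Real.pi := by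
  have : Set.Ioo (0 : ℝ) Real.pi ∈ 𝓝[>] (0 : ℝ) := Ioo_mem_nhdsGT Real.pi_pos
  filter_upwards [this] with ε h using h

lemma trunc_congr {g h : ℝ → ℂ} (H : ∀ β, β ≠ 0 → |β| ≤ Real.pi → g β = h β) {ε : ℝ} (h0 : 0 < ε)
    (h1 : ε < Real.pi) : trunc g ε = trunc h ε := by
  unfold trunc
  congr 1
  · refine intervalIntegral.integral_congr fun β hβ => ?_
    rw [Set.uIcc_of_le (by linarith)] at hβ
    exact H β (by linarith [hβ.2]) (abs_le.2 ⟨hβ.1, by linarith [hβ.2]⟩)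
  · refine intervalIntegral.integral_congr fun β hβ => ?_
    rw [Set.uIcc_of_le (by linarith)] at hβ
    exact H β (by linarith [hβ.1]) (abs_le.2 ⟨by linarith [hβ.1], hβ.2⟩)

lemma ae_ne_zero_restrict (s : Set ℝ) (hs : MeasurableSet s) :
    ∀ᵐ β ∂(volume.restrict s), β ≠ 0 ∧ β ∈ s := by
  rw [ae_restrict_iff' hs]
  filter_upwards [Measure.ae_ne volume (0 : ℝ)] with β hβ hs using ⟨hβ, hs⟩

namespace PVB

variable {g h : ℝ → ℂ} {C D : ℝ} {v u : ℂ}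

lemma pv_eq (H : PVB g C v) : pv g = v := H.tendsto.limUnder_eq

lemma norm_le (H : PVB g C v) : ‖v‖ ≤ C := by
  refine le_of_tendsto H.tendsto.norm ?_
  filter_upwards [eventually_lt_pi] with ε h using H.trunc_le ε h.1 h.2

lemma nonneg (H : PVB g C v) : 0 ≤ C := (norm_nonneg _).trans H.norm_le

lemma congr (H : PVB g C v) (e : ∀ β, β ≠ 0 → |β| ≤ Real.pi → h β = g β) : PVB h C v where
  meas := by
    refine H.meas.congr ?_
    filter_upwards [ae_ne_zero_restrict _ measurableSet_Ioc] with β hβ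
    exact (e β hβ.1 (abs_le.2 ⟨hβ.2.1.le, hβ.2.2⟩)).symm
  bound β h0 h1 := by rw [e β h0 h1]; exact H.bound β h0 h1
  trunc_le ε h0 h1 := by rw [trunc_congr e h0 h1]; exact H.trunc_le ε h0 h1
  tendsto := by
    refine H.tendsto.congr' ?_
    filter_upwards [eventually_lt_pi] with ε hε
    exact (trunc_congr e hε.1 hε.2).symm

lemma mono (H : PVB g C v) (hC : C ≤ D) : PVB g D v where
  meas := H.meas
  bound β h0 h1 := (H.bound β h0 h1).trans (by gcongr)
  trunc_le ε h0 h1 := (H.trunc_le ε h0 h1).trans hC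
  tendsto := H.tendsto

lemma const_mul (H : PVB g C v) (c : ℂ) : PVB (fun β => c * g β) (‖c‖ * C) (c * v) := by
  have ht : trunc (fun β => c * g β) = fun ε => c * trunc g ε := by
    ext ε; simp only [trunc, intervalIntegral.integral_const_mul]; ring
  refine ⟨H.meas.const_mul c, fun β h0 h1 => ?_, fun ε h0 h1 => ?_, ?_⟩
  · rw [norm_mul, mul_div_assoc]
    exact mul_le_mul_of_nonneg_left (H.bound β h0 h1) (norm_nonneg _)
  · rw [ht, norm_mul]
    exact mul_le_mul_of_nonneg_left (H.trunc_le ε h0 h1) (norm_nonneg _)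
  · rw [ht]; exact H.tendsto.const_mul c

/-- On `ε ≤ |β| ≤ π` the `i`-th function is bounded by `K i / ε`, so dominated convergence applies
for each fixed `ε`. -/
lemma hasSum_trunc {ι : Type} [Countable ι] {f : ι → ℝ → ℂ} {K : ι → ℝ} {z : ι → ℂ}
    (H : ∀ i, PVB (f i) (K i) (z i)) (hK : Summable K)
    (hg : ∀ β, β ≠ 0 → |β| ≤ Real.pi → HasSum (fun i => f i β) (g β)) {ε : ℝ} (h0 : 0 < ε)
    (h1 : ε < Real.pi) : HasSum (fun i => trunc (f i) ε) (trunc g ε) := by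
  have aux : ∀ p q : ℝ, p ≤ q → -Real.pi ≤ p → q ≤ Real.pi → (∀ β ∈ Set.Ioc p q, ε ≤ |β|) →
      HasSum (fun i => ∫ β in p..q, f i β) (∫ β in p..q, g β) := by
    intro p q hpq hp hq hε
    refine intervalIntegral.hasSum_integral_of_dominated_convergence (fun i _ => K i / ε)
      (fun i => ?_) (fun i => ?_) ?_ intervalIntegrable_const ?_
    · rw [Set.uIoc_of_le hpq]
      exact (H i).meas.mono_measure (Measure.restrict_mono (Set.Ioc_subset_Ioc hp hq) le_rfl)
    · refine Eventually.of_forall fun β hβ => ?_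
      rw [Set.uIoc_of_le hpq] at hβ
      have h2 := hε β hβ
      have := (H i).nonneg
      exact ((H i).bound β (abs_pos.1 (h0.trans_le h2))
        (abs_le.2 ⟨hp.trans hβ.1.le, hβ.2.trans hq⟩)).trans (by gcongr)
    · exact Eventually.of_forall fun β _ => hK.div_const _
    · refine Eventually.of_forall fun β hβ => ?_
      rw [Set.uIoc_of_le hpq] at hβ
      exact hg β (abs_pos.1 (h0.trans_le (hε β hβ)))
        (abs_le.2 ⟨hp.trans hβ.1.le, hβ.2.trans hq⟩)
  refine (aux (-Real.pi) (-ε) (by linarith) le_rfl (by linarith) fun β hβ => ?_).add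
    (aux ε Real.pi h1.le (by linarith) le_rfl fun β hβ => ?_)
  · rw [abs_of_neg (by linarith [hβ.2])]; linarith [hβ.2]
  · exact hβ.1.le.trans (le_abs_self β)

/-- Termwise principal values of a normally convergent series. -/
lemma tsum {ι : Type} [Countable ι] {f : ι → ℝ → ℂ} {K : ι → ℝ} {z : ι → ℂ}
    (H : ∀ i, PVB (f i) (K i) (z i)) (hK : Summable K)
    (hg : ∀ β, β ≠ 0 → |β| ≤ Real.pi → HasSum (fun i => f i β) (g β)) :
    PVB g (∑' i, K i) (∑' i, z i) where
  meas := by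
    refine aestronglyMeasurable_of_tendsto_ae (atTop : Filter (Finset ι))
      (f := fun (s : Finset ι) β => ∑ i ∈ s, f i β) (fun s => ?_) ?_
    · exact Finset.aestronglyMeasurable_fun_sum s fun i _ => (H i).meas
    · filter_upwards [ae_ne_zero_restrict _ measurableSet_Ioc] with β hβ
      exact hg β hβ.1 (abs_le.2 ⟨hβ.2.1.le, hβ.2.2⟩)
  bound β h0 h1 := by
    rw [← (hg β h0 h1).tsum_eq, ← tsum_div_const]
    exact tsum_of_norm_bounded (hK.div_const _).hasSum fun i => (H i).bound β h0 h1
  trunc_le ε h0 h1 := by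
    rw [← (hasSum_trunc H hK hg h0 h1).tsum_eq]
    exact tsum_of_norm_bounded hK.hasSum fun i => (H i).trunc_le ε h0 h1
  tendsto := by
    -- The bound `K i / |β|` is not integrable at `0`. The limit `ε → 0` passes through the sum
    -- because the truncated integrals are bounded by `K i` uniformly in `ε`, which is why that
    -- bound belongs to `PVB`.
    have h1 : Tendsto (fun ε => ∑' i, trunc (f i) ε) (𝓝[>] 0) (𝓝 (∑' i, z i)) := by
      refine tendsto_tsum_of_dominated_convergence hK (fun i => (H i).tendsto) ?_
      filter_upwards [eventually_lt_pi] with ε h i using (H i).trunc_le ε h.1 h.2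
    refine h1.congr' ?_
    filter_upwards [eventually_lt_pi] with ε h
    exact (hasSum_trunc H hK hg h.1 h.2).tsum_eq

lemma add (H : PVB g C v) (H' : PVB h D u) : PVB (fun β => g β + h β) (C + D) (v + u) := by
  have := PVB.tsum (ι := Bool) (g := fun β => g β + h β) (f := fun i => if i then g else h)
    (K := fun i => if i then C else D)
    (z := fun i => if i then v else u) (fun i => by cases i <;> simpa) (hasSum_fintype _).summable
    (fun β _ _ => by
      have h1 := hasSum_fintype fun i : Bool => (if i then g else h) β
      simpa using h1)
  simpa [tsum_fintype] using this

lemma sub (H : PVB g C v) (H' : PVB h D u) : PVB (fun β => g β - h β) (C + D) (v - u) := by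
  simpa [sub_eq_add_neg] using H.add (H'.const_mul (-1))

/-- Averages. -/
lemma average {N : ℕ} (hN : N ≠ 0) {f : Fin N → ℝ → ℂ} {z : Fin N → ℂ}
    (H : ∀ i, PVB (f i) C (z i))
    (hg : ∀ β, β ≠ 0 → |β| ≤ Real.pi → g β = (1 / (N : ℂ)) * ∑ i, f i β) :
    PVB g C ((1 / (N : ℂ)) * ∑ i, z i) := by
  have h1 := (PVB.tsum H (hasSum_fintype _).summable
    (fun β _ _ => hasSum_fintype _)).const_mul (1 / (N : ℂ))
  rw [tsum_fintype, tsum_fintype] at h1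
  refine (h1.congr hg).mono (le_of_eq ?_)
  have : (N : ℝ) ≠ 0 := by exact_mod_cast hN
  simp
  field_simp

/-- Bounded functions. -/
lemma of_bounded (hm : AEStronglyMeasurable g (volume.restrict (Set.Ioc (-Real.pi) Real.pi)))
    (hb : ∀ β, β ≠ 0 → |β| ≤ Real.pi → ‖g β‖ ≤ D) :
    PVB g (2 * Real.pi * D) (∫ β in (-Real.pi)..Real.pi, g β) := by
  have hpi := Real.pi_pos
  have hD : 0 ≤ D := (norm_nonneg _).trans (hb Real.pi hpi.ne' (abs_of_pos hpi).le)
  have hint : IntegrableOn g (Set.Ioc (-Real.pi) Real.pi) := by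
    refine Integrable.of_bound hm D ?_
    filter_upwards [ae_ne_zero_restrict _ measurableSet_Ioc] with β hβ
    exact hb β hβ.1 (abs_le.2 ⟨hβ.2.1.le, hβ.2.2⟩)
  have hi : ∀ p q, -Real.pi ≤ p → p ≤ Real.pi → -Real.pi ≤ q → q ≤ Real.pi →
      IntervalIntegrable g volume p q := by
    intro p q h1 h2 h3 h4
    rw [intervalIntegrable_iff]
    exact hint.mono_set (Set.Ioc_subset_Ioc (le_min h1 h3) (max_le h2 h4))
  -- For a bounded function the truncation removes only `∫_{-ε}^{ε}`, which has size at most `2Dε`.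
  have htr : ∀ ε, 0 < ε → ε < Real.pi →
      trunc g ε = (∫ β in (-Real.pi)..Real.pi, g β) - ∫ β in (-ε)..ε, g β := by
    intro ε h0 h1
    rw [trunc, ← intervalIntegral.integral_add_adjacent_intervals
      (hi (-Real.pi) (-ε) le_rfl (by linarith) (by linarith) (by linarith))
      (hi (-ε) Real.pi (by linarith) (by linarith) (by linarith) le_rfl),
      ← intervalIntegral.integral_add_adjacent_intervals
      (hi (-ε) ε (by linarith) (by linarith) (by linarith) (by linarith))
      (hi ε Real.pi (by linarith) (by linarith) (by linarith) le_rfl)]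
    ring
  have hn : ∀ p q, -Real.pi ≤ p → p ≤ q → q ≤ Real.pi →
      ‖∫ β in p..q, g β‖ ≤ D * (q - p) := by
    intro p q h1 h2 h3
    rw [← abs_of_nonneg (sub_nonneg.2 h2)]
    refine intervalIntegral.norm_integral_le_of_norm_le_const_ae ?_
    filter_upwards [Measure.ae_ne volume (0 : ℝ)] with β hβ hm
    rw [Set.uIoc_of_le h2] at hm
    exact hb β hβ (abs_le.2 ⟨h1.trans hm.1.le, hm.2.trans h3⟩)
  refine ⟨hm, fun β h0 h1 => ?_, fun ε h0 h1 => ?_, ?_⟩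
  · refine (hb β h0 h1).trans ?_
    rw [le_div_iff₀ (abs_pos.2 h0)]
    nlinarith
  · refine (norm_add_le _ _).trans ?_
    have h2 := hn (-Real.pi) (-ε) le_rfl (by linarith) (by linarith)
    have h3 := hn ε Real.pi (by linarith) h1.le le_rfl
    nlinarith
  · have h2 : Tendsto (fun ε => ∫ β in (-ε)..ε, g β) (𝓝[>] 0) (𝓝 0) := by
      rw [tendsto_zero_iff_norm_tendsto_zero]
      refine squeeze_zero' (g := fun ε => D * (ε - -ε)) (Eventually.of_forall fun _ => norm_nonneg _) ?_ ?_
      · filter_upwards [eventually_lt_pi] with ε hε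
        exact hn (-ε) ε (by linarith) (by linarith) hε.2.le
      · have : Continuous fun ε : ℝ => D * (ε - -ε) := by fun_prop
        have := this.tendsto 0
        simp only [neg_zero, sub_zero, mul_zero] at this
        exact this.mono_left nhdsWithin_le_nhds
    have h3 := (tendsto_const_nhds (x := ∫ β in (-Real.pi)..Real.pi, g β)).sub h2
    rw [sub_zero] at h3
    refine h3.congr' ?_
    filter_upwards [eventually_lt_pi] with ε hε
    exact (htr ε hε.1 hε.2).symm

/-- Needed because the Hilbert transform uses a principal value in `ℝ`: limits of real truncated
integrals are real, so the complex value determines the real one. -/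
lemma pv_ofReal {f : ℝ → ℝ} (H : PVB (fun β => (f β : ℂ)) C v) : ((pv f : ℝ) : ℂ) = v := by
  have h1 : trunc (fun β => (f β : ℂ)) = fun ε =>
      (((∫ β in (-Real.pi)..(-ε), f β) + ∫ β in ε..Real.pi, f β : ℝ) : ℂ) := by
    ext ε; simp only [trunc, intervalIntegral.integral_ofReal]; push_cast; ring
  have h2 := H.tendsto
  rw [h1] at h2
  have h3 : v.im = 0 := by
    have := (Complex.continuous_im.tendsto v).comp h2
    refine tendsto_nhds_unique this ?_
    simp only [Function.comp_def, Complex.ofReal_im]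
    exact tendsto_const_nhds
  have h4 := (Complex.continuous_re.tendsto v).comp h2
  simp only [Function.comp_def, Complex.ofReal_re] at h4
  rw [show pv f = v.re from h4.limUnder_eq]
  exact Complex.ext (by simp) (by simp [h3])

end PVB

/-! ### Trigonometric inequalities -/

lemma mul_cos_le_sin {u : ℝ} (h0 : 0 ≤ u) (h1 : u ≤ Real.pi / 2) : u * Real.cos u ≤ Real.sin u := by
  rcases h1.lt_or_eq with h | h
  · have hc : 0 < Real.cos u := Real.cos_pos_of_mem_Ioo ⟨by linarith [Real.pi_pos], h⟩
    have := Real.le_tan h0 h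
    rwa [Real.tan_eq_sin_div_cos, le_div_iff₀ hc] at this
  · rw [h, Real.cos_pi_div_two, Real.sin_pi_div_two]; norm_num

/-- The difference of the two sides vanishes at `0` and has derivative `(y/3)(sin y - y cos y)`,
which is nonnegative by the preceding inequality. -/
lemma mul_cos_le_sin_mul {u : ℝ} (h0 : 0 ≤ u) (h1 : u ≤ Real.pi / 2) :
    u * Real.cos u ≤ Real.sin u * (1 - u ^ 2 / 3) := by
  have hd : ∀ y : ℝ, HasDerivAt (fun y => Real.sin y * (1 - y ^ 2 / 3) - y * Real.cos y)
      (y / 3 * (Real.sin y - y * Real.cos y)) y := by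
    intro y
    have h1 := (Real.hasDerivAt_sin y).mul (((hasDerivAt_pow 2 y).div_const 3).const_sub 1)
    have h2 := (hasDerivAt_id y).mul (Real.hasDerivAt_cos y)
    refine (h1.sub h2).congr_deriv ?_
    simp
    ring
  have hm : MonotoneOn (fun y => Real.sin y * (1 - y ^ 2 / 3) - y * Real.cos y)
      (Set.Icc 0 (Real.pi / 2)) := by
    refine monotoneOn_of_deriv_nonneg (convex_Icc _ _) ?_ ?_ ?_
    · exact fun y _ => (hd y).continuousAt.continuousWithinAt
    · exact fun y _ => (hd y).differentiableAt.differentiableWithinAt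
    · intro y hy
      rw [interior_Icc] at hy
      rw [(hd y).deriv]
      have := mul_cos_le_sin hy.1.le hy.2.le
      have := hy.1
      apply mul_nonneg <;> linarith
  have := hm ⟨le_rfl, by linarith⟩ ⟨h0, h1⟩ h0
  simp at this
  linarith

lemma sin_half_pos {β : ℝ} (h0 : 0 < β) (h1 : β ≤ Real.pi) : 0 < Real.sin (β / 2) :=
  Real.sin_pos_of_pos_of_lt_pi (by linarith) (by linarith)

lemma sin_half_ne_zero {β : ℝ} (h0 : β ≠ 0) (h1 : |β| ≤ Real.pi) : Real.sin (β / 2) ≠ 0 := by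
  rcases lt_or_gt_of_ne h0 with h | h
  · have := sin_half_pos (neg_pos.2 h) (by rwa [abs_of_neg h] at h1)
    rw [neg_div, Real.sin_neg] at this
    linarith
  · exact (sin_half_pos h (by rwa [abs_of_pos h] at h1)).ne'

lemma abs_le_pi_mul_abs_sin_half {β : ℝ} (h1 : |β| ≤ Real.pi) :
    |β| ≤ Real.pi * |Real.sin (β / 2)| := by
  have hp := Real.pi_pos
  have := Real.mul_abs_le_abs_sin (x := β / 2) (by rw [abs_div, abs_two]; linarith)
  rw [abs_div, abs_two] at this
  calc |β| = Real.pi * (2 / Real.pi * (|β| / 2)) := by field_simp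
    _ ≤ _ := by gcongr

/-- `β cot(β/2)` lies between `2 cos(β/2)` and `2 - β²/6`. -/
lemma mul_cot_half_bounds {β : ℝ} (h0 : 0 < β) (h1 : β ≤ Real.pi) :
    2 * Real.cos (β / 2) ≤ β * (Real.cos (β / 2) / Real.sin (β / 2)) ∧
      β * (Real.cos (β / 2) / Real.sin (β / 2)) ≤ 2 - β ^ 2 / 6 := by
  have hs := sin_half_pos h0 h1
  have hc : 0 ≤ Real.cos (β / 2) := Real.cos_nonneg_of_mem_Icc ⟨by linarith, by linarith⟩
  have h2 := mul_cos_le_sin_mul (u := β / 2) (by linarith) (by linarith)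
  have h3 := Real.sin_le (x := β / 2) (by linarith)
  rw [← mul_div_assoc]
  constructor
  · rw [le_div_iff₀ hs]; nlinarith
  · rw [div_le_iff₀ hs]; nlinarith

/-- Thus `cot(β/2)` equals `2/β` up to an error of at most `|β|/4`, which isolates the singular part
of the kernel. Evenness reduces the proof to `β > 0`. -/
lemma abs_mul_cot_half_sub_two_le {β : ℝ} (h0 : β ≠ 0) (h1 : |β| ≤ Real.pi) :
    |β * (Real.cos (β / 2) / Real.sin (β / 2)) - 2| ≤ β ^ 2 / 4 := by
  have key : ∀ γ : ℝ, 0 < γ → γ ≤ Real.pi →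
      |γ * (Real.cos (γ / 2) / Real.sin (γ / 2)) - 2| ≤ γ ^ 2 / 4 := by
    intro γ h0 h1
    obtain ⟨h2, h3⟩ := mul_cot_half_bounds h0 h1
    have h4 := Real.one_sub_sq_div_two_le_cos (x := γ / 2)
    rw [abs_le]
    constructor <;> nlinarith
  rcases lt_or_gt_of_ne h0 with h | h
  · have := key (-β) (by linarith) (by rwa [abs_of_neg h] at h1)
    rwa [neg_div, Real.cos_neg, Real.sin_neg, div_neg, neg_mul_neg, neg_sq] at this
  · exact key β h (by rwa [abs_of_pos h] at h1)

/-! ### The Dirichlet kernel -/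

/-- Integration by parts with the primitive `-cos t / t`: two boundary terms and `∫ cos t / t²` are
each at most `1` in modulus. -/
lemma norm_integral_sin_div_le_of_one_le {p q : ℝ} (hp : 1 ≤ p) (hpq : p ≤ q) :
    ‖∫ t in p..q, Real.sin t / t‖ ≤ 3 := by
  have hne : ∀ t ∈ Set.uIcc p q, t ≠ 0 := by
    intro t ht
    rw [Set.uIcc_of_le hpq] at ht
    linarith [ht.1]
  have hi1 : IntervalIntegrable (fun t => Real.sin t / t) volume p q :=
    (Real.continuous_sin.continuousOn.div continuousOn_id hne).intervalIntegrable
  have hi2 : IntervalIntegrable (fun t => Real.cos t / t ^ 2) volume p q :=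
    (Real.continuous_cos.continuousOn.div (continuousOn_id.pow 2)
      fun t ht => pow_ne_zero 2 (hne t ht)).intervalIntegrable
  have hi3 : IntervalIntegrable (fun t : ℝ => 1 / t ^ 2) volume p q :=
    (continuousOn_const.div (continuousOn_id.pow 2)
      fun t ht => pow_ne_zero 2 (hne t ht)).intervalIntegrable
  have h1 : ∫ t in p..q, (Real.sin t / t + Real.cos t / t ^ 2)
      = -Real.cos q / q - -Real.cos p / p := by
    refine intervalIntegral.integral_eq_sub_of_hasDerivAt (f := fun t => -Real.cos t / t)
      (fun t ht => ?_) (hi1.add hi2)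
    refine ((Real.hasDerivAt_cos t).neg.div (hasDerivAt_id t) (hne t ht)).congr_deriv ?_
    have := hne t ht
    simp
    field_simp
  have h2 : ∫ t in p..q, 1 / t ^ 2 = -1 / q - -1 / p := by
    refine intervalIntegral.integral_eq_sub_of_hasDerivAt (f := fun t => -1 / t)
      (fun t ht => ?_) hi3
    refine ((hasDerivAt_const t (-1 : ℝ)).div (hasDerivAt_id t) (hne t ht)).congr_deriv ?_
    simp
  have h3 : ‖∫ t in p..q, Real.cos t / t ^ 2‖ ≤ ∫ t in p..q, 1 / t ^ 2 := by
    refine intervalIntegral.norm_integral_le_of_norm_le hpq ?_ hi3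
    refine Eventually.of_forall fun t _ => ?_
    rw [norm_div, Real.norm_eq_abs, Real.norm_eq_abs, abs_of_nonneg (sq_nonneg t)]
    gcongr
    exact Real.abs_cos_le_one t
  rw [intervalIntegral.integral_add hi1 hi2] at h1
  have hp0 : 0 < p := by linarith
  have hq0 : 0 < q := by linarith
  have h4 : ∀ r : ℝ, 1 ≤ r → |Real.cos r / r| ≤ 1 := by
    intro r hr
    rw [abs_div, abs_of_pos (by linarith : 0 < r), div_le_one (by linarith)]
    exact (Real.abs_cos_le_one r).trans hr
  have h5 := abs_le.1 (h4 p hp)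
  have h6 := abs_le.1 (h4 q (hp.trans hpq))
  have h7 : 1 / p ≤ 1 := by rw [div_le_one hp0]; exact hp
  have h8 : 0 < 1 / q := by positivity
  rw [h2, Real.norm_eq_abs, abs_le] at h3
  simp only [neg_div] at h1 h3
  rw [Real.norm_eq_abs, abs_le]
  constructor <;> linarith [h3.1, h3.2, h5.1, h5.2, h6.1, h6.2]

lemma norm_integral_sin_div_le {p q : ℝ} (hp : 0 < p) (hpq : p ≤ q) :
    ‖∫ t in p..q, Real.sin t / t‖ ≤ 4 := by
  have small : ∀ r, p ≤ r → r ≤ 1 → ‖∫ t in p..r, Real.sin t / t‖ ≤ 1 := by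
    intro r h1 h2
    refine (intervalIntegral.norm_integral_le_of_norm_le_const (C := 1) fun t ht => ?_).trans ?_
    · rw [Set.uIoc_of_le h1] at ht
      have ht0 : 0 < t := hp.trans ht.1
      rw [norm_div, Real.norm_eq_abs, Real.norm_eq_abs, div_le_one (by positivity)]
      exact Real.abs_sin_le_abs
    · rw [one_mul, abs_of_nonneg (by linarith)]; linarith
  rcases le_total q 1 with h | h
  · exact (small q hpq h).trans (by norm_num)
  rcases le_total 1 p with h' | h'
  · exact (norm_integral_sin_div_le_of_one_le h' hpq).trans (by norm_num)
  · have hi : ∀ a c, 0 < a → a ≤ c → IntervalIntegrable (fun t => Real.sin t / t) volume a c := by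
      intro a c ha hac
      refine (Real.continuous_sin.continuousOn.div continuousOn_id fun t ht => ?_).intervalIntegrable
      rw [Set.uIcc_of_le hac] at ht
      exact (ha.trans_le ht.1).ne'
    rw [← intervalIntegral.integral_add_adjacent_intervals (hi p 1 hp h') (hi 1 q one_pos h)]
    refine (norm_add_le _ _).trans ?_
    linarith [small 1 h' le_rfl, norm_integral_sin_div_le_of_one_le le_rfl h]

/-- The measure `dt/t` is scale invariant, so the bound is uniform in the frequency `k`. -/
lemma norm_integral_sin_mul_div_le (k : ℤ) {p q : ℝ} (hp : 0 < p) (hpq : p ≤ q) :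
    ‖∫ t in p..q, Real.sin (k * t) / t‖ ≤ 4 := by
  have pos : ∀ m : ℝ, 0 < m → ‖∫ t in p..q, Real.sin (m * t) / t‖ ≤ 4 := by
    intro m hm
    have h1 := intervalIntegral.integral_comp_mul_left (a := p) (b := q)
      (fun t => Real.sin t / t) hm.ne'
    have h2 : (fun t => Real.sin (m * t) / t) = fun t => m * (Real.sin (m * t) / (m * t)) := by
      ext t; field_simp
    rw [h2, intervalIntegral.integral_const_mul, h1, smul_eq_mul, mul_inv_cancel_left₀ hm.ne']
    exact norm_integral_sin_div_le (by positivity) (by gcongr)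
  rcases lt_trichotomy k 0 with h | h | h
  · have h1 := pos (-k) (by exact_mod_cast neg_pos.2 h)
    simpa only [neg_mul, Real.sin_neg, neg_div, intervalIntegral.integral_neg, norm_neg] using h1
  · simp [h]
  · exact pos k (by exact_mod_cast h)

/-! ### The kernel `1 / (1 - e^{-iβ})` -/

/-- The kernel `1 / (1 - e^{-iβ})`. -/
def ker (β : ℝ) : ℂ := 1 / (1 - Complex.exp (-Complex.I * (β : ℂ)))

lemma one_sub_exp_eq (β : ℝ) : 1 - Complex.exp (-Complex.I * (β : ℂ)) =
    2 * (Real.sin (β / 2) : ℂ) * ((Real.sin (β / 2) : ℂ) + Complex.I * (Real.cos (β / 2) : ℂ)) := by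
  have h1 : -Complex.I * (β : ℂ) = ((-β : ℝ) : ℂ) * Complex.I := by push_cast; ring
  rw [h1, Complex.exp_mul_I, ← Complex.ofReal_cos, ← Complex.ofReal_sin]
  have h2 : Real.cos (-β) = 1 - 2 * Real.sin (β / 2) ^ 2 := by
    have h3 := Real.cos_two_mul (β / 2)
    rw [mul_div_cancel₀ _ two_ne_zero] at h3
    rw [Real.cos_neg, h3, Real.cos_sq']; ring
  have h3 : Real.sin (-β) = -(2 * Real.sin (β / 2) * Real.cos (β / 2)) := by
    rw [Real.sin_neg, ← Real.sin_two_mul, mul_div_cancel₀ _ two_ne_zero]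
  rw [h2, h3]
  push_cast
  ring

lemma sin_add_I_cos_ne_zero (u : ℝ) : (Real.sin u : ℂ) + Complex.I * (Real.cos u : ℂ) ≠ 0 := by
  intro h
  have h1 := congrArg Complex.re h
  have h2 := congrArg Complex.im h
  simp [-Complex.ofReal_sin, -Complex.ofReal_cos] at h1 h2
  have := Real.sin_sq_add_cos_sq u
  rw [h1, h2] at this
  norm_num at this

lemma one_sub_exp_ne_zero {β : ℝ} (h0 : β ≠ 0) (h1 : |β| ≤ Real.pi) :
    1 - Complex.exp (-Complex.I * (β : ℂ)) ≠ 0 := by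
  rw [one_sub_exp_eq]
  have : (Real.sin (β / 2) : ℂ) ≠ 0 := by exact_mod_cast sin_half_ne_zero h0 h1
  exact mul_ne_zero (mul_ne_zero two_ne_zero this) (sin_add_I_cos_ne_zero _)

/-- Separates the kernel into its even part `1/2` and its odd singular part, a multiple of
`cot(β/2)`. -/
lemma ker_eq {β : ℝ} (h0 : β ≠ 0) (h1 : |β| ≤ Real.pi) :
    ker β = 1 / 2 - Complex.I / 2 * ((Real.cos (β / 2) / Real.sin (β / 2) : ℝ) : ℂ) := by
  have hs : (Real.sin (β / 2) : ℂ) ≠ 0 := by exact_mod_cast sin_half_ne_zero h0 h1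
  have hsc := sin_add_I_cos_ne_zero (β / 2)
  have h2 : (Real.sin (β / 2) : ℂ) ^ 2 + (Real.cos (β / 2) : ℂ) ^ 2 = 1 := by
    exact_mod_cast Real.sin_sq_add_cos_sq (β / 2)
  rw [ker, one_sub_exp_eq, Complex.ofReal_div,
    div_eq_iff (mul_ne_zero (mul_ne_zero two_ne_zero hs) hsc)]
  generalize (Real.sin (β / 2) : ℂ) = S at *
  generalize (Real.cos (β / 2) : ℂ) = c at *
  field_simp
  ring_nf
  simp only [Complex.I_sq]
  linear_combination -h2

lemma norm_ker {β : ℝ} : ‖ker β‖ = 1 / (2 * |Real.sin (β / 2)|) := by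
  rw [ker, one_sub_exp_eq, norm_div, norm_one, norm_mul, norm_mul, Complex.norm_real,
    Real.norm_eq_abs]
  have : ‖(Real.sin (β / 2) : ℂ) + Complex.I * (Real.cos (β / 2) : ℂ)‖ = 1 := by
    rw [mul_comm Complex.I, Complex.norm_add_mul_I, Real.sin_sq_add_cos_sq, Real.sqrt_one]
  rw [this]; simp

lemma norm_ker_le {β : ℝ} (h0 : β ≠ 0) (h1 : |β| ≤ Real.pi) : ‖ker β‖ ≤ Real.pi / 2 / |β| := by
  have hp := Real.pi_pos
  have hs := abs_pos.2 (sin_half_ne_zero h0 h1)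
  have hb := abs_pos.2 h0
  rw [norm_ker, div_div, div_le_div_iff₀ (by positivity) (by positivity)]
  nlinarith [abs_le_pi_mul_abs_sin_half h1]

@[fun_prop]
lemma measurable_ker : Measurable ker := by unfold ker; fun_prop

lemma continuousOn_ker : ContinuousOn ker {β | β ≠ 0 ∧ |β| ≤ Real.pi} := by
  unfold ker
  refine ContinuousOn.div (by fun_prop) (by fun_prop) fun β hβ => one_sub_exp_ne_zero hβ.1 hβ.2

/-! ### Principal values of the base exponentials -/

lemma trunc_eq_symm {g : ℝ → ℂ} (hg : ContinuousOn g {β | β ≠ 0 ∧ |β| ≤ Real.pi}) {ε : ℝ}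
    (h0 : 0 < ε) (h1 : ε < Real.pi) : trunc g ε = ∫ β in ε..Real.pi, (g β + g (-β)) := by
  have hi : IntervalIntegrable g volume ε Real.pi := by
    refine (hg.mono fun β hβ => ?_).intervalIntegrable
    rw [Set.uIcc_of_le h1.le] at hβ
    exact ⟨by linarith [hβ.1], abs_le.2 ⟨by linarith [hβ.1], hβ.2⟩⟩
  have hi' : IntervalIntegrable (fun β => g (-β)) volume ε Real.pi := by
    refine ContinuousOn.intervalIntegrable (hg.comp continuousOn_neg fun β hβ => ?_)
    rw [Set.uIcc_of_le h1.le] at hβ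
    exact ⟨by linarith [hβ.1], abs_le.2 ⟨by linarith [hβ.2], by linarith [hβ.1]⟩⟩
  rw [intervalIntegral.integral_add hi hi', intervalIntegral.integral_comp_neg, trunc, add_comm]

lemma mode_eq (k : ℤ) (β : ℝ) :
    mode k β = (Real.cos (k * β) : ℂ) + Complex.I * (Real.sin (k * β) : ℂ) := by
  rw [mode, show Complex.I * (k : ℂ) * (β : ℂ) = ((k * β : ℝ) : ℂ) * Complex.I by push_cast; ring,
    Complex.exp_mul_I, Complex.ofReal_cos, Complex.ofReal_sin, mul_comm Complex.I]

lemma mode_ker_symm (q : ℤ) {β : ℝ} (h0 : β ≠ 0) (h1 : |β| ≤ Real.pi) :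
    mode (-q) β * ker β + mode (-q) (-β) * ker (-β) =
      ((Real.cos (q * β) - Real.sin (q * β) * (Real.cos (β / 2) / Real.sin (β / 2)) : ℝ) : ℂ) := by
  rw [ker_eq h0 h1, ker_eq (neg_ne_zero.2 h0) (by rwa [abs_neg]), mode_neg_right, neg_neg,
    mode_eq, mode_eq, neg_div, Real.cos_neg, Real.sin_neg, div_neg]
  have : ((-q : ℤ) : ℝ) * β = -(q * β) := by push_cast; ring
  rw [this, Real.cos_neg, Real.sin_neg]
  generalize Real.cos (β / 2) / Real.sin (β / 2) = c
  push_cast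
  ring_nf
  simp only [Complex.I_sq]
  ring

lemma continuousOn_mode_ker (q : ℤ) :
    ContinuousOn (fun β => mode q β * ker β) {β | β ≠ 0 ∧ |β| ≤ Real.pi} :=
  (continuous_mode q).continuousOn.mul continuousOn_ker

/-- Folding onto `[ε, π]` leaves `cos(qβ) - sin(qβ) cot(β/2)`. Replacing `cot(β/2)` by `2/β` leaves
a function bounded by `1 + β/4 ≤ 2`, whose integral is at most `8`; the Dirichlet integral
contributes `2 · 4`. Hence `16`. -/
lemma norm_trunc_mode_ker_le (q : ℤ) {ε : ℝ} (h0 : 0 < ε) (h1 : ε < Real.pi) :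
    ‖trunc (fun β => mode (-q) β * ker β) ε‖ ≤ 16 := by
  have hpi := Real.pi_le_four
  have hsin : ∀ β ∈ Set.uIcc ε Real.pi, 0 < β ∧ β ≤ Real.pi := by
    intro β hβ
    rw [Set.uIcc_of_le h1.le] at hβ
    exact ⟨h0.trans_le hβ.1, hβ.2⟩
  rw [trunc_eq_symm (continuousOn_mode_ker _) h0 h1]
  have e1 : ∫ β in ε..Real.pi, (mode (-q) β * ker β + mode (-q) (-β) * ker (-β)) =
      ((∫ β in ε..Real.pi, ((Real.cos (q * β) - Real.sin (q * β) / β *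
        (β * (Real.cos (β / 2) / Real.sin (β / 2)) - 2)) - 2 * (Real.sin (q * β) / β)) : ℝ) : ℂ) := by
    rw [← intervalIntegral.integral_ofReal]
    refine intervalIntegral.integral_congr fun β hβ => ?_
    obtain ⟨h2, h3⟩ := hsin β hβ
    rw [mode_ker_symm q h2.ne' (by rwa [abs_of_pos h2])]
    congr 1
    field_simp
    ring
  have hc : ContinuousOn (fun β : ℝ => Real.sin (q * β) / β) (Set.uIcc ε Real.pi) :=
    ContinuousOn.div (by fun_prop) (by fun_prop) fun β hβ => (hsin β hβ).1.ne'
  have hc2 : ContinuousOn (fun β : ℝ => Real.cos (β / 2) / Real.sin (β / 2))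
      (Set.uIcc ε Real.pi) :=
    ContinuousOn.div (by fun_prop) (by fun_prop) fun β hβ =>
      (sin_half_pos (hsin β hβ).1 (hsin β hβ).2).ne'
  have hc3 : ContinuousOn (fun β : ℝ => Real.cos (q * β) - Real.sin (q * β) / β *
        (β * (Real.cos (β / 2) / Real.sin (β / 2)) - 2)) (Set.uIcc ε Real.pi) := by fun_prop
  have hb : ‖∫ β in ε..Real.pi, (Real.cos (q * β) - Real.sin (q * β) / β *
        (β * (Real.cos (β / 2) / Real.sin (β / 2)) - 2))‖ ≤ 2 * |Real.pi - ε| := by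
    refine intervalIntegral.norm_integral_le_of_norm_le_const fun β hβ => ?_
    obtain ⟨h2, h3⟩ := hsin β (Set.uIoc_subset_uIcc hβ)
    have h4 := abs_mul_cot_half_sub_two_le h2.ne' (by rwa [abs_of_pos h2])
    have h5 := Real.abs_cos_le_one (q * β)
    have h6 := Real.abs_sin_le_one (q * β)
    refine (norm_sub_le _ _).trans ?_
    rw [norm_mul, norm_div, Real.norm_eq_abs, Real.norm_eq_abs, Real.norm_eq_abs, Real.norm_eq_abs,
      abs_of_pos h2]
    have h7 : |Real.sin (q * β)| / β * |β * (Real.cos (β / 2) / Real.sin (β / 2)) - 2|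
        ≤ 1 / β * (β ^ 2 / 4) := by gcongr
    have h8 : 1 / β * (β ^ 2 / 4) = β / 4 := by field_simp
    linarith
  rw [e1, Complex.norm_real, intervalIntegral.integral_sub hc3.intervalIntegrable
    (hc.intervalIntegrable.const_mul 2), intervalIntegral.integral_const_mul]
  refine (norm_sub_le _ _).trans ?_
  rw [norm_mul, Real.norm_ofNat]
  rw [abs_of_pos (by linarith)] at hb
  linarith [norm_integral_sin_mul_div_le q h0 h1.le]

/-- The value of `pv ∫ e^{-iqβ} / (1 - e^{-iβ}) dβ`. -/
def halfSign (q : ℤ) : ℂ := if q ≤ 0 then (Real.pi : ℂ) else -(Real.pi : ℂ)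

lemma norm_halfSign (q : ℤ) : ‖halfSign q‖ = Real.pi := by
  unfold halfSign
  split_ifs <;> simp [abs_of_pos Real.pi_pos]

lemma pvb_mode (q : ℤ) : PVB (mode (-q)) (2 * Real.pi * 1) (if q = 0 then 2 * (Real.pi : ℂ) else 0) := by
  have := PVB.of_bounded (g := mode (-q)) (D := 1) (continuous_mode _).aestronglyMeasurable
    fun β _ _ => (norm_mode _ _).le
  rw [integral_mode] at this
  simpa using this

lemma tendsto_trunc_mode_ker (q : ℤ) :
    Tendsto (trunc fun β => mode (-q) β * ker β) (𝓝[>] 0) (𝓝 (halfSign q)) := by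
  -- From `1/(1-E) = E/(1-E) + 1` with `E = e^{-iβ}`, consecutive frequencies differ by the
  -- truncated integral of an exponential. The limit is therefore constant in `q` except for a jump
  -- of `2π` between `0` and `1`.
  have step : ∀ q : ℤ, ∀ ε, 0 < ε → ε < Real.pi → trunc (fun β => mode (-q) β * ker β) ε =
      trunc (fun β => mode (-(q + 1)) β * ker β) ε + trunc (mode (-q)) ε := by
    intro q ε h0 h1
    have hI : ∀ f : ℝ → ℂ, ContinuousOn f {β | β ≠ 0 ∧ |β| ≤ Real.pi} →
        IntervalIntegrable f volume (-Real.pi) (-ε) ∧ IntervalIntegrable f volume ε Real.pi := by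
      intro f hf
      constructor
      · refine (hf.mono fun β hβ => ?_).intervalIntegrable
        rw [Set.uIcc_of_le (by linarith)] at hβ
        exact ⟨by linarith [hβ.2], abs_le.2 ⟨by linarith [hβ.1], by linarith [hβ.2]⟩⟩
      · refine (hf.mono fun β hβ => ?_).intervalIntegrable
        rw [Set.uIcc_of_le h1.le] at hβ
        exact ⟨by linarith [hβ.1], abs_le.2 ⟨by linarith [hβ.1], hβ.2⟩⟩
    have i1 := hI _ (continuousOn_mode_ker (-(q + 1)))
    have i2 := hI _ (continuous_mode (-q)).continuousOn
    have e : trunc (fun β => mode (-q) β * ker β) ε =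
        trunc (fun β => mode (-(q + 1)) β * ker β + mode (-q) β) ε := by
      refine trunc_congr (fun β hb0 hb1 => ?_) h0 h1
      have h2 := one_sub_exp_ne_zero hb0 hb1
      have h3 : mode (-(q + 1)) β = mode (-q) β * Complex.exp (-Complex.I * (β : ℂ)) := by
        rw [show -(q + 1) = -q + -1 by ring, mode_add]
        congr 1
        rw [mode]; congr 1; push_cast; ring
      rw [h3, ker]
      generalize Complex.exp (-Complex.I * (β : ℂ)) = E at *
      field_simp
      ring
    rw [e]
    simp only [trunc]
    rw [intervalIntegral.integral_add i1.1 i2.1, intervalIntegral.integral_add i1.2 i2.2]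
    ring
  have hs : ∀ q : ℤ, halfSign q = halfSign (q + 1) + if q = 0 then 2 * (Real.pi : ℂ) else 0 := by
    intro q
    unfold halfSign
    rcases lt_trichotomy q 0 with h | h | h
    · rw [if_pos h.le, if_pos (by lia), if_neg h.ne, add_zero]
    · subst h; simp; ring
    · rw [if_neg (by lia), if_neg (by lia), if_neg h.ne', add_zero]
  induction q using Int.induction_on with
  -- Base case: for `q = 0` the folded integrand is `1`, so the truncated integral is exactly `π -
  -- ε`.
  | zero =>
    have h1 : Tendsto (fun ε : ℝ => ((Real.pi - ε : ℝ) : ℂ)) (𝓝[>] 0) (𝓝 (halfSign 0)) := by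
      have : Continuous fun ε : ℝ => ((Real.pi - ε : ℝ) : ℂ) := by fun_prop
      have := this.tendsto 0
      simp only [sub_zero] at this
      simpa [halfSign] using this.mono_left nhdsWithin_le_nhds
    refine h1.congr' ?_
    filter_upwards [eventually_lt_pi] with ε hε
    rw [trunc_eq_symm (continuousOn_mode_ker _) hε.1 hε.2, intervalIntegral.integral_congr
      (g := fun _ => (1 : ℂ)) fun β hβ => ?_]
    · simp
    · rw [Set.uIcc_of_le hε.2.le] at hβ
      have hb : 0 < β := hε.1.trans_le hβ.1
      simp only
      rw [mode_ker_symm 0 hb.ne' (by rw [abs_of_pos hb]; exact hβ.2)]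
      simp
  | succ q ih =>
    have h1 := ih.sub (pvb_mode q).tendsto
    rw [hs, add_sub_cancel_right] at h1
    refine h1.congr' ?_
    filter_upwards [eventually_lt_pi] with ε hε
    rw [step q ε hε.1 hε.2]; ring
  | pred q ih =>
    have h1 := ih.add (pvb_mode (-q - 1)).tendsto
    have h2 := hs (-q - 1)
    rw [sub_add_cancel] at h2
    rw [← h2] at h1
    refine h1.congr' ?_
    filter_upwards [eventually_lt_pi] with ε hε
    rw [step (-q - 1) ε hε.1 hε.2, sub_add_cancel]

lemma pvb_mode_ker (q : ℤ) : PVB (fun β => mode (-q) β * ker β) 16 (halfSign q) where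
  meas := ((continuous_mode _).measurable.mul measurable_ker).aestronglyMeasurable
  bound β h0 h1 := by
    rw [norm_mul, norm_mode, one_mul]
    have := Real.pi_le_four
    exact (norm_ker_le h0 h1).trans (by gcongr; linarith)
  trunc_le ε h0 h1 := norm_trunc_mode_ker_le q h0 h1
  tendsto := tendsto_trunc_mode_ker q

/-! ### Multipliers -/

/-- The factor `iβ / (1 - e^{-iβ})`. -/
def kerMul (β : ℝ) : ℂ := Complex.I * (β : ℂ) * ker β

/-- The average `∫_0^1 e^{iK(s-1)β} ds`. -/
def psi (K : ℤ) (β : ℝ) : ℂ := ∫ s in (0 : ℝ)..1, mode K ((s - 1) * β)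

@[fun_prop]
lemma measurable_kerMul : Measurable kerMul := by unfold kerMul; fun_prop

lemma kerMul_eq {β : ℝ} (h0 : β ≠ 0) (h1 : |β| ≤ Real.pi) :
    kerMul β = ((β * (Real.cos (β / 2) / Real.sin (β / 2)) / 2 : ℝ) : ℂ) +
      ((β / 2 : ℝ) : ℂ) * Complex.I := by
  rw [kerMul, ker_eq h0 h1]
  push_cast
  ring_nf
  simp only [Complex.I_sq]
  ring

lemma norm_kerMul_le {β : ℝ} (h0 : β ≠ 0) (h1 : |β| ≤ Real.pi) : ‖kerMul β‖ ≤ Real.pi / 2 := by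
  have := norm_ker_le h0 h1
  rw [le_div_iff₀ (abs_pos.2 h0)] at this
  rw [kerMul, norm_mul, norm_mul, Complex.norm_I, one_mul, Complex.norm_real, Real.norm_eq_abs]
  linarith

/-- The real part of `kerMul β - 1` is at most `β²/8` in modulus and the imaginary part is `β/2`.
With `|β| ≤ π` this leaves room for the factor `√(1 + π²/4)` required by `C̃`. -/
lemma norm_kerMul_sub_one_le {β : ℝ} (h0 : β ≠ 0) (h1 : |β| ≤ Real.pi) :
    ‖kerMul β - 1‖ ≤ |β| / 2 * √(1 + Real.pi ^ 2 / 4) := by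
  have hb := abs_mul_cot_half_sub_two_le h0 h1
  rw [kerMul_eq h0 h1, add_sub_right_comm, ← Complex.ofReal_one, ← Complex.ofReal_sub,
    Complex.norm_add_mul_I]
  have h2 : |β| / 2 * √(1 + Real.pi ^ 2 / 4) = √((|β| / 2) ^ 2 * (1 + Real.pi ^ 2 / 4)) := by
    rw [Real.sqrt_mul (sq_nonneg _), Real.sqrt_sq (by positivity)]
  rw [h2]
  apply Real.sqrt_le_sqrt
  have h3 : (β * (Real.cos (β / 2) / Real.sin (β / 2)) - 2) ^ 2 ≤ (β ^ 2 / 4) ^ 2 :=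
    sq_le_sq' (by linarith [(abs_le.1 hb).1]) (abs_le.1 hb).2
  have h4 : β ^ 2 ≤ Real.pi ^ 2 := by rw [← sq_abs β]; gcongr
  rw [show (|β| / 2) ^ 2 = β ^ 2 / 4 by rw [div_pow, sq_abs]; norm_num]
  nlinarith [mul_nonneg (sq_nonneg β) (sub_nonneg.2 h4), mul_nonneg (sq_nonneg β) (sq_nonneg Real.pi)]

lemma psi_zero (β : ℝ) : psi 0 β = 1 := by simp [psi, mode_zero]

lemma psi_eq {K : ℤ} (hK : K ≠ 0) {β : ℝ} (h0 : β ≠ 0) :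
    psi K β = (1 - mode (-K) β) / (Complex.I * K * β) := by
  have hc : Complex.I * (K : ℂ) * (β : ℂ) ≠ 0 := by simp [hK, h0]
  have h1 : ∀ s : ℝ, mode K ((s - 1) * β) =
      mode (-K) β * Complex.exp (Complex.I * K * β * s) := by
    intro s
    rw [mode, mode, ← Complex.exp_add]
    congr 1; push_cast; ring
  simp only [psi, h1]
  rw [intervalIntegral.integral_const_mul, integral_exp_mul_complex hc]
  have h2 : mode (-K) β * Complex.exp (Complex.I * K * β) = 1 := by
    rw [mode, ← Complex.exp_add]
    convert Complex.exp_zero using 2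
    push_cast; ring
  simp only [Complex.ofReal_one, Complex.ofReal_zero, mul_one, mul_zero, Complex.exp_zero]
  rw [← mul_div_assoc, mul_sub, h2, mul_one]

lemma norm_psi_le (K : ℤ) (β : ℝ) : ‖psi K β‖ ≤ 1 := by
  have := intervalIntegral.norm_integral_le_of_norm_le_const (a := (0 : ℝ)) (b := 1) (C := 1)
    (f := fun s => mode K ((s - 1) * β)) fun s _ => (norm_mode _ _).le
  simpa [psi] using this

lemma mode_neg_natCast (i : ℕ) (β : ℝ) :
    mode (-(i : ℤ)) β = Complex.exp (-Complex.I * (β : ℂ)) ^ i := by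
  rw [mode, ← Complex.exp_nat_mul]
  congr 1; push_cast; ring

/-- The product is `(1 - e^{-iKβ}) / (K(1 - e^{-iβ}))`: the singular denominators cancel, and a
finite geometric sum of `|K|` exponentials divided by `|K|` is left. -/
lemma kerMul_mul_psi {K : ℤ} (hK : K ≠ 0) :
    ∃ N : ℕ, N ≠ 0 ∧ ∃ c : Fin N → ℤ, ∀ β : ℝ, β ≠ 0 → |β| ≤ Real.pi →
      kerMul β * psi K β = 1 / (N : ℂ) * ∑ i, mode (c i) β := by
  have base : ∀ β : ℝ, β ≠ 0 → |β| ≤ Real.pi → kerMul β * psi K β = (1 - mode (-K) β) * ker β / K := by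
    intro β h0 h1
    have hb : (β : ℂ) ≠ 0 := by exact_mod_cast h0
    have hk : (K : ℂ) ≠ 0 := by exact_mod_cast hK
    rw [psi_eq hK h0, kerMul]
    field_simp
  have geom : ∀ (n : ℕ) (β : ℝ), β ≠ 0 → |β| ≤ Real.pi →
      (1 - mode (-(n : ℤ)) β) * ker β = ∑ i : Fin n, mode (-(i : ℤ)) β := by
    intro n β h0 h1
    have h2 := one_sub_exp_ne_zero h0 h1
    simp only [mode_neg_natCast]
    rw [Fin.sum_univ_eq_sum_range (fun i => Complex.exp (-Complex.I * (β : ℂ)) ^ i),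
      ← geom_sum_mul_neg, ker, mul_assoc, mul_one_div_cancel h2, mul_one]
  rcases lt_or_gt_of_ne hK with h | h
  · obtain ⟨n, hn⟩ := Int.eq_ofNat_of_zero_le (neg_nonneg.2 h.le)
    have hn0 : n ≠ 0 := by rintro rfl; simp at hn; exact hK hn
    -- For `K = -n`, extracting `e^{inβ}` reduces to the positive case and shifts its frequencies
    -- `0, …, -(n-1)` to `n, …, 1`.
    refine ⟨n, hn0, fun i => (n : ℤ) + -(i : ℤ), fun β h0 h1 => ?_⟩
    have hK' : (K : ℂ) = -(n : ℂ) := by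
      have : K = -(n : ℤ) := by lia
      rw [this]; push_cast; rfl
    have hm : mode (n : ℤ) β * mode (-(n : ℤ)) β = 1 := by rw [← mode_add, add_neg_cancel, mode_zero]
    rw [base β h0 h1, hn, hK']
    simp only [mode_add _ (-_), ← Finset.mul_sum]
    rw [← geom n β h0 h1]
    linear_combination (1 / (n : ℂ) * ker β) * hm
  · obtain ⟨n, hn⟩ := Int.eq_ofNat_of_zero_le h.le
    have hn0 : n ≠ 0 := by rintro rfl; simp at hn; exact hK hn
    refine ⟨n, hn0, fun i => -(i : ℤ), fun β h0 h1 => ?_⟩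
    rw [base β h0 h1, hn, ← geom n β h0 h1]
    push_cast
    ring

/-- Every modulation of `k` has a principal value bounded by `μ`. -/
def ModBound (k : ℝ → ℂ) (C μ : ℝ) : Prop :=
  ∀ q : ℤ, ∃ v : ℂ, ‖v‖ ≤ μ ∧ PVB (fun β => mode q β * k β) C v

lemma modBound_ker : ModBound ker 16 Real.pi := by
  intro q
  refine ⟨halfSign (-q), (norm_halfSign _).le, ?_⟩
  simpa using pvb_mode_ker (-q)

/-- Averaging exponentials only averages modulations of `k`. A bound uniform over all modulations
therefore survives with the same constants, independently of the number of terms averaged. -/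
lemma ModBound.mul_average {k : ℝ → ℂ} {C μ : ℝ} (hk : ModBound k C μ) {K : ℤ} (hK : K ≠ 0) :
    ModBound (fun β => kerMul β * psi K β * k β) C μ := by
  intro q
  obtain ⟨N, hN, c, hc⟩ := kerMul_mul_psi hK
  choose v hv hp using fun i : Fin N => hk (q + c i)
  refine ⟨_, ?_, PVB.average hN hp fun β h0 h1 => ?_⟩
  · rw [norm_mul, norm_div, norm_one, Complex.norm_natCast]
    have h1 : ‖∑ i, v i‖ ≤ N * μ := by
      refine (norm_sum_le _ _).trans ((Finset.sum_le_sum fun i _ => hv i).trans ?_)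
      simp
    have hN' : (0 : ℝ) < N := by exact_mod_cast Nat.pos_of_ne_zero hN
    calc 1 / (N : ℝ) * ‖∑ i, v i‖ ≤ 1 / (N : ℝ) * (N * μ) := by gcongr
      _ = μ := by field_simp
  · simp only
    rw [hc β h0 h1]
    simp only [mode_add, Finset.mul_sum, Finset.sum_mul]
    exact Finset.sum_congr rfl fun i _ => by ring

/-! ### The constant `C̃` -/

/-- The pointwise bound of `(m - 1) / (1 - e^{-iβ})`. -/
def kerBound (β : ℝ) : ℝ :=
  √(1 + Real.pi ^ 2 / 4) / 2 * ((β / 2) / Real.sin (β / 2))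

lemma catalan_nonneg : 0 ≤ catalan := by
  unfold catalan
  have hp := Real.pi_pos
  refine mul_nonneg (by norm_num) (intervalIntegral.integral_nonneg (by linarith) fun β hβ => ?_)
  rcases le_total 0 β with h | h
  · exact div_nonneg h (Real.sin_nonneg_of_nonneg_of_le_pi h (by linarith [hβ.2]))
  · exact div_nonneg_of_nonpos h (Real.sin_nonpos_of_nonpos_of_neg_pi_le h (by linarith [hβ.1]))

lemma Ctilde_nonneg : 0 ≤ Ctilde := by
  have := catalan_nonneg
  have := Real.pi_pos
  unfold Ctilde
  positivity

/-- The substitution `u = β/2` turns the integral into the one defining `catalan`; this fixes the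
normalization of `Ctilde`. -/
lemma integral_kerBound : ∫ β in (-Real.pi)..Real.pi, kerBound β = Real.pi * Ctilde := by
  have h := intervalIntegral.integral_comp_div (a := -Real.pi) (b := Real.pi)
    (fun u => u / Real.sin u) (two_ne_zero' ℝ)
  simp only [kerBound]
  rw [intervalIntegral.integral_const_mul, h, Ctilde, catalan, smul_eq_mul, neg_div]
  have := Real.pi_ne_zero
  field_simp

lemma kerBound_eq_abs (β : ℝ) (h1 : |β| ≤ Real.pi) : kerBound β =
    |β| / 2 * √(1 + Real.pi ^ 2 / 4) * (1 / (2 * |Real.sin (β / 2)|)) := by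
  have : β / Real.sin (β / 2) = |β| / |Real.sin (β / 2)| := by
    rw [← abs_div]
    symm
    apply abs_of_nonneg
    obtain ⟨h2, h3⟩ := abs_le.1 h1
    rcases le_total 0 β with h | h
    · exact div_nonneg h (Real.sin_nonneg_of_nonneg_of_le_pi (by linarith) (by linarith))
    · exact div_nonneg_of_nonpos h
        (Real.sin_nonpos_of_nonpos_of_neg_pi_le (by linarith) (by linarith))
  rw [kerBound, div_right_comm, this]
  ring

lemma kerBound_le {β : ℝ} (h1 : |β| ≤ Real.pi) :
    ‖kerBound β‖ ≤ √(1 + Real.pi ^ 2 / 4) * Real.pi := by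
  have hp := Real.pi_pos
  rw [kerBound_eq_abs β h1, Real.norm_of_nonneg (by positivity)]
  have h2 := abs_le_pi_mul_abs_sin_half h1
  rcases eq_or_ne (|Real.sin (β / 2)|) 0 with h | h
  · rw [h]; simp; positivity
  · have h3 : 0 < |Real.sin (β / 2)| := lt_of_le_of_ne (abs_nonneg _) h.symm
    rw [mul_one_div, div_le_iff₀ (by positivity)]
    have h4 : |β| / 2 ≤ Real.pi * (2 * |Real.sin (β / 2)|) := by
      nlinarith [mul_pos hp h3]
    calc |β| / 2 * √(1 + Real.pi ^ 2 / 4) ≤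
        Real.pi * (2 * |Real.sin (β / 2)|) * √(1 + Real.pi ^ 2 / 4) := by gcongr
      _ = _ := by ring

lemma intervalIntegrable_kerBound : IntervalIntegrable kerBound volume (-Real.pi) Real.pi := by
  rw [intervalIntegrable_iff, Set.uIoc_of_le (by linarith [Real.pi_pos])]
  have hm : Measurable kerBound := by unfold kerBound; fun_prop
  refine Integrable.of_bound hm.aestronglyMeasurable (√(1 + Real.pi ^ 2 / 4) * Real.pi) ?_
  filter_upwards [ae_ne_zero_restrict _ measurableSet_Ioc] with β hβ
  exact kerBound_le (abs_le.2 ⟨hβ.2.1.le, hβ.2.2⟩)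

/-- Factor `z^c - 1` by the geometric sum, whose `c` terms are each at most `R^(c-1)`. With `R =
π/2` this is the source of the growth of `a n`. -/
lemma norm_pow_sub_one_le {z : ℂ} {R : ℝ} (hR : 1 ≤ R) (hz : ‖z‖ ≤ R) (c : ℕ) :
    ‖z ^ c - 1‖ ≤ c * R ^ (c - 1) * ‖z - 1‖ := by
  rw [← geom_sum_mul, norm_mul]
  refine mul_le_mul_of_nonneg_right ?_ (norm_nonneg _)
  refine (norm_sum_le _ _).trans ((Finset.sum_le_sum (g := fun _ => R ^ (c - 1)) fun i hi => ?_).trans ?_)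
  · rw [norm_pow]
    have : i ≤ c - 1 := by have := Finset.mem_range.1 hi; lia
    exact (pow_le_pow_left₀ (norm_nonneg _) hz i).trans (pow_le_pow_right₀ hR this)
  · simp

/-- The constant controlling the truncated integrals of the `n`-linear kernels. -/
def truncConst (n : ℕ) : ℝ :=
  16 + n * (Real.pi / 2) ^ (n - 1) * (2 * Real.pi * (√(1 + Real.pi ^ 2 / 4) * Real.pi))

lemma nat_mul_pow_mono {R : ℝ} (hR : 1 ≤ R) {c n : ℕ} (h : c ≤ n) :
    (c : ℝ) * R ^ (c - 1) ≤ n * R ^ (n - 1) := by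
  have : c - 1 ≤ n - 1 := by lia
  gcongr

lemma one_le_pi_div_two : 1 ≤ Real.pi / 2 := by linarith [Real.two_le_pi]

lemma truncConst_mono {c n : ℕ} (h : c ≤ n) : truncConst c ≤ truncConst n := by
  unfold truncConst
  have := nat_mul_pow_mono one_le_pi_div_two h
  have := Real.pi_pos
  gcongr

lemma a_mono {c n : ℕ} (h : c ≤ n) : a c ≤ a n := by
  have h1 := nat_mul_pow_mono one_le_pi_div_two h
  have := Ctilde_nonneg
  unfold a
  rw [mul_assoc, mul_assoc]
  gcongr

lemma one_le_a (n : ℕ) : 1 ≤ a n := by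
  have := Ctilde_nonneg
  have := Real.pi_pos
  unfold a
  have : 0 ≤ Ctilde * n * (Real.pi / 2) ^ (n - 1) := by positivity
  linarith

/-- Split `kerMul^c = 1 + (kerMul^c - 1)`. The first part gives principal values of modulus `π`; in
the second the singularity cancels, and `kerBound` integrates to the `Ctilde` term of `π a_c`. -/
lemma modBound_ker_mul_pow (c : ℕ) :
    ModBound (fun β => kerMul β ^ c * ker β) (truncConst c) (Real.pi * a c) := by
  intro q
  have hS := Real.sqrt_nonneg (1 + Real.pi ^ 2 / 4)
  have hpi := Real.pi_pos
  have hpt : ∀ β, β ≠ 0 → |β| ≤ Real.pi → ‖mode q β * ((kerMul β ^ c - 1) * ker β)‖ ≤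
      c * (Real.pi / 2) ^ (c - 1) * kerBound β := by
    intro β h0 h1
    rw [norm_mul, norm_mode, one_mul, norm_mul, norm_ker, kerBound_eq_abs β h1, ← mul_assoc]
    refine mul_le_mul_of_nonneg_right ?_ (by positivity)
    refine (norm_pow_sub_one_le one_le_pi_div_two (norm_kerMul_le h0 h1) c).trans ?_
    exact mul_le_mul_of_nonneg_left (norm_kerMul_sub_one_le h0 h1) (by positivity)
  have hm : Measurable fun β => mode q β * ((kerMul β ^ c - 1) * ker β) :=
    (continuous_mode q).measurable.mul (((measurable_kerMul.pow_const c).sub_const 1).mul measurable_ker)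
  have h1 := PVB.of_bounded (D := c * (Real.pi / 2) ^ (c - 1) * (√(1 + Real.pi ^ 2 / 4) * Real.pi))
    hm.aestronglyMeasurable fun β h0 h1 => (hpt β h0 h1).trans (by
      gcongr
      exact (le_abs_self _).trans (kerBound_le h1))
  have h2 : ‖∫ β in (-Real.pi)..Real.pi, mode q β * ((kerMul β ^ c - 1) * ker β)‖ ≤
      c * (Real.pi / 2) ^ (c - 1) * (Real.pi * Ctilde) := by
    rw [← integral_kerBound, ← intervalIntegral.integral_const_mul]
    refine intervalIntegral.norm_integral_le_of_norm_le (by linarith) ?_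
      (intervalIntegrable_kerBound.const_mul _)
    filter_upwards [Measure.ae_ne volume (0 : ℝ)] with β hβ hm
    exact hpt β hβ (abs_le.2 ⟨hm.1.le, hm.2⟩)
  have h3 := (pvb_mode_ker (-q)).add h1
  refine ⟨_, ?_, (h3.congr fun β _ _ => ?_).mono ?_⟩
  · refine (norm_add_le _ _).trans ?_
    rw [norm_halfSign, a]
    linarith
  · rw [neg_neg]; ring
  · rw [truncConst]; linarith

/-- The kernel of the multiplier of the `n`-linear operator. -/
def multKer {n : ℕ} (j : ℤ) (κ : Fin n → ℤ) (β : ℝ) : ℂ :=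
  mode (-j) β * (ker β * ∏ p, (kerMul β * psi (κ p + 1) β))

/-- The multiplier of the `n`-linear operator. -/
def mult {n : ℕ} (j : ℤ) (κ : Fin n → ℤ) : ℂ := pv (multKer j κ)

/-- Factors with `κ p + 1 ≠ 0` are averages of exponentials and are removed one at a time. The
others have `psi 0 = 1`, and their number is the exponent of the remaining power of `kerMul`. -/
lemma exists_pvb_multKer {n : ℕ} (j : ℤ) (κ : Fin n → ℤ) :
    ∃ v, ‖v‖ ≤ Real.pi * a (Finset.univ.filter fun p => κ p + 1 = 0).card ∧
      PVB (multKer j κ) (truncConst (Finset.univ.filter fun p => κ p + 1 = 0).card) v := by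
  have key : ∀ s : Finset (Fin n), (∀ p ∈ s, κ p + 1 ≠ 0) → ∀ k C μ, ModBound k C μ →
      ModBound (fun β => (∏ p ∈ s, (kerMul β * psi (κ p + 1) β)) * k β) C μ := by
    intro s
    induction s using Finset.induction_on with
    | empty => intro _ k C μ h; simpa using h
    | insert p s hp ih =>
      intro hs k C μ h
      have := (ih (fun q hq => hs q (Finset.mem_insert_of_mem hq)) k C μ h).mul_average
        (hs p (Finset.mem_insert_self p s))
      simp only [Finset.prod_insert hp, mul_assoc] at this ⊢
      exact this
  obtain ⟨v, hv, hp⟩ := key (Finset.univ.filter fun p => ¬ κ p + 1 = 0) (by simp) _ _ _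
    (modBound_ker_mul_pow (Finset.univ.filter fun p => κ p + 1 = 0).card) (-j)
  refine ⟨v, hv, hp.congr fun β _ _ => ?_⟩
  rw [multKer, ← Finset.prod_filter_mul_prod_filter_not Finset.univ fun p => κ p + 1 = 0,
    Finset.prod_congr (s₁ := Finset.univ.filter fun p => κ p + 1 = 0) rfl
    (g := fun _ => kerMul β) fun p hp => ?_]
  · rw [Finset.prod_const]; ring
  · rw [(Finset.mem_filter.1 hp).2, psi_zero, mul_one]

lemma card_filter_le {n : ℕ} (κ : Fin n → ℤ) :
    (Finset.univ.filter fun p => κ p + 1 = 0).card ≤ n :=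
  (Finset.card_filter_le _ _).trans (by simp)

lemma pvb_multKer {n : ℕ} (j : ℤ) (κ : Fin n → ℤ) :
    PVB (multKer j κ) (truncConst n) (mult j κ) := by
  obtain ⟨v, -, hp⟩ := exists_pvb_multKer j κ
  rw [mult, hp.pv_eq]
  exact hp.mono (truncConst_mono (card_filter_le κ))

lemma norm_mult_le {n : ℕ} (j : ℤ) (κ : Fin n → ℤ) : ‖mult j κ‖ ≤ Real.pi * a n := by
  obtain ⟨v, hv, hp⟩ := exists_pvb_multKer j κ
  rw [mult, hp.pv_eq]
  refine hv.trans ?_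
  have := Real.pi_pos
  gcongr
  exact a_mono (card_filter_le κ)

lemma mode_neg_one_mul_ker {β : ℝ} (h0 : β ≠ 0) (h1 : |β| ≤ Real.pi) :
    mode (-1) β * ker β = -ker (-β) := by
  have h2 := one_sub_exp_ne_zero h0 h1
  have h3 := one_sub_exp_ne_zero (neg_ne_zero.2 h0) (by rwa [abs_neg])
  have h4 : Complex.exp (-Complex.I * (β : ℂ)) * Complex.exp (-Complex.I * ((-β : ℝ) : ℂ)) = 1 := by
    rw [← Complex.exp_add]; convert Complex.exp_zero using 2; push_cast; ring
  have h5 : mode (-1) β = Complex.exp (-Complex.I * (β : ℂ)) := by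
    rw [mode]; congr 1; push_cast; ring
  rw [h5, ker, ker]
  generalize Complex.exp (-Complex.I * (β : ℂ)) = E at *
  generalize Complex.exp (-Complex.I * ((-β : ℝ) : ℂ)) = E' at *
  field_simp
  linear_combination -h4

/-- Sharper than `norm_mult_le`, for the two frequencies of `ω₀`. If `κ 0 ≠ -1` the only
non-exponential factor is `ker`, whose modulations have principal value `±π`. The resonant case `κ 0
= -1` is treated by symmetry and explicit integrals. -/
lemma norm_mult_one_le {j : ℤ} (hj : j = 1 ∨ j = -1) (κ : Fin 1 → ℤ) : ‖mult j κ‖ ≤ Real.pi := by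
  have hpi := Real.pi_pos
  by_cases hκ : κ 0 + 1 = 0
  swap
  · obtain ⟨v, hv, hp⟩ := (modBound_ker.mul_average hκ) (-j)
    have h1 : PVB (multKer j κ) 16 v := hp.congr fun β _ _ => by
      simp only [multKer, Fin.prod_univ_one]; ring
    rwa [mult, h1.pv_eq]
  -- Here `psi` is `1`, and one factor `e^{-iβ}` turns `ker β ^ 2` into minus the even kernel `ker β
  -- * ker (-β)`.
  have hk : ∀ β, β ≠ 0 → |β| ≤ Real.pi →
      multKer j κ β = -(Complex.I * β * (ker β * ker (-β)) * mode (1 - j) β) := by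
    intro β h0 h1
    have h2 := mode_neg_one_mul_ker h0 h1
    rw [multKer, show -j = (1 - j) + -1 by ring, mode_add]
    simp only [Fin.prod_univ_one, hκ, psi_zero, mul_one, kerMul]
    linear_combination (mode (1 - j) β * (Complex.I * β * ker β)) * h2
  have hc : ContinuousOn (fun β => -(Complex.I * β * (ker β * ker (-β)) * mode (1 - j) β))
      {β : ℝ | β ≠ 0 ∧ |β| ≤ Real.pi} := by
    have h1 : ContinuousOn (fun β : ℝ => ker (-β)) {β : ℝ | β ≠ 0 ∧ |β| ≤ Real.pi} :=
      continuousOn_ker.comp continuousOn_neg fun β hβ =>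
        ⟨neg_ne_zero.2 hβ.1, by rw [abs_neg]; exact hβ.2⟩
    exact (((by fun_prop : Continuous fun β : ℝ => Complex.I * (β : ℂ)).continuousOn.mul
      (continuousOn_ker.mul h1)).mul (continuous_mode _).continuousOn).neg
  have ht := (pvb_multKer j κ).tendsto
  have htr : ∀ ε, 0 < ε → ε < Real.pi → trunc (multKer j κ) ε =
      ∫ β in ε..Real.pi, -(Complex.I * β * (ker β * ker (-β)) * (mode (1 - j) β - mode (1 - j) (-β))) := by
    intro ε h0 h1
    rw [trunc_congr hk h0 h1, trunc_eq_symm hc h0 h1]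
    congr 1; ext β
    rw [neg_neg]; push_cast; ring
  rcases hj with rfl | rfl
  -- For `j = 1` no oscillation remains and the factor `β` makes the integrand odd.
  · have h0 : mult 1 κ = 0 := by
      refine tendsto_nhds_unique ht (tendsto_const_nhds.congr' ?_)
      filter_upwards [eventually_lt_pi] with ε hε
      rw [htr ε hε.1 hε.2]
      simp [mode_zero]
    rw [h0, norm_zero]; exact hpi.le
  -- For `j = -1` only the sine part of `e^{2iβ}` survives folding; half-angle formulas give a real,
  -- bounded integrand.
  · have hsymm : ∀ β, 0 < β → β ≤ Real.pi →
        -(Complex.I * β * (ker β * ker (-β)) * (mode (1 - -1) β - mode (1 - -1) (-β))) =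
        ((2 * (β * (Real.cos (β / 2) / Real.sin (β / 2))) - 2 * (β * Real.sin β) : ℝ) : ℂ) := by
      intro β h0 h1
      have habs : |β| ≤ Real.pi := by rwa [abs_of_pos h0]
      have hs := (sin_half_pos h0 h1).ne'
      have hsum := Real.sin_sq_add_cos_sq (β / 2)
      have e1 : ker β * ker (-β) = ((1 / (4 * Real.sin (β / 2) ^ 2) : ℝ) : ℂ) := by
        rw [ker_eq h0.ne' habs, ker_eq (neg_ne_zero.2 h0.ne') (by rwa [abs_neg]), neg_div,
          Real.cos_neg, Real.sin_neg, div_neg]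
        have e2 : 1 / (4 * Real.sin (β / 2) ^ 2) =
            (1 + (Real.cos (β / 2) / Real.sin (β / 2)) ^ 2) / 4 := by
          field_simp; linarith
        rw [e2]
        generalize Real.cos (β / 2) / Real.sin (β / 2) = c
        push_cast
        ring_nf
        simp only [Complex.I_sq]
        ring
      have e3 : mode (1 - -1) β - mode (1 - -1) (-β) = 2 * Complex.I * (Real.sin (2 * β) : ℂ) := by
        rw [mode_eq, mode_eq]
        have : ((1 - -1 : ℤ) : ℝ) = 2 := by norm_num
        rw [this, mul_neg, Real.cos_neg, Real.sin_neg]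
        push_cast; ring
      have e4 : Real.sin β = 2 * Real.sin (β / 2) * Real.cos (β / 2) := by
        rw [← Real.sin_two_mul, mul_div_cancel₀ _ two_ne_zero]
      have e5 : Real.cos β = 1 - 2 * Real.sin (β / 2) ^ 2 := by
        have h3 := Real.cos_two_mul (β / 2)
        rw [mul_div_cancel₀ _ two_ne_zero] at h3
        rw [h3, Real.cos_sq']; ring
      rw [e1, e3, Real.sin_two_mul, e5, e4]
      have e6 : 2 * (β * (Real.cos (β / 2) / Real.sin (β / 2))) -
          2 * (β * (2 * Real.sin (β / 2) * Real.cos (β / 2))) =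
          2 * β * (1 / (4 * Real.sin (β / 2) ^ 2)) *
          (2 * (2 * Real.sin (β / 2) * Real.cos (β / 2)) * (1 - 2 * Real.sin (β / 2) ^ 2)) := by
        field_simp
        ring
      rw [e6]
      push_cast
      ring_nf
      simp only [Complex.I_sq]
      ring
    have hreal : ∀ ε, 0 < ε → ε < Real.pi → trunc (multKer (-1) κ) ε = ((∫ β in ε..Real.pi,
        (2 * (β * (Real.cos (β / 2) / Real.sin (β / 2))) - 2 * (β * Real.sin β)) : ℝ) : ℂ) := by
      intro ε h0 h1
      rw [htr ε h0 h1, ← intervalIntegral.integral_ofReal]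
      refine intervalIntegral.integral_congr fun β hβ => ?_
      rw [Set.uIcc_of_le h1.le] at hβ
      exact hsymm β (h0.trans_le hβ.1) hβ.2
    have hint : ∀ ε, 0 < ε → ε < Real.pi → IntervalIntegrable (fun β =>
        2 * (β * (Real.cos (β / 2) / Real.sin (β / 2))) - 2 * (β * Real.sin β)) volume ε Real.pi := by
      intro ε h0 h1
      have hc2 : ContinuousOn (fun β : ℝ => Real.cos (β / 2) / Real.sin (β / 2))
          (Set.uIcc ε Real.pi) :=
        ContinuousOn.div (by fun_prop) (by fun_prop) fun β hβ => by
          rw [Set.uIcc_of_le h1.le] at hβ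
          exact (sin_half_pos (h0.trans_le hβ.1) hβ.2).ne'
      exact ContinuousOn.intervalIntegrable (by fun_prop)
    -- Using `β cot(β/2) ≤ 2 - β²/6` leaves an integrand with an elementary primitive; its value `2π
    -- - π³/9` is at most `π` because `π ≥ 3`.
    have hup : ∀ ε, ∫ β in ε..Real.pi, (4 - β ^ 2 / 3 - 2 * (β * Real.sin β)) =
        (2 * Real.pi - Real.pi ^ 3 / 9) - (4 * ε - ε ^ 3 / 9 + 2 * (ε * Real.cos ε) - 2 * Real.sin ε) := by
      intro ε
      rw [intervalIntegral.integral_eq_sub_of_hasDerivAt (f := fun β =>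
        4 * β - β ^ 3 / 9 + 2 * (β * Real.cos β) - 2 * Real.sin β) (fun β _ => ?_)
        (by apply Continuous.intervalIntegrable; fun_prop)]
      · simp; ring
      · refine (((((hasDerivAt_id β).const_mul 4).sub ((hasDerivAt_pow 3 β).div_const 9)).add
          (((hasDerivAt_id β).mul (Real.hasDerivAt_cos β)).const_mul 2)).sub
          ((Real.hasDerivAt_sin β).const_mul 2)).congr_deriv ?_
        simp; ring
    -- The companion lower bound uses `β cot(β/2) ≥ 2 cos(β/2)`; the value `8 - 2π` exceeds `-π`
    -- because `π ≤ 4`.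
    have hlo : ∀ ε, ∫ β in ε..Real.pi, (4 * Real.cos (β / 2) - 2 * (β * Real.sin β)) =
        (8 - 2 * Real.pi) - (8 * Real.sin (ε / 2) + 2 * (ε * Real.cos ε) - 2 * Real.sin ε) := by
      intro ε
      rw [intervalIntegral.integral_eq_sub_of_hasDerivAt (f := fun β =>
        8 * Real.sin (β / 2) + 2 * (β * Real.cos β) - 2 * Real.sin β) (fun β _ => ?_)
        (by apply Continuous.intervalIntegrable; fun_prop)]
      · simp; ring
      · refine ((((((hasDerivAt_id β).div_const 2).sin).const_mul 8).add
          (((hasDerivAt_id β).mul (Real.hasDerivAt_cos β)).const_mul 2)).sub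
          ((Real.hasDerivAt_sin β).const_mul 2)).congr_deriv ?_
        simp; ring
    have hre := (Complex.continuous_re.tendsto _).comp ht
    have him := (Complex.continuous_im.tendsto _).comp ht
    have him0 : (mult (-1) κ).im = 0 := by
      refine tendsto_nhds_unique him (tendsto_const_nhds.congr' ?_)
      filter_upwards [eventually_lt_pi] with ε hε
      rw [Function.comp_apply, hreal ε hε.1 hε.2, Complex.ofReal_im]
    have h1 : (mult (-1) κ).re ≤ 2 * Real.pi - Real.pi ^ 3 / 9 := by
      have hlim : Tendsto (fun ε : ℝ => (2 * Real.pi - Real.pi ^ 3 / 9) -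
          (4 * ε - ε ^ 3 / 9 + 2 * (ε * Real.cos ε) - 2 * Real.sin ε)) (𝓝[>] 0)
          (𝓝 (2 * Real.pi - Real.pi ^ 3 / 9)) := by
        have : Continuous (fun ε : ℝ => (2 * Real.pi - Real.pi ^ 3 / 9) -
          (4 * ε - ε ^ 3 / 9 + 2 * (ε * Real.cos ε) - 2 * Real.sin ε)) := by fun_prop
        have := this.tendsto 0
        simp only [mul_zero, Real.sin_zero, zero_mul, sub_zero, ne_eq, OfNat.ofNat_ne_zero,
          not_false_eq_true, zero_pow, zero_div, add_zero] at this
        exact this.mono_left nhdsWithin_le_nhds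
      refine le_of_tendsto_of_tendsto hre hlim ?_
      filter_upwards [eventually_lt_pi] with ε hε
      rw [Function.comp_apply, hreal ε hε.1 hε.2, Complex.ofReal_re, ← hup]
      refine intervalIntegral.integral_mono_on hε.2.le (hint ε hε.1 hε.2)
        (by apply Continuous.intervalIntegrable; fun_prop) fun β hβ => ?_
      linarith [(mul_cot_half_bounds (hε.1.trans_le hβ.1) hβ.2).2]
    have h2 : 8 - 2 * Real.pi ≤ (mult (-1) κ).re := by
      have hlim : Tendsto (fun ε : ℝ => (8 - 2 * Real.pi) -
          (8 * Real.sin (ε / 2) + 2 * (ε * Real.cos ε) - 2 * Real.sin ε)) (𝓝[>] 0)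
          (𝓝 (8 - 2 * Real.pi)) := by
        have : Continuous (fun ε : ℝ => (8 - 2 * Real.pi) -
          (8 * Real.sin (ε / 2) + 2 * (ε * Real.cos ε) - 2 * Real.sin ε)) := by fun_prop
        have := this.tendsto 0
        simp only [mul_zero, Real.sin_zero, zero_mul, sub_zero, zero_div, add_zero] at this
        exact this.mono_left nhdsWithin_le_nhds
      refine le_of_tendsto_of_tendsto hlim hre ?_
      filter_upwards [eventually_lt_pi] with ε hε
      rw [Function.comp_apply, hreal ε hε.1 hε.2, Complex.ofReal_re, ← hlo]
      refine intervalIntegral.integral_mono_on hε.2.le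
        (by apply Continuous.intervalIntegrable; fun_prop) (hint ε hε.1 hε.2) fun β hβ => ?_
      linarith [(mul_cot_half_bounds (hε.1.trans_le hβ.1) hβ.2).1]
    have h3 : mult (-1) κ = ((mult (-1) κ).re : ℂ) := Complex.ext (by simp) (by simp [him0])
    rw [h3, Complex.norm_real, Real.norm_eq_abs, abs_le]
    have := Real.pi_gt_three
    have := Real.pi_le_four
    constructor
    · linarith
    · nlinarith [mul_pos hpi hpi]

/-! ### The multilinear operators -/

/-- A number is a constant function, so this is the power rule for expansions with all frequencies
zero. -/
lemma hasSum_pow {ι : Type} {c : ι → ℂ} {z : ℂ} (hs : Summable fun i => ‖c i‖) (h : HasSum c z)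
    (n : ℕ) : HasSum (fun κ : Fin n → ι => ∏ p, c (κ p)) (z ^ n) := by
  have h1 : HasExp c (fun _ => 0) (fun _ => z) := ⟨hs, fun α => by simpa [mode_zero] using h⟩
  simpa [mode_zero] using (h1.pow n).hasSum 0

lemma hasSum_norm_pow {ι : Type} {c : ι → ℂ} (hs : Summable fun i => ‖c i‖) (n : ℕ) :
    HasSum (fun κ : Fin n → ι => ‖∏ p, c (κ p)‖) ((∑' i, ‖c i‖) ^ n) := by
  have h1 := hasSum_pow (c := fun i => (‖c i‖ : ℂ)) (by simpa using hs)
    (Complex.hasSum_ofReal.2 hs.hasSum) n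
  rw [← Complex.hasSum_ofReal]
  simpa using h1

/-- The average `∫_0^1 e^{i(s-1)β} u(α + (s-1)β) ds`. -/
def segAvg (u : ℝ → ℂ) (α β : ℝ) : ℂ :=
  ∫ s in (0 : ℝ)..1, Complex.exp (Complex.I * (((s - 1) * β : ℝ) : ℂ)) * u (α + (s - 1) * β)

lemma exp_eq_mode_one (x : ℝ) : Complex.exp (Complex.I * (x : ℂ)) = mode 1 x := by simp [mode]

/-- The weight `e^{i(s-1)β}` shifts every frequency by one, whence `psi (k i + 1)`; frequency `-1`
is the resonant one. -/
lemma hasSum_segAvg {ι : Type} [Countable ι] {c : ι → ℂ} {k : ι → ℤ} {u : ℝ → ℂ}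
    (h : HasExp c k u) (α β : ℝ) :
    HasSum (fun i => c i * mode (k i) α * psi (k i + 1) β) (segAvg u α β) := by
  have key : HasSum (fun i => ∫ s in (0 : ℝ)..1, mode 1 ((s - 1) * β) *
      (c i * mode (k i) (α + (s - 1) * β))) (segAvg u α β) := by
    unfold segAvg
    simp only [exp_eq_mode_one]
    refine intervalIntegral.hasSum_integral_of_dominated_convergence (fun i _ => ‖c i‖)
      (fun i => ?_) (fun i => ?_) ?_ intervalIntegrable_const ?_
    · exact (by fun_prop : Continuous fun s => mode 1 ((s - 1) * β) *
        (c i * mode (k i) (α + (s - 1) * β))).aestronglyMeasurable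
    · refine Eventually.of_forall fun s _ => ?_
      rw [norm_mul, norm_mul, norm_mode, norm_mode, one_mul, mul_one]
    · exact Eventually.of_forall fun s _ => h.summable
    · exact Eventually.of_forall fun s _ => (h.hasSum _).mul_left _
  refine key.congr_fun fun i => ?_
  rw [psi, ← intervalIntegral.integral_const_mul]
  refine intervalIntegral.integral_congr fun s _ => ?_
  rw [mode_add_right, mode_add]
  ring

/-- The `n`-linear operator `pv ∫ f(α-β) (1-e^{-iβ})⁻¹ (iβ (1-e^{-iβ})⁻¹ ∫_0^1 …)^n dβ`. -/
def opT (n : ℕ) (f u : ℝ → ℂ) (α : ℝ) : ℂ :=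
  pv fun β => f (α - β) * (ker β * (kerMul β * segAvg u α β) ^ n)

/-- The sum of the absolute values of the Fourier coefficients. -/
def absSum (f : ℝ → ℂ) : ℝ := ∑' k, ‖fc f k‖

lemma absSum_nonneg (f : ℝ → ℂ) : 0 ≤ absSum f := tsum_nonneg fun _ => norm_nonneg _

variable {f u : ℝ → ℂ}

lemma hasSum_opT_coeff (hf : Wiener f) (hu : Wiener u) (n : ℕ) :
    HasSum (fun p : ℤ × (Fin n → ℤ) => ‖fc f p.1 * ∏ q, fc u (p.2 q)‖) (absSum f * absSum u ^ n) := by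
  have h1 := hf.summable.hasSum
  have h2 := hasSum_norm_pow hu.summable n
  have h3 := Summable.mul_of_nonneg (f := fun i => ‖fc f i‖) h1.summable h2.summable
    (fun _ => norm_nonneg _) (fun _ => norm_nonneg _)
  have h4 := h1.mul h2 h3
  simp only [norm_mul]
  exact h4

lemma summable_opT_coeff (hf : Wiener f) (hu : Wiener u) (n : ℕ) :
    Summable fun p : ℤ × (Fin n → ℤ) => ‖fc f p.1 * (∏ q, fc u (p.2 q)) * mult p.1 p.2‖ := by
  refine Summable.of_nonneg_of_le (fun _ => norm_nonneg _) (fun p => ?_)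
    ((hasSum_opT_coeff hf hu n).summable.mul_right (Real.pi * a n))
  rw [norm_mul]
  exact mul_le_mul_of_nonneg_left (norm_mult_le _ _) (norm_nonneg _)

/-- Expanding `f` and the `n` averages in modes separates `α` from `β`. The `β`-part of each term is
`multKer`, so `opT n` is an `n`-linear Fourier multiplier, and termwise principal values are
legitimate because the `PVB` constants are summable. -/
lemma pvb_opT_tsum (hf : Wiener f) (hu : Wiener u) (n : ℕ) (α : ℝ) :
    PVB (fun β => f (α - β) * (ker β * (kerMul β * segAvg u α β) ^ n))
      (absSum f * absSum u ^ n * truncConst n)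
      (∑' p : ℤ × (Fin n → ℤ), fc f p.1 * (∏ q, fc u (p.2 q)) * mult p.1 p.2 *
        mode (p.1 + ∑ q, p.2 q) α) := by
  have hcoef := hasSum_opT_coeff hf hu n
  have h1 : ∀ p : ℤ × (Fin n → ℤ), PVB
      (fun β => (fc f p.1 * (∏ q, fc u (p.2 q)) * mode (p.1 + ∑ q, p.2 q) α) * multKer p.1 p.2 β)
      (‖fc f p.1 * ∏ q, fc u (p.2 q)‖ * truncConst n)
      (fc f p.1 * (∏ q, fc u (p.2 q)) * mult p.1 p.2 * mode (p.1 + ∑ q, p.2 q) α) := by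
    intro p
    have := (pvb_multKer p.1 p.2).const_mul
      (fc f p.1 * (∏ q, fc u (p.2 q)) * mode (p.1 + ∑ q, p.2 q) α)
    rw [norm_mul _ (mode _ _), norm_mode, mul_one] at this
    convert this using 1
    ring
  have h2 := PVB.tsum (g := fun β => f (α - β) * (ker β * (kerMul β * segAvg u α β) ^ n)) h1
    (hcoef.summable.mul_right _) fun β _ _ => ?_
  · rwa [(hcoef.mul_right _).tsum_eq] at h2
  · have e1 := hf.hasExp.hasSum (α - β)
    have e1s : Summable fun i => ‖fc f i * mode (id i) (α - β)‖ := by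
      simpa only [norm_mul, norm_mode, mul_one] using hf.summable
    have e2 := (hasSum_segAvg hu.hasExp α β).mul_left (kerMul β)
    have e2s : Summable fun i => ‖kerMul β * (fc u i * mode (id i) α * psi (id i + 1) β)‖ := by
      simp only [norm_mul, norm_mode, mul_one]
      refine (Summable.of_nonneg_of_le (fun _ => by positivity) (fun i => ?_) hu.summable).mul_left _
      exact mul_le_of_le_one_right (norm_nonneg _) (norm_psi_le _ _)
    have e3 := hasSum_pow e2s e2 n
    have e3s := (hasSum_norm_pow e2s n).summable
    have e4s := summable_mul_of_summable_norm (f := fun i => fc f i * mode (id i) (α - β))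
      (g := fun κ : Fin n → ℤ =>
        ∏ p, kerMul β * (fc u (κ p) * mode (id (κ p)) α * psi (id (κ p) + 1) β)) e1s e3s
    have e4 := (HasSum.mul (f := fun i => fc f i * mode (id i) (α - β))
      (g := fun κ : Fin n → ℤ =>
        ∏ p, kerMul β * (fc u (κ p) * mode (id (κ p)) α * psi (id (κ p) + 1) β))
      e1 e3 e4s).mul_left (ker β)
    rw [show f (α - β) * (ker β * (kerMul β * segAvg u α β) ^ n) =
      ker β * (f (α - β) * (kerMul β * segAvg u α β) ^ n) by ring]
    refine e4.congr_fun fun p => ?_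
    simp only [multKer, mode_add, mode_sum, id, sub_eq_add_neg, mode_add_right, mode_neg_right,
      Finset.prod_mul_distrib]
    ring

lemma pvb_opT (hf : Wiener f) (hu : Wiener u) (n : ℕ) (α : ℝ) :
    PVB (fun β => f (α - β) * (ker β * (kerMul β * segAvg u α β) ^ n))
      (absSum f * absSum u ^ n * truncConst n) (opT n f u α) := by
  have h := pvb_opT_tsum hf hu n α
  rw [opT, h.pv_eq]
  exact h

lemma hasExp_opT (hf : Wiener f) (hu : Wiener u) (n : ℕ) :
    HasExp (fun p : ℤ × (Fin n → ℤ) => fc f p.1 * (∏ q, fc u (p.2 q)) * mult p.1 p.2)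
      (fun p => p.1 + ∑ q, p.2 q) (opT n f u) := by
  have hs := summable_opT_coeff hf hu n
  refine ⟨hs, fun α => ?_⟩
  rw [opT, (pvb_opT_tsum hf hu n α).pv_eq]
  apply Summable.hasSum
  apply Summable.of_norm
  simpa only [norm_mul _ (mode _ _), norm_mode, mul_one] using hs

lemma opT_sub_left {g : ℝ → ℂ} (hf : Wiener f) (hg : Wiener g) (hu : Wiener u) (n : ℕ) (α : ℝ) :
    opT n (fun x => f x - g x) u α = opT n f u α - opT n g u α := by
  refine PVB.pv_eq (C := absSum f * absSum u ^ n * truncConst n + absSum g * absSum u ^ n * truncConst n)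
    (((pvb_opT hf hu n α).sub (pvb_opT hg hu n α)).congr fun β _ _ => ?_)
  ring

lemma segAvg_add {v : ℝ → ℂ} (hu : Continuous u) (hv : Continuous v) (α β : ℝ) :
    segAvg (fun x => u x + v x) α β = segAvg u α β + segAvg v α β := by
  simp only [segAvg, mul_add]
  rw [intervalIntegral.integral_add] <;>
  · apply Continuous.intervalIntegrable
    fun_prop

lemma segAvg_const_mul (c : ℂ) (α β : ℝ) :
    segAvg (fun x => c * u x) α β = c * segAvg u α β := by
  simp only [segAvg, mul_left_comm _ c]
  exact intervalIntegral.integral_const_mul _ _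

lemma opT_one_add_right {v : ℝ → ℂ} (hf : Wiener f) (hu : Wiener u) (hv : Wiener v) (α : ℝ) :
    opT 1 f (fun x => u x + v x) α = opT 1 f u α + opT 1 f v α := by
  refine PVB.pv_eq (((pvb_opT hf hu 1 α).add (pvb_opT hf hv 1 α)).congr fun β _ _ => ?_)
  rw [segAvg_add hu.continuous hv.continuous]
  ring

lemma opT_one_const_mul_right (hf : Wiener f) (hu : Wiener u) (c : ℂ) (α : ℝ) :
    opT 1 f (fun x => c * u x) α = c * opT 1 f u α := by
  refine PVB.pv_eq (((pvb_opT hf hu 1 α).const_mul c).congr fun β _ _ => ?_)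
  rw [segAvg_const_mul]
  ring

/-! ### Remainders of the exponential series -/

/-- The remainder `∑_{m ≥ m₀} (iθ)^m / m!`. -/
def expRem (m₀ : ℕ) (θ : ℝ → ℂ) (α : ℝ) : ℂ :=
  ∑' m : ℕ, Complex.I ^ (m + m₀) / ((m + m₀).factorial : ℂ) * θ α ^ (m + m₀)

variable {θ : ℝ → ℂ}

lemma norm_I_pow_div (m : ℕ) : ‖Complex.I ^ m / (m.factorial : ℂ)‖ = 1 / (m.factorial : ℝ) := by
  simp

lemma summable_pow_div_factorial_add (x : ℝ) (m₀ : ℕ) :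
    Summable fun m : ℕ => x ^ (m + m₀) / ((m + m₀).factorial : ℝ) :=
  (summable_nat_add_iff m₀).2 (Real.summable_pow_div_factorial x)

lemma hasExp_expRem (hθ : Wiener θ) (m₀ : ℕ) :
    HasExp (fun p : Σ m : ℕ, (Fin (m + m₀) → ℤ) =>
        Complex.I ^ (p.1 + m₀) / ((p.1 + m₀).factorial : ℂ) * ∏ q, fc θ (p.2 q))
      (fun p => ∑ q, p.2 q) (expRem m₀ θ) := by
  have h1 : ∀ m : ℕ, HasExp
      (fun κ : Fin (m + m₀) → ℤ => Complex.I ^ (m + m₀) / ((m + m₀).factorial : ℂ) * ∏ q, fc θ (κ q))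
      (fun κ => ∑ q, κ q)
      (fun α => Complex.I ^ (m + m₀) / ((m + m₀).factorial : ℂ) * θ α ^ (m + m₀)) := fun m =>
    (hθ.hasExp.pow (m + m₀)).const_mul _
  refine HasExp.sigma h1 ?_ fun α => rfl
  have : ∀ m : ℕ, ∑' κ : Fin (m + m₀) → ℤ,
      ‖Complex.I ^ (m + m₀) / ((m + m₀).factorial : ℂ) * ∏ q, fc θ (κ q)‖ =
      absSum θ ^ (m + m₀) / ((m + m₀).factorial : ℝ) := by
    intro m
    simp only [norm_mul, norm_I_pow_div]
    have h2 := (hasSum_norm_pow hθ.summable (m + m₀)).tsum_eq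
    rw [tsum_mul_left, h2, absSum]
    ring
  simp only [this]
  exact summable_pow_div_factorial_add _ _

lemma wiener_expRem (hθ : Wiener θ) (m₀ : ℕ) : Wiener (expRem m₀ θ) := (hasExp_expRem hθ m₀).wiener

lemma hasSum_exp_I_mul (z : ℂ) :
    HasSum (fun m : ℕ => Complex.I ^ m / (m.factorial : ℂ) * z ^ m) (Complex.exp (Complex.I * z)) := by
  have := NormedSpace.expSeries_div_hasSum_exp (𝔸 := ℂ) (Complex.I * z)
  rw [← Complex.exp_eq_exp_ℂ] at this
  refine this.congr_fun fun m => ?_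
  rw [mul_pow]; ring

lemma expRem_one (α : ℝ) : expRem 1 θ α = Complex.exp (Complex.I * θ α) - 1 := by
  have h := hasSum_exp_I_mul (θ α)
  rw [expRem, ← h.tsum_eq, h.summable.tsum_eq_zero_add]
  simp

lemma expRem_two (α : ℝ) :
    expRem 2 θ α = Complex.exp (Complex.I * θ α) - 1 - Complex.I * θ α := by
  have h := hasSum_exp_I_mul (θ α)
  rw [expRem, ← h.tsum_eq, ← h.summable.sum_add_tsum_nat_add 2]
  simp [Finset.sum_range_succ]
  ring

/-- Sum and average are interchanged, with the exponential series of `absSum` as majorant. -/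
lemma expTail_eq {φ : ℝ → ℝ} (hφ : Wiener fun x => (φ x : ℂ)) (m₀ : ℕ) (α β : ℝ) :
    expTail m₀ φ α β = segAvg (expRem m₀ fun x => (φ x : ℂ)) α β := by
  have hb : ∀ x, ‖(φ x : ℂ)‖ ≤ absSum fun x => (φ x : ℂ) := by
    intro x
    rw [hφ.hasExp.eq x]
    refine tsum_of_norm_bounded hφ.summable.hasSum fun k => ?_
    rw [norm_mul, norm_mode, mul_one]
  have hc := hφ.continuous
  have key : HasSum (fun m : ℕ => ∫ s in (0 : ℝ)..1,
      Complex.exp (Complex.I * (((s - 1) * β : ℝ) : ℂ)) *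
        (Complex.I ^ (m + m₀) / ((m + m₀).factorial : ℂ) * (φ (α + (s - 1) * β) : ℂ) ^ (m + m₀)))
      (segAvg (expRem m₀ fun x => (φ x : ℂ)) α β) := by
    unfold segAvg
    refine intervalIntegral.hasSum_integral_of_dominated_convergence
      (fun m _ => (absSum fun x => (φ x : ℂ)) ^ (m + m₀) / ((m + m₀).factorial : ℝ))
      (fun i => ?_) (fun i => ?_) ?_ intervalIntegrable_const ?_
    · have : Continuous fun s : ℝ => (φ (α + (s - 1) * β) : ℂ) :=
        hc.comp (by fun_prop : Continuous fun s : ℝ => α + (s - 1) * β)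
      apply Continuous.aestronglyMeasurable
      fun_prop
    · refine Eventually.of_forall fun s _ => ?_
      rw [exp_eq_mode_one, norm_mul, norm_mode, one_mul, norm_mul, norm_I_pow_div, norm_pow,
        one_div_mul_eq_div]
      gcongr
      exact hb _
    · exact Eventually.of_forall fun s _ => summable_pow_div_factorial_add _ _
    · refine Eventually.of_forall fun s _ => ?_
      exact (((summable_nat_add_iff m₀).2 (hasSum_exp_I_mul _).summable).hasSum).mul_left _
  rw [expTail, ← key.tsum_eq]
  refine tsum_congr fun m => ?_
  rw [← intervalIntegral.integral_const_mul]
  congr 1; ext s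
  ring

/-! ### The operators `ℛ`, `𝒮`, `𝓗`, `𝒟` in terms of the multilinear operators -/

variable {f θ : ℝ → ℝ}

/-- Each `β/(1 - e^{-iβ})` equals `-i · kerMul β`; the resulting `-i` cancels the `i` in front of
`ℛ`. -/
lemma opR_eq (hf : Wiener fun x => (f x : ℂ)) (hθ : Wiener fun x => (θ x : ℂ)) (α : ℝ) :
    opR θ f α = 1 / (Real.pi : ℂ) * opT 1 (fun x => (f x : ℂ)) (fun x => (θ x : ℂ)) α := by
  have h := ((pvb_opT hf hθ 1 α).const_mul (-Complex.I)).congr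
    (h := fun β => (f (α - β) : ℂ) / (β : ℂ) *
      ((β : ℂ) ^ 2 / (1 - Complex.exp (-Complex.I * (β : ℂ))) ^ 2) *
      ∫ s in (0 : ℝ)..1, Complex.exp (Complex.I * (((s - 1) * β : ℝ) : ℂ)) *
        (θ (α + (s - 1) * β) : ℂ)) fun β h0 h1 => by
      have hb : (β : ℂ) ≠ 0 := by exact_mod_cast h0
      have he := one_sub_exp_ne_zero h0 h1
      simp only [segAvg, kerMul, ker]
      generalize 1 - Complex.exp (-Complex.I * (β : ℂ)) = E at *
      field_simp
      simp only [Complex.I_sq]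
      ring
  rw [opR, h.pv_eq]
  linear_combination (-(1 / (Real.pi : ℂ)) * opT 1 (fun x => (f x : ℂ)) (fun x => (θ x : ℂ)) α) *
    Complex.I_sq

/-- The summand of order `(n, l)` of the expansion of the Birkhoff–Rott integrand. -/
def expansionTerm (θ f : ℝ → ℝ) (α : ℝ) (p : ℕ × ℕ) : ℂ :=
  (-1) ^ p.1 * (Complex.I ^ p.2 / (p.2.factorial : ℂ) * (θ α : ℂ) ^ p.2) *
    opT p.1 (fun x => (f x : ℂ)) (expRem 1 fun x => (θ x : ℂ)) α

/-- The conversions to `kerMul` produce `(-i)^n`, which cancels the `i^n` in the coefficients of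
`𝒮`. Both pieces then have the common prefactor `i/π`. -/
lemma opS_eq (hf : Wiener fun x => (f x : ℂ)) (hθ : Wiener fun x => (θ x : ℂ)) (α : ℝ) :
    opS θ f α = Complex.I / (Real.pi : ℂ) *
      ((∑' p : ℕ × ℕ, if 2 ≤ p.1 + p.2 then expansionTerm θ f α p else 0) -
        opT 1 (fun x => (f x : ℂ)) (expRem 2 fun x => (θ x : ℂ)) α) := by
  have h1 : ∀ n : ℕ, pv (fun β => (f (α - β) : ℂ) * (β : ℂ) ^ (n + 1) /
        ((β : ℂ) * (1 - Complex.exp (-Complex.I * (β : ℂ))) ^ (n + 1)) * expTail 1 θ α β ^ n) =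
      (-Complex.I) ^ n * opT n (fun x => (f x : ℂ)) (expRem 1 fun x => (θ x : ℂ)) α := by
    intro n
    refine PVB.pv_eq (((pvb_opT hf (wiener_expRem hθ 1) n α).const_mul ((-Complex.I) ^ n)).congr
      fun β h0 h1 => ?_)
    have hb : (β : ℂ) ≠ 0 := by exact_mod_cast h0
    have he := one_sub_exp_ne_zero h0 h1
    rw [expTail_eq hθ]
    simp only [kerMul, ker]
    generalize segAvg (expRem 1 fun x => (θ x : ℂ)) α β = U
    generalize 1 - Complex.exp (-Complex.I * (β : ℂ)) = E at *
    have e1 : (-Complex.I) ^ n * (Complex.I) ^ n = 1 := by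
      rw [← mul_pow, neg_mul, Complex.I_mul_I, neg_neg, one_pow]
    calc _ = 1 * ((f (α - β) : ℂ) * (β : ℂ) ^ n / E ^ (n + 1) * U ^ n) := by
          rw [pow_succ (β : ℂ)]; field_simp
      _ = ((-Complex.I) ^ n * (Complex.I) ^ n) *
            ((f (α - β) : ℂ) * (β : ℂ) ^ n / E ^ (n + 1) * U ^ n) := by rw [e1]
      _ = _ := by
          simp only [mul_pow, one_div, inv_pow]; field_simp; ring
  have h2 : pv (fun β => (f (α - β) : ℂ) * (β : ℂ) ^ 2 /
        ((β : ℂ) * (1 - Complex.exp (-Complex.I * (β : ℂ))) ^ 2) * expTail 2 θ α β) =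
      (-Complex.I) * opT 1 (fun x => (f x : ℂ)) (expRem 2 fun x => (θ x : ℂ)) α := by
    refine PVB.pv_eq (((pvb_opT hf (wiener_expRem hθ 2) 1 α).const_mul (-Complex.I)).congr
      fun β h0 h1 => ?_)
    have hb : (β : ℂ) ≠ 0 := by exact_mod_cast h0
    have he := one_sub_exp_ne_zero h0 h1
    rw [expTail_eq hθ]
    simp only [kerMul, ker]
    generalize segAvg (expRem 2 fun x => (θ x : ℂ)) α β = U
    generalize 1 - Complex.exp (-Complex.I * (β : ℂ)) = E at *
    field_simp
    simp only [Complex.I_sq]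
    ring
  have h3 : ∀ p : ℕ × ℕ, (if 2 ≤ p.1 + p.2 then
      (-1) ^ p.1 * Complex.I ^ (p.2 + p.1 + 1) * (θ α : ℂ) ^ p.2 / (p.2.factorial : ℂ) *
        pv fun β => (f (α - β) : ℂ) * (β : ℂ) ^ (p.1 + 1) /
              ((β : ℂ) * (1 - Complex.exp (-Complex.I * (β : ℂ))) ^ (p.1 + 1)) *
            expTail 1 θ α β ^ p.1
      else 0) = Complex.I * (if 2 ≤ p.1 + p.2 then expansionTerm θ f α p else 0) := by
    intro p
    split_ifs
    · have e1 : (-Complex.I) ^ p.1 * (Complex.I) ^ p.1 = 1 := by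
        rw [← mul_pow, neg_mul, Complex.I_mul_I, neg_neg, one_pow]
      rw [h1, expansionTerm, pow_succ, pow_add]
      linear_combination ((-1) ^ p.1 * Complex.I ^ p.2 * Complex.I * (θ α : ℂ) ^ p.2 /
        (p.2.factorial : ℂ) * opT p.1 (fun x => (f x : ℂ)) (expRem 1 fun x => (θ x : ℂ)) α) * e1
    · rw [mul_zero]
  rw [opS, h2, tsum_congr h3, tsum_mul_left]
  ring

lemma cot_half_eq {β : ℝ} (h0 : β ≠ 0) (h1 : |β| ≤ Real.pi) :
    ((1 / Real.tan (β / 2) : ℝ) : ℂ) = Complex.I * (2 * ker β - 1) := by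
  rw [ker_eq h0 h1, Real.tan_eq_sin_div_cos, one_div_div]
  generalize Real.cos (β / 2) / Real.sin (β / 2) = c
  ring_nf
  simp

lemma integral_comp_sub_eq {F : ℝ → ℂ} (hF : Wiener F) (α : ℝ) :
    ∫ β in (-Real.pi)..Real.pi, F (α - β) = 2 * (Real.pi : ℂ) * fc F 0 := by
  have hpi : (Real.pi : ℂ) ≠ 0 := by exact_mod_cast Real.pi_ne_zero
  rw [intervalIntegral.integral_comp_sub_left, fc_eq]
  have h := hF.periodic.intervalIntegral_add_eq (α - Real.pi) (-Real.pi)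
  rw [show α - Real.pi + 2 * Real.pi = α - -Real.pi by ring,
    show -Real.pi + 2 * Real.pi = Real.pi by ring] at h
  rw [h]
  simp only [neg_zero, mode_zero, one_mul]
  field_simp

/-- `cot(β/2) = i(2 ker β - 1)`, and the constant part integrates to zero because `f` has mean zero.
The function `u` enters only through a zeroth power, so it is arbitrary. -/
lemma hilbert_eq (hf : Wiener fun x => (f x : ℂ)) (h0 : fc (fun x => (f x : ℂ)) 0 = 0)
    {u : ℝ → ℂ} (hu : Wiener u) (α : ℝ) :
    (hilbert f α : ℂ) = Complex.I / (Real.pi : ℂ) * opT 0 (fun x => (f x : ℂ)) u α := by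
  have hpi : (Real.pi : ℂ) ≠ 0 := by exact_mod_cast Real.pi_ne_zero
  have hc := hf.continuous
  have hb : ∀ x, ‖(f x : ℂ)‖ ≤ absSum fun x => (f x : ℂ) := by
    intro x
    rw [hf.hasExp.eq x]
    refine tsum_of_norm_bounded hf.summable.hasSum fun k => ?_
    rw [norm_mul, norm_mode, mul_one]
  have h1 := PVB.of_bounded (g := fun β => (f (α - β) : ℂ))
    (by
      have : Continuous fun β : ℝ => (f (α - β) : ℂ) :=
        hc.comp (by fun_prop : Continuous fun β : ℝ => α - β)
      exact this.aestronglyMeasurable) (fun β _ _ => hb (α - β))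
  rw [integral_comp_sub_eq hf, h0, mul_zero] at h1
  have h2 := (((pvb_opT hf hu 0 α).const_mul 2).sub h1).const_mul Complex.I
  have h3 := h2.congr (h := fun β => ((f (α - β) / Real.tan (β / 2) : ℝ) : ℂ)) fun β hb0 hb1 => by
    rw [div_eq_mul_one_div, Complex.ofReal_mul, cot_half_eq hb0 hb1]
    ring
  rw [hilbert, Complex.ofReal_mul, h3.pv_ofReal]
  push_cast
  field_simp
  ring

/-! ### The geometric series for the Birkhoff–Rott integral. -/

lemma absSum_expRem_one_le {u : ℝ → ℂ} (hu : Wiener u) :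
    absSum (expRem 1 u) ≤ Real.exp (absSum u) - 1 := by
  have h := hasExp_expRem hu 1
  have h1 := h.wn_le fun _ => 1
  simp only [wn, one_mul] at h1
  have hs := h.summable
  have h2 : absSum (expRem 1 u) ≤ ∑' p : Σ m : ℕ, (Fin (m + 1) → ℤ),
      ‖Complex.I ^ (p.1 + 1) / ((p.1 + 1).factorial : ℂ) * ∏ q, fc u (p.2 q)‖ := by
    have h3 := ENNReal.toReal_mono (tsum_enorm_ne_top hs) h1
    rw [ENNReal.tsum_toReal_eq fun _ => enorm_ne_top, ENNReal.tsum_toReal_eq fun _ => enorm_ne_top] at h3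
    simp only [toReal_enorm] at h3
    exact h3
  refine h2.trans (le_of_eq ?_)
  rw [hs.tsum_sigma' fun m => ?_]
  · have h4 : ∀ m : ℕ, ∑' κ : Fin (m + 1) → ℤ,
        ‖Complex.I ^ (m + 1) / ((m + 1).factorial : ℂ) * ∏ q, fc u (κ q)‖ =
        absSum u ^ (m + 1) / ((m + 1).factorial : ℝ) := by
      intro m
      simp only [norm_mul, norm_I_pow_div]
      have h2 := (hasSum_norm_pow hu.summable (m + 1)).tsum_eq
      rw [tsum_mul_left, h2, absSum]
      ring
    simp only [h4]
    have h5 := (NormedSpace.expSeries_div_hasSum_exp (𝔸 := ℝ) (absSum u))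
    rw [← Real.exp_eq_exp_ℝ] at h5
    rw [← h5.tsum_eq, h5.summable.tsum_eq_zero_add]
    simp
  · simp only [norm_mul]
    exact (hasSum_norm_pow hu.summable (m + 1)).summable.mul_left _

lemma norm_segAvg_le {u : ℝ → ℂ} (hu : Wiener u) (α β : ℝ) : ‖segAvg u α β‖ ≤ absSum u := by
  rw [← (hasSum_segAvg hu.hasExp α β).tsum_eq]
  refine tsum_of_norm_bounded hu.summable.hasSum fun k => ?_
  rw [norm_mul, norm_mul, norm_mode, mul_one]
  exact mul_le_of_le_one_right (norm_nonneg _) (norm_psi_le _ _)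

/-- `truncConst n` grows like `n (π/2)^n`; this is where the threshold `(π/2) y < 1` is needed. -/
lemma summable_truncConst_mul_pow {y : ℝ} (h0 : 0 ≤ y) (h1 : Real.pi / 2 * y < 1) (c : ℝ) :
    Summable fun n : ℕ => c * y ^ n * truncConst n := by
  have hpi := Real.pi_pos
  have hy : y < 1 := by nlinarith [Real.two_le_pi]
  have s1 : Summable fun n : ℕ => 16 * y ^ n := (summable_geometric_of_lt_one h0 hy).mul_left _
  have s2 : Summable fun n : ℕ => (n : ℝ) ^ 1 * (Real.pi / 2 * y) ^ n :=
    summable_pow_mul_geometric_of_norm_lt_one 1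
      (by rwa [Real.norm_of_nonneg (by positivity)])
  have s3 : Summable fun n : ℕ => (n : ℝ) * (Real.pi / 2) ^ (n - 1) * y ^ n := by
    refine (s2.mul_left (2 / Real.pi)).congr fun n => ?_
    rcases n with _ | n
    · simp
    · rw [Nat.add_sub_cancel, mul_pow, pow_succ (Real.pi / 2)]
      field_simp
  have s4 := (s1.add (s3.mul_right (2 * Real.pi * (√(1 + Real.pi ^ 2 / 4) * Real.pi)))).mul_left c
  refine s4.congr fun n => ?_
  rw [truncConst]; ring

lemma kerMul_mul_psi_one {β : ℝ} (h0 : β ≠ 0) (h1 : |β| ≤ Real.pi) : kerMul β * psi 1 β = 1 := by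
  have hb : (β : ℂ) ≠ 0 := by exact_mod_cast h0
  have he := one_sub_exp_ne_zero h0 h1
  have h2 : mode (-1) β = Complex.exp (-Complex.I * (β : ℂ)) := by
    rw [mode]; congr 1; push_cast; ring
  rw [psi_eq one_ne_zero h0, h2, kerMul, ker]
  generalize 1 - Complex.exp (-Complex.I * (β : ℂ)) = E at *
  have := Complex.I_ne_zero
  push_cast
  field_simp

/-- The mean of `ϑ` and the angle `α` leave the integral as a phase, and `e^{iθ} = 1 + expRem 1`
separates the circle from its perturbation. -/
lemma BRconj_integral_eq {ϑ : ℝ → ℝ} (hθ : Wiener fun x => (theta ϑ x : ℂ)) (α β : ℝ) :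
    (∫ s in (0 : ℝ)..1, Complex.exp (Complex.I * ((α + (s - 1) * β : ℝ) : ℂ)) *
      Complex.exp (Complex.I * (ϑ (α + (s - 1) * β) : ℂ))) =
    Complex.exp (Complex.I * ((α + mean ϑ : ℝ) : ℂ)) *
      (psi 1 β + segAvg (expRem 1 fun x => (theta ϑ x : ℂ)) α β) := by
  have h1 : psi 1 β = segAvg (fun _ => 1) α β := by
    simp only [psi, segAvg, mul_one, exp_eq_mode_one]
  rw [h1, ← segAvg_add continuous_const (wiener_expRem hθ 1).continuous, segAvg,
    ← intervalIntegral.integral_const_mul]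
  congr 1; ext s
  rw [expRem_one, add_sub_cancel, theta]
  simp only [← Complex.exp_add]
  congr 1
  push_cast
  ring

/-- Since `kerMul * psi 1 = 1`, the integrand is a phase times `ω ker / (1 + kerMul * segAvg)`. Its
geometric series converges uniformly in `β`, and principal values may be taken term by term. -/
lemma BRconj_mul_exp_eq {L : ℝ} {ϑ ω : ℝ → ℝ} (hθ : Wiener fun x => (theta ϑ x : ℂ))
    (hω : Wiener fun x => (ω x : ℂ))
    (hsmall : Real.pi / 2 * absSum (expRem 1 fun x => (theta ϑ x : ℂ)) < 1) (α : ℝ) :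
    BRconj L ϑ ω α * Complex.exp (Complex.I * ((α + ϑ α : ℝ) : ℂ)) =
      1 / (L : ℂ) * (Complex.exp (Complex.I * (theta ϑ α : ℂ)) * ∑' n : ℕ, (-1) ^ n *
        opT n (fun x => (ω x : ℂ)) (expRem 1 fun x => (theta ϑ x : ℂ)) α) := by
  have hu := wiener_expRem hθ 1
  have hE := Complex.exp_ne_zero (Complex.I * ((α + mean ϑ : ℝ) : ℂ))
  have h1 := fun n => ((pvb_opT hω hu n α).const_mul ((-1) ^ n)).mono (D :=
    absSum (fun x => (ω x : ℂ)) * absSum (expRem 1 fun x => (theta ϑ x : ℂ)) ^ n * truncConst n)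
    (by simp)
  have h2 := PVB.tsum (g := fun β => (ω (α - β) : ℂ) * ker β *
    (1 / (1 + kerMul β * segAvg (expRem 1 fun x => (theta ϑ x : ℂ)) α β))) h1
    (summable_truncConst_mul_pow (absSum_nonneg _) hsmall _) fun β hb0 hb1 => by
      have hz : ‖-(kerMul β * segAvg (expRem 1 fun x => (theta ϑ x : ℂ)) α β)‖ < 1 := by
        rw [norm_neg, norm_mul]
        refine lt_of_le_of_lt ?_ hsmall
        have := Real.pi_pos
        exact mul_le_mul (norm_kerMul_le hb0 hb1) (norm_segAvg_le hu α β) (norm_nonneg _)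
          (by positivity)
      have hg := (hasSum_geometric_of_norm_lt_one hz).mul_left ((ω (α - β) : ℂ) * ker β)
      rw [sub_neg_eq_add, ← one_div] at hg
      refine hg.congr_fun fun n => ?_
      rw [neg_pow]; ring
  have h3 := (h2.const_mul (Complex.I / Complex.exp (Complex.I * ((α + mean ϑ : ℝ) : ℂ)))).congr
    (h := fun β => (ω (α - β) : ℂ) /
        (∫ s in (0 : ℝ)..1,
          Complex.exp (Complex.I * ((α + (s - 1) * β : ℝ) : ℂ)) *
            Complex.exp (Complex.I * (ϑ (α + (s - 1) * β) : ℂ))) *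
      (1 / (β : ℂ))) fun β hb0 hb1 => by
      have hb : (β : ℂ) ≠ 0 := by exact_mod_cast hb0
      have he := one_sub_exp_ne_zero hb0 hb1
      rw [BRconj_integral_eq hθ]
      have hk := kerMul_mul_psi_one hb0 hb1
      have hk0 : kerMul β ≠ 0 := left_ne_zero_of_mul_eq_one hk
      rw [← hk, ← mul_add]
      simp only [kerMul] at *
      generalize ker β = k at *
      generalize segAvg (expRem 1 fun x => (theta ϑ x : ℂ)) α β = U
      have hk1 : k ≠ 0 := right_ne_zero_of_mul hk0
      have := Complex.I_ne_zero
      field_simp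
  rw [BRconj, h3.pv_eq]
  have he : Complex.exp (Complex.I * ((α + ϑ α : ℝ) : ℂ)) =
      Complex.exp (Complex.I * ((α + mean ϑ : ℝ) : ℂ)) * Complex.exp (Complex.I * (theta ϑ α : ℂ)) := by
    rw [← Complex.exp_add, theta]; congr 1; push_cast; ring
  rw [he]
  have := Complex.I_ne_zero
  field_simp

lemma summable_opT_series {u : ℝ → ℂ} {F : ℝ → ℂ} (hu : Wiener u) (hF : Wiener F)
    (hsmall : Real.pi / 2 * absSum u < 1) (α : ℝ) : Summable fun n : ℕ => ‖opT n F u α‖ :=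
  Summable.of_nonneg_of_le (fun _ => norm_nonneg _) (fun n => (pvb_opT hF hu n α).norm_le)
    (summable_truncConst_mul_pow (absSum_nonneg _) hsmall _)

/-- Among the low orders, `(0,0)` is purely imaginary and disappears in the real part. Order `(0,1)`
gives `θ𝓗`, and the linear part of `(1,0)` gives `ℛ`; its remainder is the last term of `𝒮`. -/
lemma opD_eq {L : ℝ} {ϑ ω : ℝ → ℝ} (hθ : Wiener fun x => (theta ϑ x : ℂ))
    (hω : Wiener fun x => (ω x : ℂ)) (h0 : fc (fun x => (ω x : ℂ)) 0 = 0)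
    (hsmall : Real.pi / 2 * absSum (expRem 1 fun x => (theta ϑ x : ℂ)) < 1) (α : ℝ) :
    opD L ϑ ω α = -Real.pi / L * (theta ϑ α * hilbert ω α + (opR (theta ϑ) ω α).im
      + (opS (theta ϑ) ω α).im) := by
  have hpi : (Real.pi : ℂ) ≠ 0 := by exact_mod_cast Real.pi_ne_zero
  have hu := wiener_expRem hθ 1
  have hs := summable_opT_series hu hω hsmall α
  have he := hasSum_exp_I_mul (theta ϑ α : ℂ)
  have hes : Summable fun m : ℕ =>
      ‖Complex.I ^ m / (m.factorial : ℂ) * (theta ϑ α : ℂ) ^ m‖ := by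
    simp only [norm_mul, norm_I_pow_div, norm_pow, one_div_mul_eq_div]
    exact Real.summable_pow_div_factorial _
  have hs' : Summable fun n : ℕ => ‖(-1) ^ n *
      opT n (fun x => (ω x : ℂ)) (expRem 1 fun x => (theta ϑ x : ℂ)) α‖ := by simpa using hs
  have hF : HasSum (expansionTerm (theta ϑ) ω α) (Complex.exp (Complex.I * (theta ϑ α : ℂ)) *
      ∑' n : ℕ, (-1) ^ n * opT n (fun x => (ω x : ℂ)) (expRem 1 fun x => (theta ϑ x : ℂ)) α) := by
    rw [mul_comm]
    have hprod := summable_mul_of_summable_norm (f := fun n : ℕ => (-1) ^ n *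
      opT n (fun x => (ω x : ℂ)) (expRem 1 fun x => (theta ϑ x : ℂ)) α)
      (g := fun m : ℕ => Complex.I ^ m / (m.factorial : ℂ) * (theta ϑ α : ℂ) ^ m) hs' hes
    refine (HasSum.mul (f := fun n : ℕ => (-1) ^ n *
      opT n (fun x => (ω x : ℂ)) (expRem 1 fun x => (theta ϑ x : ℂ)) α)
      (g := fun m : ℕ => Complex.I ^ m / (m.factorial : ℂ) * (theta ϑ α : ℂ) ^ m)
      hs'.of_norm.hasSum he hprod).congr_fun fun p => ?_
    rw [expansionTerm]; ring
  have hsplit : ∑' p, expansionTerm (theta ϑ) ω α p =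
      (∑' p : ℕ × ℕ, if 2 ≤ p.1 + p.2 then expansionTerm (theta ϑ) ω α p else 0) +
      (expansionTerm (theta ϑ) ω α (0, 0) + expansionTerm (theta ϑ) ω α (0, 1) +
        expansionTerm (theta ϑ) ω α (1, 0)) := by
    have h1 : HasSum (fun p : ℕ × ℕ => if 2 ≤ p.1 + p.2 then 0 else expansionTerm (theta ϑ) ω α p)
        (∑ p ∈ ({(0, 0), (0, 1), (1, 0)} : Finset (ℕ × ℕ)),
          if 2 ≤ p.1 + p.2 then 0 else expansionTerm (theta ϑ) ω α p) := by
      refine hasSum_sum_of_ne_finset_zero fun p hp => ?_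
      rw [if_pos]
      by_contra! h
      apply hp
      obtain ⟨n, l⟩ := p
      simp only [Finset.mem_insert, Finset.mem_singleton, Prod.mk.injEq]
      simp only at h
      lia
    have h2 := hF.sub h1
    have h3 : (fun p : ℕ × ℕ => expansionTerm (theta ϑ) ω α p -
        if 2 ≤ p.1 + p.2 then 0 else expansionTerm (theta ϑ) ω α p) =
        fun p => if 2 ≤ p.1 + p.2 then expansionTerm (theta ϑ) ω α p else 0 := by
      ext p; split_ifs <;> simp
    rw [h3] at h2
    rw [h2.tsum_eq, hF.tsum_eq]
    simp
    ring
  -- The term of order `n = 1` is not homogeneous in `θ`: from `e^{iθ} - 1 = iθ + expRem 2` its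
  -- linear part is separated.
  have hT1 : opT 1 (fun x => (ω x : ℂ)) (expRem 1 fun x => (theta ϑ x : ℂ)) α =
      Complex.I * opT 1 (fun x => (ω x : ℂ)) (fun x => (theta ϑ x : ℂ)) α +
      opT 1 (fun x => (ω x : ℂ)) (expRem 2 fun x => (theta ϑ x : ℂ)) α := by
    rw [← opT_one_const_mul_right hω hθ, ← opT_one_add_right hω (hθ.const_mul _) (wiener_expRem hθ 2)]
    congr 1; ext x
    rw [expRem_one, expRem_two]; ring
  have hH := hilbert_eq hω h0 hu α
  have hH' : opT 0 (fun x => (ω x : ℂ)) (expRem 1 fun x => (theta ϑ x : ℂ)) α =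
      -Complex.I * Real.pi * (hilbert ω α : ℂ) := by
    rw [hH]
    field_simp
    simp
  rw [opD, BRconj_mul_exp_eq hθ hω hsmall, ← hF.tsum_eq, hsplit, opR_eq hω hθ, opS_eq hω hθ]
  simp only [expansionTerm, hT1, hH']
  generalize (∑' p : ℕ × ℕ, if 2 ≤ p.1 + p.2 then (-1) ^ p.1 * (Complex.I ^ p.2 /
    (p.2.factorial : ℂ) * (theta ϑ α : ℂ) ^ p.2) * opT p.1 (fun x => (ω x : ℂ))
    (expRem 1 fun x => (theta ϑ x : ℂ)) α else 0) = S
  generalize opT 1 (fun x => (ω x : ℂ)) (fun x => (theta ϑ x : ℂ)) α = R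
  generalize opT 1 (fun x => (ω x : ℂ)) (expRem 2 fun x => (theta ϑ x : ℂ)) α = T
  have e1 : ∀ z : ℂ, (1 / (L : ℂ) * z).re = 1 / L * z.re := by
    intro z; rw [← Complex.ofReal_one, ← Complex.ofReal_div, Complex.re_ofReal_mul]
  have e2 : ∀ z : ℂ, (Complex.I / (Real.pi : ℂ) * z).im = 1 / Real.pi * z.re := by
    intro z
    rw [show Complex.I / (Real.pi : ℂ) * z = ((1 / Real.pi : ℝ) : ℂ) * (Complex.I * z) by
      push_cast; ring, Complex.im_ofReal_mul]
    simp
  have e3 : ∀ z : ℂ, (1 / (Real.pi : ℂ) * z).im = 1 / Real.pi * z.im := by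
    intro z; rw [← Complex.ofReal_one, ← Complex.ofReal_div, Complex.im_ofReal_mul]
  rw [e1, e2, e3]
  have := Real.pi_ne_zero
  simp
  field_simp
  ring

/-! ### Weighted bounds -/

namespace IsWeight

variable {w φ : ℤ → ℝ≥0∞}

/-- Submultiplicativity at `k + (-k) = 0` with evenness gives `w k ^ 2 ≥ 1`. -/
lemma one_le_w (hw : IsWeight w φ) (k : ℤ) : 1 ≤ w k := by
  have h := hw.w_add k (-k)
  rw [add_neg_cancel, hw.w_zero, hw.w_neg] at h
  by_contra! hlt
  exact absurd h (not_le.2 (by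
    calc w k * w k ≤ w k * 1 := mul_le_mul_right hlt.le _
      _ < 1 := by rwa [mul_one]))

variable (A F : ℤ → ℝ≥0∞) (l : ℕ)

lemma tsum_w_pow_mul_le (hw : IsWeight w φ) :
    ∑' p : (Fin l → ℤ) × ℤ, w (∑ i, p.1 i + p.2) * ((∏ i, A (p.1 i)) * F p.2)
    ≤ (∑' k, w k * A k) ^ l * ∑' k, w k * F k := by
  have h := hw.tsum_w_block_le A F F l 0
  rw [ENNReal.tsum_prod'] at h ⊢
  simp only [ENNReal.tsum_prod', tsum_fintype, Finset.univ_unique, Finset.sum_singleton,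
    Fin.prod_univ_zero, Fin.sum_univ_zero, add_zero, mul_one, pow_zero] at h
  exact h

lemma tsum_wpow_pow_mul_le (hw : IsWeight w φ) {s : ℝ} (hs : 0 < s) :
    ∑' p : (Fin l → ℤ) × ℤ, wpow w φ s (∑ i, p.1 i + p.2) * ((∏ i, A (p.1 i)) * F p.2)
    ≤ ENNReal.ofReal (b (l + 1) s) * ((∑' k, w k * A k) ^ l * (∑' k, wpow w φ s k * F k)
      + (l * (∑' k, wpow w φ s k * A k) * (∑' k, w k * A k) ^ (l - 1)) * ∑' k, w k * F k) := by
  have h := hw.tsum_wpow_block_le A F F l 0 hs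
  rw [ENNReal.tsum_prod'] at h ⊢
  simp only [ENNReal.tsum_prod', tsum_fintype, Finset.univ_unique, Finset.sum_singleton,
    Fin.prod_univ_zero, Fin.sum_univ_zero, add_zero, mul_one, pow_zero, Nat.cast_zero, zero_mul,
    mul_zero] at h
  exact h

lemma tsum_w_pow_le (hw : IsWeight w φ) :
    ∑' κ : Fin l → ℤ, w (∑ i, κ i) * ∏ i, A (κ i) ≤ (∑' k, w k * A k) ^ l := by
  rw [← tsum_prod_const]
  refine ENNReal.tsum_le_tsum fun κ => ?_
  refine (mul_le_mul_left (hw.w_sum_le _ _) _).trans (le_of_eq ?_)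
  rw [Finset.prod_mul_distrib]

lemma tsum_wpow_pow_le (hw : IsWeight w φ) {s : ℝ} (hs : 0 < s) :
    ∑' κ : Fin l → ℤ, wpow w φ s (∑ i, κ i) * ∏ i, A (κ i)
    ≤ ENNReal.ofReal (b l s) *
      (l * (∑' k, wpow w φ s k * A k) * (∑' k, w k * A k) ^ (l - 1)) := by
  have hA : ∑' k, wpow w φ s k * A k = ∑' k, (w k * A k) * φ k ^ s :=
    tsum_congr fun k => by rw [wpow]; ring
  rw [hA, ← tsum_prod_mul_sum (fun k => w k * A k) (fun k => φ k ^ s), ← ENNReal.tsum_mul_left]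
  refine ENNReal.tsum_le_tsum fun κ => ?_
  have h1 := (ENNReal.rpow_le_rpow (hw.φ_sum_le Finset.univ κ) hs.le).trans
    (rpow_sum_le_b Finset.univ (fun i => φ (κ i)) hs)
  rw [Finset.card_univ, Fintype.card_fin] at h1
  refine (mul_le_mul_left (mul_le_mul' (hw.w_sum_le _ _) h1) _).trans (le_of_eq ?_)
  simp only [Finset.prod_mul_distrib]
  ring

end IsWeight

/-- The weighted norm of the convolution of the absolute Fourier coefficients. -/
def convNorm (W : ℤ → ℝ≥0∞) (F V : ℝ → ℂ) : ℝ≥0∞ :=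
  ∑' p : ℤ × ℤ, W (p.1 + p.2) * (‖fc F p.1‖ₑ * ‖fc V p.2‖ₑ)

section Operators

variable {F V U Θ : ℝ → ℂ} (W : ℤ → ℝ≥0∞)

lemma wn_mul_le_convNorm (hF : Wiener F) (hV : Wiener V) :
    wn W (fun α => F α * V α) ≤ convNorm W F V := by
  refine ((hF.hasExp.mul hV.hasExp).wn_le W).trans (le_of_eq ?_)
  simp [convNorm]

lemma enorm_mult_le {n : ℕ} (j : ℤ) (κ : Fin n → ℤ) :
    ‖mult j κ‖ₑ ≤ ENNReal.ofReal (Real.pi * a n) := by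
  rw [← ofReal_norm]
  exact ENNReal.ofReal_le_ofReal (norm_mult_le j κ)

/-- The multiplier need only be controlled on the frequencies present in `F`; this lets the sharp
bound for `ω₀` enter. -/
lemma wn_opT_one_le_of_mult_le (hF : Wiener F) (hV : Wiener V) {C : ℝ≥0∞}
    (hC : ∀ j : ℤ, fc F j ≠ 0 → ∀ κ : Fin 1 → ℤ, ‖mult j κ‖ₑ ≤ C) :
    wn W (opT 1 F V) ≤ C * convNorm W F V := by
  refine ((hasExp_opT hF hV 1).wn_le W).trans ?_
  rw [← ((Equiv.refl ℤ).prodCongr (Equiv.funUnique (Fin 1) ℤ)).symm.tsum_eq, convNorm,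
    ← ENNReal.tsum_mul_left]
  refine ENNReal.tsum_le_tsum fun p => ?_
  simp only [Equiv.prodCongr_symm, Equiv.prodCongr_apply, Prod.map, Equiv.refl_symm, Equiv.refl_apply,
    Fin.sum_univ_one, Fin.prod_univ_one, enorm_mul, Equiv.funUnique_symm_apply, uniqueElim_const]
  by_cases h0 : fc F p.1 = 0
  · simp [h0]
  · calc W (p.1 + p.2) * (‖fc F p.1‖ₑ * ‖fc V p.2‖ₑ * ‖mult p.1 _‖ₑ)
        ≤ W (p.1 + p.2) * (‖fc F p.1‖ₑ * ‖fc V p.2‖ₑ * C) := by gcongr; exact hC _ h0 _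
      _ = _ := by ring

lemma wn_opT_one_le (hF : Wiener F) (hV : Wiener V) :
    wn W (opT 1 F V) ≤ ENNReal.ofReal (Real.pi * a 1) * convNorm W F V :=
  wn_opT_one_le_of_mult_le W hF hV fun _ _ _ => enorm_mult_le _ _

/-- Since `a 0 = 1`, there is no loss from `Ctilde`; after division by `π` the Hilbert transform is
bounded with constant `1`. -/
lemma wn_opT_zero_le (hF : Wiener F) (hV : Wiener V) :
    wn W (opT 0 F V) ≤ ENNReal.ofReal Real.pi * wn W F := by
  have h1 : ∀ p : ℤ × (Fin 0 → ℤ), W (p.1 + ∑ q, p.2 q) *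
      ‖fc F p.1 * (∏ q, fc V (p.2 q)) * mult p.1 p.2‖ₑ ≤
      ENNReal.ofReal Real.pi * (W p.1 * ‖fc F p.1‖ₑ) := by
    intro p
    have h := enorm_mult_le p.1 p.2
    have ha : a 0 = 1 := by simp [a]
    rw [ha, mul_one] at h
    rw [Fin.sum_univ_zero, Fin.prod_univ_zero, add_zero, mul_one, enorm_mul]
    calc W p.1 * (‖fc F p.1‖ₑ * ‖mult p.1 p.2‖ₑ) ≤
        W p.1 * (‖fc F p.1‖ₑ * ENNReal.ofReal Real.pi) := by gcongr
      _ = _ := by ring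
  refine ((hasExp_opT hF hV 0).wn_le W).trans ((ENNReal.tsum_le_tsum h1).trans (le_of_eq ?_))
  rw [ENNReal.tsum_mul_left, ENNReal.tsum_prod', wn]
  congr 1
  refine tsum_congr fun j => ?_
  rw [tsum_fintype]
  simp

lemma tsum_pow_mul_opT_le (F U Θ : ℝ → ℂ) (l n : ℕ) :
    ∑' p : (Fin l → ℤ) × ℤ × (Fin n → ℤ), W (∑ i, p.1 i + (p.2.1 + ∑ i, p.2.2 i)) *
      ‖(∏ i, fc Θ (p.1 i)) * (fc F p.2.1 * (∏ i, fc U (p.2.2 i)) * mult p.2.1 p.2.2)‖ₑ ≤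
    ENNReal.ofReal (Real.pi * a n) *
      ∑' p : (Fin l → ℤ) × ℤ × (Fin n → ℤ), W (∑ i, p.1 i + (p.2.1 + ∑ i, p.2.2 i)) *
      ((∏ i, ‖fc Θ (p.1 i)‖ₑ) * (‖fc F p.2.1‖ₑ * ∏ i, ‖fc U (p.2.2 i)‖ₑ)) := by
  have hprod : ∀ {m : ℕ} (g : Fin m → ℂ), ‖∏ i, g i‖ₑ = ∏ i, ‖g i‖ₑ := by
    intro m g
    rw [← ofReal_norm, norm_prod, ENNReal.ofReal_prod_of_nonneg fun _ _ => norm_nonneg _]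
    simp only [ofReal_norm]
  rw [← ENNReal.tsum_mul_left]
  refine ENNReal.tsum_le_tsum fun p => ?_
  simp only [enorm_mul, hprod]
  calc _ ≤ W (∑ i, p.1 i + (p.2.1 + ∑ i, p.2.2 i)) * ((∏ i, ‖fc Θ (p.1 i)‖ₑ) *
        (‖fc F p.2.1‖ₑ * (∏ i, ‖fc U (p.2.2 i)‖ₑ) * ENNReal.ofReal (Real.pi * a n))) := by
        gcongr; exact enorm_mult_le _ _
    _ = _ := by ring

/-- Normally convergent sums of expansions. -/
lemma HasExp.tsum_bound {ι : Type} [Countable ι] {κ : ι → Type} [∀ i, Countable (κ i)]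
    {c : ∀ i, κ i → ℂ} {k : ∀ i, κ i → ℤ} {G : ι → ℝ → ℂ} {S : ℝ → ℂ}
    (h : ∀ i, HasExp (c i) (k i) (G i)) (hfin : ∑' i, ∑' j, ‖c i j‖ₑ ≠ ∞)
    (hS : ∀ α, S α = ∑' i, G i α) :
    Wiener S ∧ ∀ W : ℤ → ℝ≥0∞, wn W S ≤ ∑' i, ∑' j, W (k i j) * ‖c i j‖ₑ := by
  have hs : Summable fun i => ∑' j, ‖c i j‖ := by
    have := ENNReal.summable_toReal hfin
    refine this.congr fun i => ?_
    rw [ENNReal.tsum_toReal_eq fun _ => enorm_ne_top]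
    simp only [toReal_enorm]
  have h1 := HasExp.sigma h hs hS
  refine ⟨h1.wiener, fun W => (h1.wn_le W).trans (le_of_eq ?_)⟩
  rw [ENNReal.tsum_sigma']

variable {w φ : ℤ → ℝ≥0∞}

lemma tsum_w_fc (F : ℝ → ℂ) (W : ℤ → ℝ≥0∞) : ∑' k, W k * ‖fc F k‖ₑ = wn W F := rfl

lemma convNorm_w_le (hw : IsWeight w φ) (F V : ℝ → ℂ) :
    convNorm w F V ≤ wn w F * wn w V := by
  have h := hw.tsum_w_pow_mul_le (fun k => ‖fc F k‖ₑ) (fun k => ‖fc V k‖ₑ) 1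
  rw [← ((Equiv.funUnique (Fin 1) ℤ).symm.prodCongr (Equiv.refl ℤ)).tsum_eq] at h
  simpa [convNorm, wn] using h

lemma convNorm_wpow_le (hw : IsWeight w φ) {s : ℝ} (hs : 0 < s) (F V : ℝ → ℂ) :
    convNorm (wpow w φ s) F V ≤ ENNReal.ofReal (b 2 s) *
      (wn w F * wn (wpow w φ s) V + wn (wpow w φ s) F * wn w V) := by
  have h := hw.tsum_wpow_pow_mul_le (fun k => ‖fc F k‖ₑ) (fun k => ‖fc V k‖ₑ) 1 hs
  rw [← ((Equiv.funUnique (Fin 1) ℤ).symm.prodCongr (Equiv.refl ℤ)).tsum_eq] at h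
  simpa [convNorm, wn] using h

lemma enorm_I_pow_div (m : ℕ) :
    ‖Complex.I ^ m / (m.factorial : ℂ)‖ₑ = ENNReal.ofReal (1 / (m.factorial : ℝ)) := by
  rw [← ofReal_norm, norm_I_pow_div]

lemma enorm_prod {m : ℕ} (g : Fin m → ℂ) : ‖∏ i, g i‖ₑ = ∏ i, ‖g i‖ₑ := by
  rw [← ofReal_norm, norm_prod, ENNReal.ofReal_prod_of_nonneg fun _ _ => norm_nonneg _]
  simp only [ofReal_norm]

lemma wn_expRem_le (hΘ : Wiener Θ) (m₀ : ℕ) :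
    wn W (expRem m₀ Θ) ≤ ∑' m : ℕ, ENNReal.ofReal (1 / ((m + m₀).factorial : ℝ)) *
      ∑' κ : Fin (m + m₀) → ℤ, W (∑ i, κ i) * ∏ i, ‖fc Θ (κ i)‖ₑ := by
  refine ((hasExp_expRem hΘ m₀).wn_le W).trans (le_of_eq ?_)
  rw [ENNReal.tsum_sigma']
  refine tsum_congr fun m => ?_
  rw [← ENNReal.tsum_mul_left]
  refine tsum_congr fun κ => ?_
  rw [enorm_mul, enorm_I_pow_div, enorm_prod]
  ring

lemma convNorm_expRem_le (hΘ : Wiener Θ) (m₀ : ℕ) (F : ℝ → ℂ) :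
    convNorm W F (expRem m₀ Θ) ≤ ∑' m : ℕ, ENNReal.ofReal (1 / ((m + m₀).factorial : ℝ)) *
      ∑' p : (Fin (m + m₀) → ℤ) × ℤ, W (∑ i, p.1 i + p.2) *
        ((∏ i, ‖fc Θ (p.1 i)‖ₑ) * ‖fc F p.2‖ₑ) := by
  have hE := hasExp_expRem hΘ m₀
  have h1 : ∀ j : ℤ, ∑' k : ℤ, W (j + k) * (‖fc F j‖ₑ * ‖fc (expRem m₀ Θ) k‖ₑ) ≤
      ∑' m : ℕ, ∑' κ : Fin (m + m₀) → ℤ, ENNReal.ofReal (1 / ((m + m₀).factorial : ℝ)) *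
        (W (∑ i, κ i + j) * ((∏ i, ‖fc Θ (κ i)‖ₑ) * ‖fc F j‖ₑ)) := by
    intro j
    -- For a frozen frequency `j` of `F`, the shifted weight is again a weight in `k`, so the
    -- expansion of the remainder can be inserted.
    have h2 := hE.wn_le fun k => W (j + k) * ‖fc F j‖ₑ
    simp only [wn, mul_assoc] at h2
    refine h2.trans (le_of_eq ?_)
    rw [ENNReal.tsum_sigma']
    refine tsum_congr fun m => tsum_congr fun κ => ?_
    rw [enorm_mul, enorm_I_pow_div, enorm_prod, add_comm j]
    ring
  rw [convNorm, ENNReal.tsum_prod']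
  refine (ENNReal.tsum_le_tsum h1).trans (le_of_eq ?_)
  rw [ENNReal.tsum_comm]
  refine tsum_congr fun m => ?_
  rw [ENNReal.tsum_comm, ENNReal.tsum_prod', ← ENNReal.tsum_mul_left]
  refine tsum_congr fun κ => ?_
  rw [← ENNReal.tsum_mul_left]

end Operators

/-! ### Summability of the series of constants -/

lemma b_nonneg (n : ℕ) (s : ℝ) : 0 ≤ b n s := by unfold b; split_ifs <;> positivity

lemma b_one_right (n : ℕ) : b n 1 = 1 := by simp [b]

lemma one_le_b {n : ℕ} (hn : 1 ≤ n) (s : ℝ) : 1 ≤ b n s := by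
  unfold b
  split_ifs with h
  · exact le_rfl
  · exact Real.one_le_rpow (by exact_mod_cast hn) (by linarith)

/-- `b` grows at most polynomially in `n`, hence slower than any `r^n` with `r > 1`. This keeps the
convergence threshold independent of `s`. -/
lemma exists_b_le (s : ℝ) {r : ℝ} (hr : 1 < r) : ∃ C, 0 ≤ C ∧ ∀ n, b n s ≤ C * r ^ n := by
  have hlog := Real.log_pos hr
  have hr0 : 0 < r := by linarith
  by_cases h : s ≤ 1
  · refine ⟨1, by norm_num, fun n => ?_⟩
    rw [b, if_pos h, one_mul]
    exact one_le_pow₀ hr.le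
  · have h1 := (tendsto_rpow_mul_exp_neg_mul_atTop_nhds_zero (s - 1) _ hlog).comp
      tendsto_natCast_atTop_atTop
    obtain ⟨C, hC⟩ := h1.bddAbove_range
    have hC' : ∀ n : ℕ, (n : ℝ) ^ (s - 1) * Real.exp (-Real.log r * n) ≤ C := fun n =>
      hC ⟨n, rfl⟩
    refine ⟨C, (by positivity : (0 : ℝ) ≤ _).trans (hC' 1), fun n => ?_⟩
    have h2 : r ^ n * Real.exp (-Real.log r * n) = 1 := by
      rw [mul_comm (-Real.log r), Real.exp_nat_mul, Real.exp_neg, Real.exp_log hr0, ← mul_pow,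
        mul_inv_cancel₀ hr0.ne', one_pow]
    rw [b, if_neg h]
    calc (n : ℝ) ^ (s - 1) = (n : ℝ) ^ (s - 1) * Real.exp (-Real.log r * n) * r ^ n := by
          rw [mul_assoc, mul_comm (Real.exp _), h2, mul_one]
      _ ≤ C * r ^ n := by gcongr; exact hC' n

lemma summable_b_div_factorial (s x : ℝ) (hx : 0 ≤ x) (c d : ℕ) :
    Summable fun m : ℕ => b (m + c) s / ((m + d).factorial : ℝ) * x ^ m := by
  obtain ⟨C, hC, hb⟩ := exists_b_le s (one_lt_two : (1 : ℝ) < 2)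
  refine Summable.of_nonneg_of_le (fun m => ?_) (fun m => ?_)
    ((Real.summable_pow_div_factorial (2 * x)).mul_left (C * 2 ^ c))
  · have := b_nonneg (m + c) s
    positivity
  · have h1 : (m.factorial : ℝ) ≤ ((m + d).factorial : ℝ) := by
      exact_mod_cast Nat.factorial_le (by lia)
    have h2 : (0 : ℝ) < m.factorial := by exact_mod_cast m.factorial_pos
    calc b (m + c) s / ((m + d).factorial : ℝ) * x ^ m ≤
        C * 2 ^ (m + c) / (m.factorial : ℝ) * x ^ m := by
          gcongr
          exact hb _
      _ = _ := by rw [pow_add, mul_pow]; ring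

lemma a_nonneg (n : ℕ) : 0 ≤ a n := zero_le_one.trans (one_le_a n)

lemma a_one : a 1 = CR := by simp [a, CR]

lemma CR_nonneg : 0 ≤ CR := by rw [← a_one]; exact a_nonneg 1

/-- `a n z^n` is a geometric term plus `n` times a geometric term of ratio `(π/2) z`; a further
power of `n` is harmless. -/
lemma summable_a_mul_pow {z : ℝ} (h0 : 0 ≤ z) (h1 : Real.pi / 2 * z < 1) (k : ℕ) :
    Summable fun n : ℕ => (n : ℝ) ^ k * (a n * z ^ n) := by
  have hpi := Real.pi_pos
  have hz : z < 1 := by nlinarith [Real.two_le_pi]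
  have s1 : Summable fun n : ℕ => (n : ℝ) ^ k * z ^ n :=
    summable_pow_mul_geometric_of_norm_lt_one k (by rwa [Real.norm_of_nonneg h0])
  have s2 : Summable fun n : ℕ => (n : ℝ) ^ (k + 1) * (Real.pi / 2 * z) ^ n :=
    summable_pow_mul_geometric_of_norm_lt_one (k + 1)
      (by rwa [Real.norm_of_nonneg (by positivity)])
  refine (s1.add (s2.mul_left (Ctilde * (2 / Real.pi)))).congr fun n => ?_
  rcases n with _ | n
  · simp [a]
  · rw [a, Nat.add_sub_cancel, mul_pow, pow_succ (Real.pi / 2)]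
    field_simp
    ring

lemma summable_nat_mul_a_mul_pow {z : ℝ} (h0 : 0 ≤ z) (h1 : Real.pi / 2 * z < 1) :
    Summable fun n : ℕ => (n : ℝ) * (a n * z ^ (n - 1)) := by
  rcases h0.eq_or_lt with h | h
  · refine summable_of_ne_finset_zero (s := {0, 1}) fun n hn => ?_
    simp only [Finset.mem_insert, Finset.mem_singleton, not_or] at hn
    rw [← h, zero_pow (by lia)]
    ring
  · refine ((summable_a_mul_pow h0 h1 1).mul_left z⁻¹).congr fun n => ?_
    rcases n with _ | n
    · simp
    · rw [Nat.add_sub_cancel, pow_succ z]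
      field_simp

lemma summable_nat_mul_pow_div_factorial (z : ℝ) :
    Summable fun l : ℕ => (l : ℝ) * z ^ (l - 1) / (l.factorial : ℝ) := by
  refine (summable_nat_add_iff 1).1 ((Real.summable_pow_div_factorial z).congr fun l => ?_)
  rw [Nat.add_sub_cancel, Nat.factorial_succ]
  push_cast
  field_simp

/-- The bound `∑_{m ≥ 1} b(m, s) x^{m-1} / (m-1)!` for `e^{iθ} - 1` in the space of order `s`. -/
def expConst (s x : ℝ) : ℝ := ∑' m : ℕ, b (m + 1) s / (m.factorial : ℝ) * x ^ m

lemma expConst_nonneg (s : ℝ) {x : ℝ} (hx : 0 ≤ x) : 0 ≤ expConst s x :=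
  tsum_nonneg fun m => by have := b_nonneg (m + 1) s; positivity

/-- The summands of `C̃₃ x²`. -/
def term3 (s x : ℝ) (p : ℕ × ℕ) : ℝ :=
  b (p.2 + p.1 + 1) s / (p.2.factorial : ℝ) * a p.1 * (x ^ p.2 * (Real.exp x - 1) ^ p.1)

/-- The summands of `C̃₄ x`. -/
def term4 (s x : ℝ) (p : ℕ × ℕ) : ℝ :=
  b (p.2 + p.1 + 1) s / (p.2.factorial : ℝ) * a p.1 *
    (p.2 * x ^ (p.2 - 1) * (Real.exp x - 1) ^ p.1 +
      x ^ p.2 * (p.1 * expConst s x * (Real.exp x - 1) ^ (p.1 - 1)))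

section

variable {s x : ℝ}

lemma exp_sub_one_nonneg (hx : 0 ≤ x) : 0 ≤ Real.exp x - 1 := by
  linarith [Real.add_one_le_exp x]

lemma term3_nonneg (hx : 0 ≤ x) (p : ℕ × ℕ) : 0 ≤ term3 s x p := by
  have h1 := b_nonneg (p.2 + p.1 + 1) s
  have h2 := a_nonneg p.1
  have h3 := exp_sub_one_nonneg hx
  unfold term3; positivity

lemma term4_nonneg (hx : 0 ≤ x) (p : ℕ × ℕ) : 0 ≤ term4 s x p := by
  have h1 := b_nonneg (p.2 + p.1 + 1) s
  have h2 := a_nonneg p.1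
  have h3 := exp_sub_one_nonneg hx
  have h4 := expConst_nonneg s hx
  unfold term4; positivity

/-- With `q = (π/2) y`, the choice `r = 2/(1+q)` gives `(π/2) r y = 2q/(1+q) < 1`: the strict
hypothesis leaves room for the growth of `b`. -/
lemma exists_ratio {y : ℝ} (hy : 0 ≤ y) (h : Real.pi / 2 * y < 1) :
    ∃ r : ℝ, 1 < r ∧ Real.pi / 2 * (r * y) < 1 := by
  have hpi := Real.pi_pos
  have hq : 0 ≤ Real.pi / 2 * y := by positivity
  generalize hqq : Real.pi / 2 * y = q at *
  refine ⟨2 / (1 + q), by rw [lt_div_iff₀ (by linarith)]; linarith, ?_⟩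
  have : Real.pi / 2 * (2 / (1 + q) * y) = 2 * q / (1 + q) := by rw [← hqq]; ring
  rw [this, div_lt_one (by linarith)]
  linarith

/-- Bounding `b` by `C r^(l+n+1)` decouples the indices, leaving an exponential series in `l` and a
series in `n` still below the threshold. -/
lemma summable_term3 (hx : 0 ≤ x) (h : Real.pi / 2 * (Real.exp x - 1) < 1) :
    Summable (term3 s x) := by
  have hy := exp_sub_one_nonneg hx
  obtain ⟨r, hr, hry⟩ := exists_ratio hy h
  obtain ⟨C, hC, hb⟩ := exists_b_le s hr
  have hr0 : 0 < r := by linarith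
  have s1 := summable_a_mul_pow (z := r * (Real.exp x - 1)) (by positivity) hry 0
  simp only [pow_zero, one_mul] at s1
  have s2 := Real.summable_pow_div_factorial (r * x)
  have s3 := (Summable.mul_of_nonneg s1 s2 (fun n => by have := a_nonneg n; positivity)
    (fun l => by positivity)).mul_left (C * r)
  refine Summable.of_nonneg_of_le (term3_nonneg hx) (fun p => ?_) s3
  have ha := a_nonneg p.1
  calc term3 s x p ≤ C * r ^ (p.2 + p.1 + 1) / (p.2.factorial : ℝ) * a p.1 *
        (x ^ p.2 * (Real.exp x - 1) ^ p.1) := by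
        unfold term3; gcongr; exact hb _
    _ = _ := by rw [pow_succ, pow_add, mul_pow, mul_pow]; ring

lemma summable_term4 (hx : 0 ≤ x) (h : Real.pi / 2 * (Real.exp x - 1) < 1) :
    Summable (term4 s x) := by
  have hy := exp_sub_one_nonneg hx
  have hB := expConst_nonneg s hx
  obtain ⟨r, hr, hry⟩ := exists_ratio hy h
  obtain ⟨C, hC, hb⟩ := exists_b_le s hr
  have hr0 : 0 < r := by linarith
  have s1 := summable_a_mul_pow (z := r * (Real.exp x - 1)) (by positivity) hry 0
  simp only [pow_zero, one_mul] at s1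
  have s1' := summable_nat_mul_a_mul_pow (z := r * (Real.exp x - 1)) (by positivity) hry
  have s2 := Real.summable_pow_div_factorial (r * x)
  have s2' := summable_nat_mul_pow_div_factorial (r * x)
  have s3 := (Summable.mul_of_nonneg s1 s2' (fun n => by have := a_nonneg n; positivity)
    (fun l => by positivity)).mul_left (C * r * r)
  have s4 := (Summable.mul_of_nonneg s1' s2 (fun n => by have := a_nonneg n; positivity)
    (fun l => by positivity)).mul_left (C * r * r * expConst s x)
  -- The exponent `l - 1` absorbs all but one power of `r`; for `l = 0` both sides vanish.
  have hl : ∀ (l : ℕ) (z : ℝ), r ^ l * (l * z ^ (l - 1)) = r * (l * (r * z) ^ (l - 1)) := by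
    intro l z
    rcases l with _ | l
    · simp
    · rw [Nat.add_sub_cancel, mul_pow, pow_succ]; ring
  refine Summable.of_nonneg_of_le (term4_nonneg hx) (fun p => ?_) (s3.add s4)
  have ha := a_nonneg p.1
  calc term4 s x p ≤ C * r ^ (p.2 + p.1 + 1) / (p.2.factorial : ℝ) * a p.1 *
      (p.2 * x ^ (p.2 - 1) * (Real.exp x - 1) ^ p.1 +
        x ^ p.2 * (p.1 * expConst s x * (Real.exp x - 1) ^ (p.1 - 1))) := by
        unfold term4; gcongr; exact hb _
    _ = C * r / (p.2.factorial : ℝ) * a p.1 *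
      (r ^ p.2 * (p.2 * x ^ (p.2 - 1)) * (r * (Real.exp x - 1)) ^ p.1 +
        (r * x) ^ p.2 * expConst s x * (r ^ p.1 * (p.1 * (Real.exp x - 1) ^ (p.1 - 1)))) := by
        rw [pow_succ, pow_add, mul_pow, mul_pow]; ring
    _ = _ := by rw [hl, hl]; ring

/-- Restriction of a double series to the orders `n + l ≥ 2`. -/
def ge2 (T : ℕ × ℕ → ℝ) (p : ℕ × ℕ) : ℝ := if 2 ≤ p.1 + p.2 then T p else 0

lemma ge2_nonneg {T : ℕ × ℕ → ℝ} (h : ∀ p, 0 ≤ T p) (p : ℕ × ℕ) : 0 ≤ ge2 T p := by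
  unfold ge2; split_ifs
  · exact h p
  · exact le_rfl

lemma summable_ge2 {T : ℕ × ℕ → ℝ} (h : ∀ p, 0 ≤ T p) (hs : Summable T) : Summable (ge2 T) := by
  refine Summable.of_nonneg_of_le (ge2_nonneg h) (fun p => ?_) hs
  unfold ge2; split_ifs
  · exact le_rfl
  · exact h p

/-- Multiplying by `x²` clears the quotients `(e^x - 1)/x`, and the restriction `n + l ≥ 2` makes `n
+ l - 2` a genuine subtraction. At `x = 0` all terms vanish, so no case distinction is needed later.
-/
lemma C3tilde_mul_sq (s x : ℝ) : C3tilde s x * x ^ 2 = ∑' p, ge2 (term3 s x) p := by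
  rw [C3tilde, ← tsum_mul_right]
  refine tsum_congr fun p => ?_
  unfold ge2
  split_ifs with h
  · obtain ⟨n, l⟩ := p
    simp only at h ⊢
    rcases eq_or_ne x 0 with rfl | hx
    · rcases n with _ | n
      · simp [term3, (by lia : l ≠ 0)]
      · simp [term3]
    · rw [term3]
      simp only
      have : x ^ (n + l - 2) * x ^ 2 = x ^ l * x ^ n := by
        rw [← pow_add, ← pow_add]; congr 1; lia
      rw [div_pow]
      field_simp
      linear_combination (b (l + n + 1) s * a n * (Real.exp x - 1) ^ n) * this
  · rw [zero_mul]

lemma C4tilde_mul (s x : ℝ) : C4tilde s x * x = ∑' p, ge2 (term4 s x) p := by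
  rw [C4tilde, ← tsum_mul_right]
  refine tsum_congr fun p => ?_
  unfold ge2
  split_ifs with h
  · obtain ⟨n, l⟩ := p
    simp only at h ⊢
    rw [term4, C5tilde, ← expConst]
    simp only
    rcases eq_or_ne x 0 with rfl | hx
    · rw [mul_zero, Real.exp_zero, sub_self]
      symm
      -- At `x = 0` the order restriction leaves a positive power of zero in every term: `l ≥ 2` for
      -- `n = 0`, `l ≥ 1` for `n = 1`, and a positive power of `e^0 - 1` for `n ≥ 2`.
      rcases n with _ | _ | n
      · have : (0 : ℝ) ^ (l - 1) = 0 := zero_pow (by lia)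
        simp [this]
      · simp [(by lia : l ≠ 0)]
      · simp
    · have e1 : (l : ℝ) * (x ^ (n + l - 2) * x * ((Real.exp x - 1) / x) ^ n) =
          l * x ^ (l - 1) * (Real.exp x - 1) ^ n := by
        rcases l with _ | l
        · simp
        · rw [← pow_succ, show n + (l + 1) - 2 + 1 = l + n by lia, pow_add, div_pow,
            Nat.add_sub_cancel]
          field_simp
      have e2 : (n : ℝ) * (x ^ (n + l - 2) * x * ((Real.exp x - 1) / x) ^ (n - 1)) =
          x ^ l * (n * (Real.exp x - 1) ^ (n - 1)) := by
        rcases n with _ | n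
        · simp
        · rw [← pow_succ, show n + 1 + l - 2 + 1 = l + n by lia, pow_add, div_pow,
            Nat.add_sub_cancel]
          field_simp
      linear_combination (b (l + n + 1) s / (l.factorial : ℝ) * a n) * e1 +
        (b (l + n + 1) s / (l.factorial : ℝ) * a n * expConst s x) * e2
  · rw [zero_mul]

lemma hasSum_exp_div_factorial (x : ℝ) : HasSum (fun n : ℕ => x ^ n / (n.factorial : ℝ)) (Real.exp x) := by
  have := NormedSpace.expSeries_div_hasSum_exp (𝔸 := ℝ) x
  rwa [← Real.exp_eq_exp_ℝ] at this

lemma hasSum_exp_tail_one (x : ℝ) :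
    HasSum (fun n : ℕ => x ^ (n + 1) / ((n + 1).factorial : ℝ)) (Real.exp x - 1) := by
  have := (hasSum_nat_add_iff' 1).2 (hasSum_exp_div_factorial x)
  simpa using this

lemma hasSum_exp_tail_two (x : ℝ) :
    HasSum (fun n : ℕ => x ^ (n + 2) / ((n + 2).factorial : ℝ)) (Real.exp x - 1 - x) := by
  have := (hasSum_nat_add_iff' 2).2 (hasSum_exp_div_factorial x)
  simpa [Finset.sum_range_succ, sub_sub] using this

lemma C3breve_one_mul_sq (x : ℝ) : C3breve 1 x * x ^ 2 = Real.exp x - 1 - x := by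
  rw [C3breve, ← tsum_mul_right, ← (hasSum_exp_tail_two x).tsum_eq]
  refine tsum_congr fun m => ?_
  rw [b_one_right, pow_add]; ring

lemma C1breve_mul_sq (x : ℝ) : C1breve x * x ^ 2 = Real.exp x - 1 - x := by
  rcases eq_or_ne x 0 with rfl | hx
  · simp
  · rw [C1breve]; field_simp

/-- For `s = 1` the factor `b` is `1` and the double series factors as `e^x ∑ a_n y^n` with `y = e^x
- 1`. Geometric series sum it, and subtracting the orders `0` and `1` gives the closed form. -/
lemma tsum_ge2_term3_one (hx : 0 ≤ x) (h : Real.pi / 2 * (Real.exp x - 1) < 1) :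
    ∑' p, ge2 (term3 1 x) p = C1tilde x * x ^ 2 := by
  have hpi := Real.pi_pos
  have hy := exp_sub_one_nonneg hx
  generalize hyy : Real.exp x - 1 = y at *
  have hE : Real.exp x = y + 1 := by linarith
  have hy1 : y < 1 := by nlinarith [Real.two_le_pi]
  have hz : ‖Real.pi / 2 * y‖ < 1 := by rwa [Real.norm_of_nonneg (by positivity)]
  have g1 : HasSum (fun n : ℕ => y ^ n) (1 - y)⁻¹ := hasSum_geometric_of_lt_one hy hy1
  have g2 := (hasSum_coe_mul_geometric_of_norm_lt_one hz).mul_left (Ctilde * (2 / Real.pi))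
  have g3 : HasSum (fun n : ℕ => a n * y ^ n)
      ((1 - y)⁻¹ + Ctilde * (2 / Real.pi) * (Real.pi / 2 * y / (1 - Real.pi / 2 * y) ^ 2)) := by
    refine (g1.add g2).congr_fun fun n => ?_
    rcases n with _ | n
    · simp [a]
    · rw [a, Nat.add_sub_cancel, mul_pow, pow_succ (Real.pi / 2)]
      field_simp
  have hfun : term3 1 x = fun p => a p.1 * y ^ p.1 * (x ^ p.2 / (p.2.factorial : ℝ)) := by
    ext p; rw [term3, b_one_right, hyy]; ring
  have e1 := hasSum_exp_div_factorial x
  have hs : Summable (term3 1 x) := summable_term3 hx (by rw [hyy]; exact h)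
  have hall : HasSum (term3 1 x) (((1 - y)⁻¹ + Ctilde * (2 / Real.pi) *
      (Real.pi / 2 * y / (1 - Real.pi / 2 * y) ^ 2)) * Real.exp x) := by
    rw [hfun] at hs ⊢
    exact HasSum.mul (f := fun n : ℕ => a n * y ^ n) (g := fun l : ℕ => x ^ l / (l.factorial : ℝ))
      g3 e1 hs
  have hfin : HasSum (fun p : ℕ × ℕ => if 2 ≤ p.1 + p.2 then 0 else term3 1 x p)
      (∑ p ∈ ({(0, 0), (0, 1), (1, 0)} : Finset (ℕ × ℕ)),
        if 2 ≤ p.1 + p.2 then 0 else term3 1 x p) := by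
    refine hasSum_sum_of_ne_finset_zero fun p hp => ?_
    rw [if_pos]
    by_contra! h
    apply hp
    obtain ⟨n, l⟩ := p
    simp only [Finset.mem_insert, Finset.mem_singleton, Prod.mk.injEq]
    simp only at h
    lia
  have h2 := hall.sub hfin
  have h3 : (fun p : ℕ × ℕ => term3 1 x p - if 2 ≤ p.1 + p.2 then 0 else term3 1 x p) =
      ge2 (term3 1 x) := by
    ext p; unfold ge2; split_ifs <;> simp
  rw [h3] at h2
  rw [h2.tsum_eq]
  have hden1 : 1 - y ≠ 0 := by linarith
  have hden2 : 1 - Real.pi / 2 * y ≠ 0 := by linarith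
  have hden3 : 2 - Real.exp x ≠ 0 := by rw [hE]; linarith
  -- The omitted orders, with `a 0 = 1` and `a 1 = 1 + Ctilde`.
  have hsum : (∑ p ∈ ({(0, 0), (0, 1), (1, 0)} : Finset (ℕ × ℕ)),
        if 2 ≤ p.1 + p.2 then 0 else term3 1 x p) = 1 + x + (1 + Ctilde) * y := by
    rw [hfun]
    simp [a]
    ring
  rw [hsum]
  rcases eq_or_ne x 0 with rfl | hx0
  · have : y = 0 := by rw [← hyy]; simp
    subst this
    simp
  · rw [C1tilde, hyy]
    have e : (2 : ℝ) - Real.exp x = 1 - y := by rw [hE]; ring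
    have hu : (1 - y) * (1 - y)⁻¹ = 1 := mul_inv_cancel₀ hden1
    have hd : (1 - Real.pi / 2 * y) ^ 2 * ((1 - Real.pi / 2 * y) ^ 2)⁻¹ = 1 :=
      mul_inv_cancel₀ (pow_ne_zero 2 hden2)
    have hi : (x ^ 2)⁻¹ * x ^ 2 = 1 := inv_mul_cancel₀ (pow_ne_zero 2 hx0)
    have hp : Ctilde * (2 / Real.pi) * (Real.pi / 2 * y / (1 - Real.pi / 2 * y) ^ 2) =
        Ctilde * y * ((1 - Real.pi / 2 * y) ^ 2)⁻¹ := by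
      rw [div_eq_mul_inv _ ((1 - Real.pi / 2 * y) ^ 2)]
      field_simp
    rw [hp, e, hE]
    simp only [div_eq_mul_inv _ (x ^ 2), div_eq_mul_inv _ ((1 - Real.pi / 2 * y) ^ 2),
      div_eq_mul_inv _ (x ^ 2 * (1 - y)), mul_inv (x ^ 2)]
    generalize (1 - y)⁻¹ = u at *
    generalize ((1 - Real.pi / 2 * y) ^ 2)⁻¹ = d at *
    generalize (x ^ 2)⁻¹ = i at *
    linear_combination ((y + 1) ^ 2) * hu + (Ctilde * y * (y + 1)) * hd -
      (Real.pi * Ctilde / 2 * ((y + 1) * y ^ 2) * ((2 - Real.pi / 2 * y) * d) + (y - x) +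
        (1 + Ctilde) * y ^ 2 + (y + 1) * y ^ 2 * u) * hi

/-- Because `b(n,1) = 1`, the unweighted constant is the case `s = 1` of `C3`. This allows one
treatment of both norms. -/
lemma C1_mul_sq (hx : 0 ≤ x) (h : Real.pi / 2 * (Real.exp x - 1) < 1) :
    C1 x * x ^ 2 = C3 1 x * x ^ 2 := by
  rw [C1, C3, add_mul, add_mul, ← tsum_ge2_term3_one hx h, C3tilde_mul_sq, mul_assoc, mul_assoc,
    C1breve_mul_sq, C3breve_one_mul_sq]

/-- Termwise, from `b(n,1) = 1 ≤ b(n,s)` for `n ≥ 1`. -/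
lemma C3_mono (hx : 0 ≤ x) (h : Real.pi / 2 * (Real.exp x - 1) < 1) :
    C3 1 x * x ^ 2 ≤ C3 s x * x ^ 2 := by
  have hCR := CR_nonneg
  rw [C3, C3, add_mul, add_mul, C3tilde_mul_sq, C3tilde_mul_sq]
  have hb : ∀ n, 1 ≤ n → b n 1 ≤ b n s := fun n hn => by rw [b_one_right]; exact one_le_b hn s
  have hy := exp_sub_one_nonneg hx
  refine add_le_add ?_ ?_
  · refine Summable.tsum_le_tsum (fun p => ?_)
      (summable_ge2 (term3_nonneg hx) (summable_term3 hx h))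
      (summable_ge2 (term3_nonneg hx) (summable_term3 hx h))
    unfold ge2
    split_ifs
    · have := a_nonneg p.1
      unfold term3
      gcongr
      exact hb _ (by lia)
    · exact le_rfl
  · gcongr
    refine Summable.tsum_le_tsum (fun m => ?_) (summable_b_div_factorial 1 x hx 3 2)
      (summable_b_div_factorial s x hx 3 2)
    gcongr
    exact hb _ (by lia)

end

/-! ### Operator bounds in weighted norms -/

lemma ENNReal_tsum_le_ofReal {ι : Type} {f : ι → ℝ≥0∞} {g : ι → ℝ} {S : ℝ} (h0 : ∀ i, 0 ≤ g i)
    (hg : HasSum g S) (h : ∀ i, f i ≤ ENNReal.ofReal (g i)) : ∑' i, f i ≤ ENNReal.ofReal S := by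
  rw [← hg.tsum_eq, ENNReal.ofReal_tsum_of_nonneg h0 hg.summable]
  exact ENNReal.tsum_le_tsum h

lemma ENNReal_tsum_le_ofReal_mul {ι : Type} {f : ι → ℝ≥0∞} {g : ι → ℝ} {S : ℝ} {X : ℝ≥0∞}
    (h0 : ∀ i, 0 ≤ g i) (hg : HasSum g S) (h : ∀ i, f i ≤ ENNReal.ofReal (g i) * X) :
    ∑' i, f i ≤ ENNReal.ofReal S * X := by
  refine (ENNReal.tsum_le_tsum h).trans ?_
  rw [ENNReal.tsum_mul_right]
  gcongr
  exact ENNReal_tsum_le_ofReal h0 hg fun _ => le_rfl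

lemma ENNReal_tsum_le_add {ι : Type} {f : ι → ℝ≥0∞} {g g' : ι → ℝ} {S S' : ℝ} {X X' : ℝ≥0∞}
    (h0 : ∀ i, 0 ≤ g i) (hg : HasSum g S) (h0' : ∀ i, 0 ≤ g' i) (hg' : HasSum g' S')
    (h : ∀ i, f i ≤ ENNReal.ofReal (g i) * X + ENNReal.ofReal (g' i) * X') :
    ∑' i, f i ≤ ENNReal.ofReal S * X + ENNReal.ofReal S' * X' := by
  refine (ENNReal.tsum_le_tsum h).trans ?_
  rw [ENNReal.tsum_add]
  exact add_le_add (ENNReal_tsum_le_ofReal_mul h0 hg fun _ => le_rfl)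
    (ENNReal_tsum_le_ofReal_mul h0' hg' fun _ => le_rfl)

namespace IsWeight

variable {w φ : ℤ → ℝ≥0∞} {Θ : ℝ → ℂ} {s x t : ℝ}

/-- Submultiplicativity bounds each power of `Θ` by the power of its norm, so the exponential tail
at `x` is a majorant. -/
lemma wn_expRem_one_le (hw : IsWeight w φ) (hΘ : Wiener Θ) (hx : 0 ≤ x)
    (hΘx : wn w Θ ≤ ENNReal.ofReal x) :
    wn w (expRem 1 Θ) ≤ ENNReal.ofReal (Real.exp x - 1) := by
  refine (wn_expRem_le w hΘ 1).trans (ENNReal_tsum_le_ofReal (fun m => by positivity)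
    (hasSum_exp_tail_one x) fun m => ?_)
  have h := hw.tsum_w_pow_le (fun k => ‖fc Θ k‖ₑ) (m + 1)
  calc _ ≤ ENNReal.ofReal (1 / ((m + 1).factorial : ℝ)) * ENNReal.ofReal x ^ (m + 1) := by
        gcongr
        exact h.trans (pow_le_pow_left' hΘx _)
    _ = _ := by
        rw [← ENNReal.ofReal_pow hx, ← ENNReal.ofReal_mul (by positivity)]
        congr 1; ring

/-- In the power `m + 1` the `s`-weight can fall on any of `m + 1` factors; `(m+1)/(m+1)! = 1/m!`
yields `expConst`. -/
lemma wn_wpow_expRem_one_le (hw : IsWeight w φ) (hs : 0 < s) (hΘ : Wiener Θ) (hx : 0 ≤ x)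
    (ht : 0 ≤ t) (hΘx : wn w Θ ≤ ENNReal.ofReal x) (hΘt : wn (wpow w φ s) Θ ≤ ENNReal.ofReal t) :
    wn (wpow w φ s) (expRem 1 Θ) ≤ ENNReal.ofReal (expConst s x * t) := by
  refine (wn_expRem_le _ hΘ 1).trans (ENNReal_tsum_le_ofReal (fun m => ?_)
    ((summable_b_div_factorial s x hx 1 0).hasSum.mul_right t) fun m => ?_)
  · have := b_nonneg (m + 1) s
    positivity
  have hb := b_nonneg (m + 1) s
  have h := hw.tsum_wpow_pow_le (fun k => ‖fc Θ k‖ₑ) (m + 1) hs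
  calc _ ≤ ENNReal.ofReal (1 / ((m + 1).factorial : ℝ)) * (ENNReal.ofReal (b (m + 1) s) *
        (ENNReal.ofReal ((m + 1 : ℕ) : ℝ) * ENNReal.ofReal t * ENNReal.ofReal x ^ m)) := by
        gcongr
        refine h.trans ?_
        rw [ENNReal.ofReal_natCast, Nat.add_sub_cancel]
        gcongr
        · exact hΘt
        · exact hΘx
    _ = _ := by
        rw [← ENNReal.ofReal_pow hx, ← ENNReal.ofReal_mul (by positivity),
          ← ENNReal.ofReal_mul (by positivity), ← ENNReal.ofReal_mul (by positivity),
          ← ENNReal.ofReal_mul (by positivity)]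
        congr 1
        rw [Nat.factorial_succ, add_zero]
        have : (m.factorial : ℝ) ≠ 0 := by positivity
        push_cast
        field_simp

lemma convNorm_expRem_two_le (hw : IsWeight w φ) (hΘ : Wiener Θ) (hx : 0 ≤ x)
    (hΘx : wn w Θ ≤ ENNReal.ofReal x) (F : ℝ → ℂ) :
    convNorm w F (expRem 2 Θ) ≤ ENNReal.ofReal (Real.exp x - 1 - x) * wn w F := by
  refine (convNorm_expRem_le w hΘ 2 F).trans (ENNReal_tsum_le_ofReal_mul (fun m => by positivity)
    (hasSum_exp_tail_two x) fun m => ?_)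
  have h := hw.tsum_w_pow_mul_le (fun k => ‖fc Θ k‖ₑ) (fun k => ‖fc F k‖ₑ) (m + 2)
  calc _ ≤ ENNReal.ofReal (1 / ((m + 2).factorial : ℝ)) *
          (ENNReal.ofReal x ^ (m + 2) * wn w F) := by
        gcongr
        refine h.trans ?_
        gcongr
        · exact hΘx
        · exact le_rfl
    _ = _ := by
        rw [← ENNReal.ofReal_pow hx, ← mul_assoc, ← ENNReal.ofReal_mul (by positivity)]
        congr 2; ring

/-- With `m + 2` factors of `Θ` and one of `F`, weighting `F` gives `C3breve`. Weighting one `Θ`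
gives the multiplicity `m + 2`, hence `C4breve`. -/
lemma convNorm_wpow_expRem_two_le (hw : IsWeight w φ) (hs : 0 < s) (hΘ : Wiener Θ) (hx : 0 ≤ x)
    (ht : 0 ≤ t) (hΘx : wn w Θ ≤ ENNReal.ofReal x) (hΘt : wn (wpow w φ s) Θ ≤ ENNReal.ofReal t)
    (F : ℝ → ℂ) :
    convNorm (wpow w φ s) F (expRem 2 Θ) ≤
      ENNReal.ofReal (C3breve s x * x ^ 2) * wn (wpow w φ s) F +
        ENNReal.ofReal (C4breve s x * (x * t)) * wn w F := by
  refine (convNorm_expRem_le _ hΘ 2 F).trans (ENNReal_tsum_le_add (fun m => ?_)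
    ((summable_b_div_factorial s x hx 3 2).hasSum.mul_right (x ^ 2)) (fun m => ?_)
    ((summable_b_div_factorial s x hx 3 1).hasSum.mul_right (x * t)) fun m => ?_)
  · have := b_nonneg (m + 3) s
    positivity
  · have := b_nonneg (m + 3) s
    positivity
  have hb := b_nonneg (m + 3) s
  have h := hw.tsum_wpow_pow_mul_le (fun k => ‖fc Θ k‖ₑ) (fun k => ‖fc F k‖ₑ) (m + 2) hs
  calc _ ≤ ENNReal.ofReal (1 / ((m + 2).factorial : ℝ)) * (ENNReal.ofReal (b (m + 3) s) *
        (ENNReal.ofReal x ^ (m + 2) * wn (wpow w φ s) F +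
          (ENNReal.ofReal ((m + 2 : ℕ) : ℝ) * ENNReal.ofReal t * ENNReal.ofReal x ^ (m + 1)) *
            wn w F)) := by
        gcongr
        refine h.trans ?_
        rw [ENNReal.ofReal_natCast, show m + 2 - 1 = m + 1 by lia]
        gcongr
        · exact hΘx
        · exact le_rfl
        · exact hΘt
        · exact hΘx
        · exact le_rfl
    _ = ENNReal.ofReal (1 / ((m + 2).factorial : ℝ) * b (m + 3) s * x ^ (m + 2)) *
          wn (wpow w φ s) F + ENNReal.ofReal (1 / ((m + 2).factorial : ℝ) * b (m + 3) s *
            (((m + 2 : ℕ) : ℝ) * t * x ^ (m + 1))) * wn w F := by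
        rw [← ENNReal.ofReal_pow hx, ← ENNReal.ofReal_pow hx, ENNReal.ofReal_mul (by positivity),
          ENNReal.ofReal_mul (by positivity), ENNReal.ofReal_mul (q := _ * t * _) (by positivity),
          ENNReal.ofReal_mul (p := 1 / _) (by positivity),
          ENNReal.ofReal_mul (p := _ * t) (by positivity), ENNReal.ofReal_mul (q := t) (by positivity)]
        ring
    _ = _ := by
        have h2 : (((m + 1 : ℕ).factorial : ℕ) : ℝ) ≠ 0 := by positivity
        congr 3
        · rw [pow_add]; ring
        · rw [Nat.factorial_succ (m + 1), pow_succ]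
          push_cast
          field_simp
          ring

end IsWeight

/-! ### The nonlinear operator `𝒮` -/

section OpS

variable {w φ : ℤ → ℝ≥0∞} {f θ : ℝ → ℝ} {s x t : ℝ}

/-- The scalar in front of the term of order `(n, l)` in the expansion of `𝒮`. -/
def expansionCoeff (p : ℕ × ℕ) : ℂ :=
  if 2 ≤ p.1 + p.2 then (-1) ^ p.1 * (Complex.I ^ p.2 / (p.2.factorial : ℂ)) else 0

lemma enorm_expansionCoeff (p : ℕ × ℕ) :
    ‖expansionCoeff p‖ₑ = ENNReal.ofReal (if 2 ≤ p.1 + p.2 then 1 / (p.2.factorial : ℝ) else 0) := by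
  unfold expansionCoeff
  rw [← ofReal_norm]
  split_ifs
  · rw [norm_mul, norm_I_pow_div]; simp
  · simp

/-- The double series in `𝒮`. -/
def expansionSum (θ f : ℝ → ℝ) (α : ℝ) : ℂ :=
  ∑' p : ℕ × ℕ, if 2 ≤ p.1 + p.2 then expansionTerm θ f α p else 0

lemma hasExp_expansion (hf : Wiener fun x => (f x : ℂ)) (hθ : Wiener fun x => (θ x : ℂ))
    (p : ℕ × ℕ) :
    HasExp (fun q : (Fin p.2 → ℤ) × ℤ × (Fin p.1 → ℤ) => expansionCoeff p *
        ((∏ i, fc (fun x => (θ x : ℂ)) (q.1 i)) * (fc (fun x => (f x : ℂ)) q.2.1 *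
          (∏ i, fc (expRem 1 fun x => (θ x : ℂ)) (q.2.2 i)) * mult q.2.1 q.2.2)))
      (fun q => ∑ i, q.1 i + (q.2.1 + ∑ i, q.2.2 i))
      (fun α => if 2 ≤ p.1 + p.2 then expansionTerm θ f α p else 0) := by
  refine (((hθ.hasExp.pow p.2).mul (hasExp_opT hf (wiener_expRem hθ 1) p.1)).const_mul
    (expansionCoeff p)).congr fun α => ?_
  unfold expansionCoeff expansionTerm
  split_ifs <;> ring

lemma tsum_expansion_le (W : ℤ → ℝ≥0∞) (F U Θ : ℝ → ℂ) (p : ℕ × ℕ) {X : ℝ≥0∞}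
    (hX : ∑' q : (Fin p.2 → ℤ) × ℤ × (Fin p.1 → ℤ), W (∑ i, q.1 i + (q.2.1 + ∑ i, q.2.2 i)) *
      ((∏ i, ‖fc Θ (q.1 i)‖ₑ) * (‖fc F q.2.1‖ₑ * ∏ i, ‖fc U (q.2.2 i)‖ₑ)) ≤ X) :
    ∑' q : (Fin p.2 → ℤ) × ℤ × (Fin p.1 → ℤ), W (∑ i, q.1 i + (q.2.1 + ∑ i, q.2.2 i)) *
      ‖expansionCoeff p * ((∏ i, fc Θ (q.1 i)) * (fc F q.2.1 *
          (∏ i, fc U (q.2.2 i)) * mult q.2.1 q.2.2))‖ₑ ≤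
      ENNReal.ofReal ((if 2 ≤ p.1 + p.2 then 1 / (p.2.factorial : ℝ) else 0) *
        (Real.pi * a p.1)) * X := by
  have h1 := (tsum_pow_mul_opT_le W F U Θ p.2 p.1).trans (mul_le_mul_right hX _)
  rw [ENNReal.ofReal_mul (by split_ifs <;> positivity), mul_assoc, ← enorm_expansionCoeff]
  refine le_trans (le_of_eq ?_) (mul_le_mul_right h1 _)
  rw [← ENNReal.tsum_mul_left]
  refine tsum_congr fun q => ?_
  rw [enorm_mul (expansionCoeff p)]
  ring

lemma block_w_le {F U Θ : ℝ → ℂ} (hw : IsWeight w φ) (hx : 0 ≤ x) {y : ℝ} (hy : 0 ≤ y)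
    (hΘ : wn w Θ ≤ ENNReal.ofReal x) (hU : wn w U ≤ ENNReal.ofReal y) (l n : ℕ) :
    ∑' q : (Fin l → ℤ) × ℤ × (Fin n → ℤ), w (∑ i, q.1 i + (q.2.1 + ∑ i, q.2.2 i)) *
      ((∏ i, ‖fc Θ (q.1 i)‖ₑ) * (‖fc F q.2.1‖ₑ * ∏ i, ‖fc U (q.2.2 i)‖ₑ)) ≤
      ENNReal.ofReal (x ^ l * y ^ n) * wn w F := by
  have h := hw.tsum_w_block_le (fun k => ‖fc Θ k‖ₑ) (fun k => ‖fc F k‖ₑ) (fun k => ‖fc U k‖ₑ) l n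
  simp only [tsum_w_fc] at h
  refine h.trans ?_
  rw [ENNReal.ofReal_mul (by positivity), ENNReal.ofReal_pow hx, ENNReal.ofReal_pow hy, mul_assoc,
    mul_comm (ENNReal.ofReal y ^ n)]
  gcongr

lemma block_wpow_le {F U Θ : ℝ → ℂ} (hw : IsWeight w φ) (hs : 0 < s) (hx : 0 ≤ x) (ht : 0 ≤ t)
    {y u : ℝ} (hy : 0 ≤ y) (hu : 0 ≤ u)
    (hΘ : wn w Θ ≤ ENNReal.ofReal x) (hΘt : wn (wpow w φ s) Θ ≤ ENNReal.ofReal t)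
    (hU : wn w U ≤ ENNReal.ofReal y) (hUt : wn (wpow w φ s) U ≤ ENNReal.ofReal u) (l n : ℕ) :
    ∑' q : (Fin l → ℤ) × ℤ × (Fin n → ℤ), wpow w φ s (∑ i, q.1 i + (q.2.1 + ∑ i, q.2.2 i)) *
      ((∏ i, ‖fc Θ (q.1 i)‖ₑ) * (‖fc F q.2.1‖ₑ * ∏ i, ‖fc U (q.2.2 i)‖ₑ)) ≤
      ENNReal.ofReal (b (l + n + 1) s * (x ^ l * y ^ n)) * wn (wpow w φ s) F +
      ENNReal.ofReal (b (l + n + 1) s *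
        (l * t * x ^ (l - 1) * y ^ n + x ^ l * (n * u * y ^ (n - 1)))) * wn w F := by
  have h := hw.tsum_wpow_block_le (fun k => ‖fc Θ k‖ₑ) (fun k => ‖fc F k‖ₑ) (fun k => ‖fc U k‖ₑ)
    l n hs
  simp only [tsum_w_fc] at h
  have hb := b_nonneg (l + n + 1) s
  refine h.trans ?_
  calc _ ≤ ENNReal.ofReal (b (l + n + 1) s) *
        (ENNReal.ofReal x ^ l * (wn (wpow w φ s) F * ENNReal.ofReal y ^ n)
        + (l * ENNReal.ofReal t * ENNReal.ofReal x ^ (l - 1)) * (wn w F * ENNReal.ofReal y ^ n)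
        + ENNReal.ofReal x ^ l * (wn w F * (n * ENNReal.ofReal u * ENNReal.ofReal y ^ (n - 1)))) := by
        gcongr
    _ = _ := by
        rw [ENNReal.ofReal_mul hb, ENNReal.ofReal_mul hb,
          ENNReal.ofReal_add (by positivity) (by positivity),
          ENNReal.ofReal_mul (by positivity), ENNReal.ofReal_mul (by positivity),
          ENNReal.ofReal_mul (by positivity), ENNReal.ofReal_mul (by positivity),
          ENNReal.ofReal_mul (by positivity), ENNReal.ofReal_mul (by positivity),
          ENNReal.ofReal_mul (by positivity), ENNReal.ofReal_pow hx, ENNReal.ofReal_pow hx,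
          ENNReal.ofReal_pow hy, ENNReal.ofReal_pow hy, ENNReal.ofReal_natCast,
          ENNReal.ofReal_natCast]
        ring

/-- The last term of `𝒮` is a bilinear operator, so its multiplier bound divided by `π` is `a 1 =
CR`. -/
lemma wn_opS_le_aux (hf : Wiener fun x => (f x : ℂ)) (hθ : Wiener fun x => (θ x : ℂ))
    (hS : Wiener (expansionSum θ f)) (W : ℤ → ℝ≥0∞) :
    Wiener (opS θ f) ∧ wn W (opS θ f) ≤ ENNReal.ofReal (1 / Real.pi) * wn W (expansionSum θ f) +
      ENNReal.ofReal CR * convNorm W (fun x => (f x : ℂ)) (expRem 2 fun x => (θ x : ℂ)) := by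
  have hpi := Real.pi_pos
  have hT := (hasExp_opT hf (wiener_expRem hθ 2) 1).wiener
  have h : opS θ f = fun α => Complex.I / (Real.pi : ℂ) * (expansionSum θ f α -
      opT 1 (fun x => (f x : ℂ)) (expRem 2 fun x => (θ x : ℂ)) α) :=
    funext fun α => opS_eq hf hθ α
  refine ⟨by rw [h]; exact (hS.sub hT).const_mul _, ?_⟩
  have hc : ‖(Complex.I / (Real.pi : ℂ) : ℂ)‖ₑ = ENNReal.ofReal (1 / Real.pi) := by
    rw [← ofReal_norm]
    simp [abs_of_pos hpi]
  rw [h, wn_const_mul, hc]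
  refine (mul_le_mul_right (wn_sub_le W hS.continuous hT.continuous) _).trans ?_
  rw [mul_add]
  refine add_le_add le_rfl ?_
  refine (mul_le_mul_right (wn_opT_one_le W hf (wiener_expRem hθ 2)) _).trans (le_of_eq ?_)
  rw [← mul_assoc, ← ENNReal.ofReal_mul (by positivity), a_one]
  congr 2
  field_simp

/-- Finiteness for `w` and `w ≥ 1` give absolute convergence of all coefficients. The expansion is
then valid for every weight, and the last clause can be reused in order `s`. -/
lemma wn_expansionSum_le (hw : IsWeight w φ) (hf : Wiener fun x => (f x : ℂ))
    (hθ : Wiener fun x => (θ x : ℂ)) (hx : 0 ≤ x) (hsmall : Real.pi / 2 * (Real.exp x - 1) < 1)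
    (hθx : wn w (fun x => (θ x : ℂ)) ≤ ENNReal.ofReal x) (hfw : wn w (fun x => (f x : ℂ)) ≠ ∞) :
    Wiener (expansionSum θ f) ∧
      wn w (expansionSum θ f) ≤
        ENNReal.ofReal (Real.pi * ∑' p, ge2 (term3 1 x) p) * wn w (fun x => (f x : ℂ)) ∧
      ∀ W, wn W (expansionSum θ f) ≤ ∑' p : ℕ × ℕ, ∑' q : (Fin p.2 → ℤ) × ℤ × (Fin p.1 → ℤ),
      W (∑ i, q.1 i + (q.2.1 + ∑ i, q.2.2 i)) *
      ‖expansionCoeff p * ((∏ i, fc (fun x => (θ x : ℂ)) (q.1 i)) * (fc (fun x => (f x : ℂ)) q.2.1 *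
          (∏ i, fc (expRem 1 fun x => (θ x : ℂ)) (q.2.2 i)) * mult q.2.1 q.2.2))‖ₑ := by
  have hpi := Real.pi_pos
  have hy := exp_sub_one_nonneg hx
  have hU := hw.wn_expRem_one_le hθ hx hθx
  have hsum := (summable_ge2 (term3_nonneg (s := 1) hx) (summable_term3 hx hsmall)).hasSum
  have h3 := ge2_nonneg (term3_nonneg (s := 1) hx)
  have key : ∑' p : ℕ × ℕ, ∑' q : (Fin p.2 → ℤ) × ℤ × (Fin p.1 → ℤ),
      w (∑ i, q.1 i + (q.2.1 + ∑ i, q.2.2 i)) *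
      ‖expansionCoeff p * ((∏ i, fc (fun x => (θ x : ℂ)) (q.1 i)) * (fc (fun x => (f x : ℂ)) q.2.1 *
          (∏ i, fc (expRem 1 fun x => (θ x : ℂ)) (q.2.2 i)) * mult q.2.1 q.2.2))‖ₑ ≤
      ENNReal.ofReal (Real.pi * ∑' p, ge2 (term3 1 x) p) * wn w (fun x => (f x : ℂ)) := by
    refine ENNReal_tsum_le_ofReal_mul (fun p => mul_nonneg hpi.le (h3 p)) (hsum.mul_left Real.pi)
      fun p => (tsum_expansion_le w _ _ _ p (block_w_le hw hx hy hθx hU p.2 p.1)).trans (le_of_eq ?_)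
    rw [← mul_assoc, ← ENNReal.ofReal_mul
      (by have := a_nonneg p.1; split_ifs <;> positivity)]
    congr 2
    unfold ge2
    split_ifs
    · rw [term3, b_one_right]; ring
    · ring
  have hfin := ne_top_of_le_ne_top (ENNReal.mul_ne_top ENNReal.ofReal_ne_top hfw) key
  have hfin' : ∑' p : ℕ × ℕ, ∑' q : (Fin p.2 → ℤ) × ℤ × (Fin p.1 → ℤ),
      ‖expansionCoeff p * ((∏ i, fc (fun x => (θ x : ℂ)) (q.1 i)) * (fc (fun x => (f x : ℂ)) q.2.1 *
          (∏ i, fc (expRem 1 fun x => (θ x : ℂ)) (q.2.2 i)) * mult q.2.1 q.2.2))‖ₑ ≠ ∞ :=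
    ne_top_of_le_ne_top hfin (ENNReal.tsum_le_tsum fun p => ENNReal.tsum_le_tsum fun q =>
      le_mul_of_one_le_left' (hw.one_le_w _))
  obtain ⟨hS, hSW⟩ := HasExp.tsum_bound (hasExp_expansion hf hθ) hfin'
    (S := expansionSum θ f) fun α => rfl
  exact ⟨hS, (hSW w).trans key, hSW⟩

/-- Bounds for the operator `𝒮` in `F^{0,1}`. -/
lemma wn_opS_le (hw : IsWeight w φ) (hf : Wiener fun x => (f x : ℂ))
    (hθ : Wiener fun x => (θ x : ℂ)) (hx : 0 ≤ x) (hsmall : Real.pi / 2 * (Real.exp x - 1) < 1)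
    (hθx : wn w (fun x => (θ x : ℂ)) ≤ ENNReal.ofReal x) (hfw : wn w (fun x => (f x : ℂ)) ≠ ∞) :
    Wiener (opS θ f) ∧
      wn w (opS θ f) ≤ ENNReal.ofReal (C3 1 x * x ^ 2) * wn w fun x => (f x : ℂ) := by
  have hpi := Real.pi_pos
  have hCR := CR_nonneg
  have h3 := ge2_nonneg (term3_nonneg (s := 1) hx)
  obtain ⟨hS, key, -⟩ := wn_expansionSum_le hw hf hθ hx hsmall hθx hfw
  obtain ⟨h1, h2⟩ := wn_opS_le_aux hf hθ hS w
  refine ⟨h1, h2.trans ?_⟩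
  refine (add_le_add (mul_le_mul_right key _)
    (mul_le_mul_right (hw.convNorm_expRem_two_le hθ hx hθx _) _)).trans (le_of_eq ?_)
  have e : C3 1 x * x ^ 2 = (∑' p, ge2 (term3 1 x) p) + CR * (Real.exp x - 1 - x) := by
    rw [← C3breve_one_mul_sq, ← C3tilde_mul_sq, C3]; ring
  rw [← mul_assoc, ← mul_assoc, ← add_mul, ← ENNReal.ofReal_mul (by positivity),
    ← ENNReal.ofReal_mul hCR, e, ENNReal.ofReal_add (tsum_nonneg h3)
      (mul_nonneg hCR (by linarith [Real.add_one_le_exp x]))]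
  congr 3
  field_simp

lemma C3breve_nonneg (s : ℝ) (hx : 0 ≤ x) : 0 ≤ C3breve s x :=
  tsum_nonneg fun m => by have := b_nonneg (m + 3) s; positivity

lemma C4breve_nonneg (s : ℝ) (hx : 0 ≤ x) : 0 ≤ C4breve s x :=
  tsum_nonneg fun m => by have := b_nonneg (m + 3) s; positivity

/-- Bounds for the operator `𝒮` in the space of order `s`. -/
lemma wn_wpow_opS_le (hw : IsWeight w φ) (hs : 0 < s) (hf : Wiener fun x => (f x : ℂ))
    (hθ : Wiener fun x => (θ x : ℂ)) (hx : 0 ≤ x) (ht : 0 ≤ t)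
    (hsmall : Real.pi / 2 * (Real.exp x - 1) < 1)
    (hθx : wn w (fun x => (θ x : ℂ)) ≤ ENNReal.ofReal x)
    (hθt : wn (wpow w φ s) (fun x => (θ x : ℂ)) ≤ ENNReal.ofReal t)
    (hfw : wn w (fun x => (f x : ℂ)) ≠ ∞) :
    wn (wpow w φ s) (opS θ f) ≤
      ENNReal.ofReal (C3 s x * x ^ 2) * wn (wpow w φ s) (fun x => (f x : ℂ)) +
      ENNReal.ofReal (C4 s x * x * t) * wn w (fun x => (f x : ℂ)) := by
  have hpi := Real.pi_pos
  have hy := exp_sub_one_nonneg hx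
  have hCR := CR_nonneg
  have hE := expConst_nonneg s hx
  have hU := hw.wn_expRem_one_le hθ hx hθx
  have hUs := hw.wn_wpow_expRem_one_le hs hθ hx ht hθx hθt
  have hsum3 := (summable_ge2 (term3_nonneg (s := s) hx) (summable_term3 hx hsmall)).hasSum
  have h3 := ge2_nonneg (term3_nonneg (s := s) hx)
  have hsum4 := (summable_ge2 (term4_nonneg (s := s) hx) (summable_term4 hx hsmall)).hasSum
  have h4 := ge2_nonneg (term4_nonneg (s := s) hx)
  have key : ∑' p : ℕ × ℕ, ∑' q : (Fin p.2 → ℤ) × ℤ × (Fin p.1 → ℤ),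
      wpow w φ s (∑ i, q.1 i + (q.2.1 + ∑ i, q.2.2 i)) *
      ‖expansionCoeff p * ((∏ i, fc (fun x => (θ x : ℂ)) (q.1 i)) * (fc (fun x => (f x : ℂ)) q.2.1 *
          (∏ i, fc (expRem 1 fun x => (θ x : ℂ)) (q.2.2 i)) * mult q.2.1 q.2.2))‖ₑ ≤
      ENNReal.ofReal (Real.pi * ∑' p, ge2 (term3 s x) p) * wn (wpow w φ s) (fun x => (f x : ℂ)) +
      ENNReal.ofReal ((Real.pi * ∑' p, ge2 (term4 s x) p) * t) * wn w (fun x => (f x : ℂ)) := by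
    refine ENNReal_tsum_le_add (fun p => mul_nonneg hpi.le (h3 p)) (hsum3.mul_left Real.pi)
      (fun p => mul_nonneg (mul_nonneg hpi.le (h4 p)) ht) ((hsum4.mul_left Real.pi).mul_right t)
      fun p => (tsum_expansion_le (wpow w φ s) _ _ _ p (block_wpow_le hw hs hx ht hy
        (mul_nonneg hE ht) hθx hθt hU hUs p.2 p.1)).trans (le_of_eq ?_)
    have h0 : 0 ≤ (if 2 ≤ p.1 + p.2 then 1 / (p.2.factorial : ℝ) else 0) * (Real.pi * a p.1) := by
      have := a_nonneg p.1; split_ifs <;> positivity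
    rw [mul_add, ← mul_assoc (ENNReal.ofReal _), ← mul_assoc (ENNReal.ofReal _),
      ← ENNReal.ofReal_mul h0, ← ENNReal.ofReal_mul h0]
    congr 3
    · unfold ge2
      split_ifs
      · rw [term3]; ring
      · ring
    · unfold ge2
      split_ifs
      · rw [term4]; ring
      · ring
  obtain ⟨hS, -, hSW⟩ := wn_expansionSum_le hw hf hθ hx hsmall hθx hfw
  obtain ⟨-, h2⟩ := wn_opS_le_aux hf hθ hS (wpow w φ s)
  refine h2.trans ?_
  refine (add_le_add (mul_le_mul_right ((hSW (wpow w φ s)).trans key) _)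
    (mul_le_mul_right (hw.convNorm_wpow_expRem_two_le hs hθ hx ht hθx hθt _) _)).trans (le_of_eq ?_)
  have e3 : C3 s x * x ^ 2 = 1 / Real.pi * (Real.pi * ∑' p, ge2 (term3 s x) p) +
      CR * (C3breve s x * x ^ 2) := by
    rw [← C3tilde_mul_sq, C3]; field_simp
  have e4 : C4 s x * x * t = 1 / Real.pi * ((Real.pi * ∑' p, ge2 (term4 s x) p) * t) +
      CR * (C4breve s x * (x * t)) := by
    rw [← C4tilde_mul, C4]; field_simp
  have h3' : 0 ≤ ∑' p, ge2 (term3 s x) p := tsum_nonneg h3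
  have h4' : 0 ≤ ∑' p, ge2 (term4 s x) p := tsum_nonneg h4
  have hb3 := C3breve_nonneg s hx
  have hb4 := C4breve_nonneg s hx
  rw [e3, e4, ENNReal.ofReal_add (by positivity) (by positivity),
    ENNReal.ofReal_add (by positivity) (by positivity), ENNReal.ofReal_mul (p := 1 / Real.pi)
    (by positivity), ENNReal.ofReal_mul (p := 1 / Real.pi) (by positivity),
    ENNReal.ofReal_mul hCR, ENNReal.ofReal_mul hCR]
  ring

end OpS

/-! ### The part of the operators that is linear in `θ` -/

lemma fc_sub {F G : ℝ → ℂ} (hF : Continuous F) (hG : Continuous G) (m : ℤ) :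
    fc (fun α => F α - G α) m = fc F m - fc G m := by
  have h := fc_const_mul (G := G) (-1) m
  simp only [neg_one_mul] at h
  simp only [sub_eq_add_neg]
  rw [fc_add hF (by fun_prop), h]

section LinearPart

variable {w φ : ℤ → ℝ≥0∞} {f θ : ℝ → ℝ} {s x t K : ℝ}

lemma enorm_I_div_pi : ‖(Complex.I / (Real.pi : ℂ) : ℂ)‖ₑ = ENNReal.ofReal (1 / Real.pi) := by
  rw [← ofReal_norm]
  simp [abs_of_pos Real.pi_pos]

lemma wiener_hilbert (hf : Wiener fun x => (f x : ℂ)) (h0 : fc (fun x => (f x : ℂ)) 0 = 0) :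
    Wiener fun x => (hilbert f x : ℂ) := by
  rw [funext fun α => hilbert_eq hf h0 hf α]
  exact (hasExp_opT hf hf 0).wiener.const_mul _

lemma wn_hilbert_le (hf : Wiener fun x => (f x : ℂ)) (h0 : fc (fun x => (f x : ℂ)) 0 = 0)
    (W : ℤ → ℝ≥0∞) : wn W (fun x => (hilbert f x : ℂ)) ≤ wn W fun x => (f x : ℂ) := by
  have hpi := Real.pi_pos
  rw [funext fun α => hilbert_eq hf h0 hf α, wn_const_mul, enorm_I_div_pi]
  refine (mul_le_mul_right (wn_opT_zero_le W hf hf) _).trans (le_of_eq ?_)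
  rw [← mul_assoc, ← ENNReal.ofReal_mul (by positivity), one_div_mul_cancel hpi.ne',
    ENNReal.ofReal_one, one_mul]

lemma wiener_opR (hf : Wiener fun x => (f x : ℂ)) (hθ : Wiener fun x => (θ x : ℂ)) :
    Wiener (opR θ f) := by
  rw [funext fun α => opR_eq hf hθ α]
  exact (hasExp_opT hf hθ 1).wiener.const_mul _

/-- The constant `K` is left free: it is `1` on `ω₀` and `CR` for a general function. -/
lemma wn_opR_le (hf : Wiener fun x => (f x : ℂ)) (hθ : Wiener fun x => (θ x : ℂ))
    (hC : ∀ j : ℤ, fc (fun x => (f x : ℂ)) j ≠ 0 → ∀ κ : Fin 1 → ℤ, ‖mult j κ‖ ≤ Real.pi * K)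
    (W : ℤ → ℝ≥0∞) :
    wn W (opR θ f) ≤ ENNReal.ofReal K * convNorm W (fun x => (f x : ℂ)) fun x => (θ x : ℂ) := by
  have hpi := Real.pi_pos
  have hc : ‖(1 / (Real.pi : ℂ) : ℂ)‖ₑ = ENNReal.ofReal (1 / Real.pi) := by
    rw [← ofReal_norm]
    simp [abs_of_pos hpi]
  rw [funext fun α => opR_eq hf hθ α, wn_const_mul, hc]
  have h := wn_opT_one_le_of_mult_le W hf hθ (C := ENNReal.ofReal (Real.pi * K)) fun j hj κ => by
    rw [← ofReal_norm]
    exact ENNReal.ofReal_le_ofReal (hC j hj κ)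
  refine (mul_le_mul_right h _).trans (le_of_eq ?_)
  rw [← mul_assoc, ← ENNReal.ofReal_mul (by positivity)]
  congr 2
  field_simp

/-- The operator `θ 𝓗 + Im ℛ`. -/
def linOp (θ f : ℝ → ℝ) (α : ℝ) : ℝ := θ α * hilbert f α + (opR θ f α).im

lemma wn_linOp_le_aux (hf : Wiener fun x => (f x : ℂ)) (h0 : fc (fun x => (f x : ℂ)) 0 = 0)
    (hθ : Wiener fun x => (θ x : ℂ)) :
    (Wiener fun x => (linOp θ f x : ℂ)) ∧ ∀ W : ℤ → ℝ≥0∞, (∀ k, W (-k) = W k) →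
      wn W (fun x => (linOp θ f x : ℂ)) ≤
        convNorm W (fun x => (hilbert f x : ℂ)) (fun x => (θ x : ℂ)) + wn W (opR θ f) := by
  have hH := wiener_hilbert hf h0
  have hR := wiener_opR hf hθ
  have e : (fun x => (linOp θ f x : ℂ)) =
      fun x => (hilbert f x : ℂ) * (θ x : ℂ) + ((opR θ f x).im : ℂ) := by
    ext x; rw [linOp]; push_cast; ring
  rw [e]
  refine ⟨(hH.mul hθ).add (wn_im_le (fun _ => 1) (fun _ => rfl) hR).1, fun W hW => ?_⟩
  obtain ⟨h1, h2⟩ := wn_im_le W hW hR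
  exact (wn_add_le W (hH.mul hθ).continuous h1.continuous).trans
    (add_le_add (wn_mul_le_convNorm W hH hθ) h2)

lemma wiener_linOp (hf : Wiener fun x => (f x : ℂ)) (h0 : fc (fun x => (f x : ℂ)) 0 = 0)
    (hθ : Wiener fun x => (θ x : ℂ)) : Wiener fun x => (linOp θ f x : ℂ) :=
  (wn_linOp_le_aux hf h0 hθ).1

lemma wn_linOp_le (hw : IsWeight w φ) (hf : Wiener fun x => (f x : ℂ))
    (h0 : fc (fun x => (f x : ℂ)) 0 = 0) (hθ : Wiener fun x => (θ x : ℂ)) (hK : 0 ≤ K)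
    (hC : ∀ j : ℤ, fc (fun x => (f x : ℂ)) j ≠ 0 → ∀ κ : Fin 1 → ℤ, ‖mult j κ‖ ≤ Real.pi * K)
    (hθx : wn w (fun x => (θ x : ℂ)) ≤ ENNReal.ofReal x) :
    wn w (fun x => (linOp θ f x : ℂ)) ≤
      ENNReal.ofReal ((1 + K) * x) * wn w fun x => (f x : ℂ) := by
  refine ((wn_linOp_le_aux hf h0 hθ).2 w hw.w_neg).trans ?_
  refine (add_le_add (convNorm_w_le hw _ _) ((wn_opR_le hf hθ hC w).trans
    (mul_le_mul_right (convNorm_w_le hw _ _) _))).trans ?_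
  calc _ ≤ wn w (fun x => (f x : ℂ)) * ENNReal.ofReal x +
        ENNReal.ofReal K * (wn w (fun x => (f x : ℂ)) * ENNReal.ofReal x) := by
        gcongr
        exact wn_hilbert_le hf h0 w
    _ = _ := by
        rw [ENNReal.ofReal_mul (by positivity), ENNReal.ofReal_add zero_le_one hK,
          ENNReal.ofReal_one]
        ring

lemma wn_wpow_linOp_le (hw : IsWeight w φ) (hs : 0 < s) (hf : Wiener fun x => (f x : ℂ))
    (h0 : fc (fun x => (f x : ℂ)) 0 = 0) (hθ : Wiener fun x => (θ x : ℂ)) (hK : 0 ≤ K)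
    (hC : ∀ j : ℤ, fc (fun x => (f x : ℂ)) j ≠ 0 → ∀ κ : Fin 1 → ℤ, ‖mult j κ‖ ≤ Real.pi * K)
    (hθx : wn w (fun x => (θ x : ℂ)) ≤ ENNReal.ofReal x)
    (hθt : wn (wpow w φ s) (fun x => (θ x : ℂ)) ≤ ENNReal.ofReal t) :
    wn (wpow w φ s) (fun x => (linOp θ f x : ℂ)) ≤
      ENNReal.ofReal (b 2 s * (1 + K) * x) * wn (wpow w φ s) (fun x => (f x : ℂ)) +
      ENNReal.ofReal (b 2 s * (1 + K) * t) * wn w (fun x => (f x : ℂ)) := by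
  have hb := b_nonneg 2 s
  refine ((wn_linOp_le_aux hf h0 hθ).2 _ (hw.wpow_neg s)).trans ?_
  refine (add_le_add (convNorm_wpow_le hw hs _ _) ((wn_opR_le hf hθ hC _).trans
    (mul_le_mul_right (convNorm_wpow_le hw hs _ _) _))).trans ?_
  calc _ ≤ ENNReal.ofReal (b 2 s) * (wn w (fun x => (f x : ℂ)) * ENNReal.ofReal t +
          wn (wpow w φ s) (fun x => (f x : ℂ)) * ENNReal.ofReal x) +
        ENNReal.ofReal K * (ENNReal.ofReal (b 2 s) * (wn w (fun x => (f x : ℂ)) * ENNReal.ofReal t +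
          wn (wpow w φ s) (fun x => (f x : ℂ)) * ENNReal.ofReal x)) := by
        gcongr
        · exact wn_hilbert_le hf h0 w
        · exact wn_hilbert_le hf h0 _
    _ = _ := by
        rw [ENNReal.ofReal_mul (q := x) (by positivity), ENNReal.ofReal_mul (q := t) (by positivity),
          ENNReal.ofReal_mul hb, ENNReal.ofReal_add zero_le_one hK, ENNReal.ofReal_one]
        ring

lemma norm_mult_le_CR (j : ℤ) (κ : Fin 1 → ℤ) : ‖mult j κ‖ ≤ Real.pi * CR := by
  rw [← a_one]; exact norm_mult_le j κ

/-- Additivity of a principal value requires the individual limits to exist; the representations by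
`opT` supply this, and mean zero is needed for the Hilbert part. -/
lemma linOp_sub {g : ℝ → ℝ} (hf : Wiener fun x => (f x : ℂ)) (hf0 : fc (fun x => (f x : ℂ)) 0 = 0)
    (hg : Wiener fun x => (g x : ℂ)) (hg0 : fc (fun x => (g x : ℂ)) 0 = 0)
    (hθ : Wiener fun x => (θ x : ℂ)) (α : ℝ) :
    linOp θ (fun x => f x - g x) α = linOp θ f α - linOp θ g α := by
  have e : (fun x => ((f x - g x : ℝ) : ℂ)) = fun x => (f x : ℂ) - (g x : ℂ) := by
    ext x; push_cast; rfl
  have hfg : Wiener fun x => ((f x - g x : ℝ) : ℂ) := by rw [e]; exact hf.sub hg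
  have hfg0 : fc (fun x => ((f x - g x : ℝ) : ℂ)) 0 = 0 := by
    rw [e, fc_sub hf.continuous hg.continuous, hf0, hg0, sub_zero]
  have h1 : hilbert (fun x => f x - g x) α = hilbert f α - hilbert g α := by
    have := hilbert_eq hfg hfg0 hθ α
    rw [e, opT_sub_left hf hg hθ, mul_sub, ← hilbert_eq hf hf0 hθ, ← hilbert_eq hg hg0 hθ] at this
    exact_mod_cast this
  have h2 : opR θ (fun x => f x - g x) α = opR θ f α - opR θ g α := by
    rw [opR_eq hfg hθ, opR_eq hf hθ, opR_eq hg hθ, e, opT_sub_left hf hg hθ, mul_sub]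
  rw [linOp, linOp, linOp, h1, h2, Complex.sub_im]
  ring

end LinearPart

/-! ### The part of order zero and the gravity terms -/

section Gravity

variable {w φ : ℤ → ℝ≥0∞} {θ : ℝ → ℝ} {s x t : ℝ}

lemma hasExp_const_mul_mode (c : ℂ) (k : ℤ) :
    HasExp (fun _ : Unit => c) (fun _ => k) (fun α => c * mode k α) where
  summable := (hasSum_fintype _).summable
  hasSum _ := by simp

lemma hasExp_im_const_mul_mode (c : ℂ) :
    HasExp (Sum.elim (fun _ : Unit => 1 / (2 * Complex.I) * c)
        (fun _ : Unit => -(1 / (2 * Complex.I)) * (starRingEnd ℂ) c))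
      (Sum.elim (fun _ => (1 : ℤ)) fun _ => -1) (fun α => ((c * mode 1 α).im : ℂ)) := by
  refine ((hasExp_const_mul_mode (1 / (2 * Complex.I) * c) 1).add (hasExp_const_mul_mode
    (-(1 / (2 * Complex.I)) * (starRingEnd ℂ) c) (-1))).congr fun α => ?_
  rw [mode_neg]
  have h := Complex.sub_conj (c * mode 1 α)
  rw [map_mul] at h
  have h2 : 1 / (2 * Complex.I) * (2 * Complex.I) = 1 :=
    one_div_mul_cancel (mul_ne_zero two_ne_zero Complex.I_ne_zero)
  push_cast at h
  linear_combination (-((c * mode 1 α).im : ℂ)) * h2 - 1 / (2 * Complex.I) * h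

lemma fc_im_const_mul_mode (c : ℂ) {j : ℤ} (h1 : j ≠ 1) (h2 : j ≠ -1) :
    fc (fun α => ((c * mode 1 α).im : ℂ)) j = 0 := by
  rw [(hasExp_im_const_mul_mode c).fc_eq, tsum_fintype]
  simp [h1.symm, h2.symm]

lemma wn_const_mul_mode_le (W : ℤ → ℝ≥0∞) (c : ℂ) (k : ℤ) :
    wn W (fun α => c * mode k α) ≤ ‖c‖ₑ * W k := by
  refine ((hasExp_const_mul_mode c k).wn_le W).trans (le_of_eq ?_)
  rw [tsum_fintype]
  simp [mul_comm]

lemma exp_I_add_eq (c α : ℝ) :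
    Complex.exp (Complex.I * ((α + c : ℝ) : ℂ)) = Complex.exp (Complex.I * (c : ℂ)) * mode 1 α := by
  rw [mode, ← Complex.exp_add]; congr 1; push_cast; ring

/-- The coefficient of `e^{iα}` in the gravity terms. -/
def gravCoeff (Aρ L : ℝ) (ϑ : ℝ → ℝ) : ℂ :=
  -(Aρ : ℂ) * ((L / Real.pi : ℝ) : ℂ) * Complex.exp (Complex.I * (mean ϑ : ℂ))

variable {Aρ L : ℝ} {ϑ : ℝ → ℝ}

lemma enorm_gravCoeff (hL : 0 < L) :
    ‖gravCoeff Aρ L ϑ‖ₑ = ENNReal.ofReal (|Aρ| * (L / Real.pi)) := by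
  have hpi := Real.pi_pos
  rw [← ofReal_norm, gravCoeff, norm_mul, norm_mul, mul_comm Complex.I,
    Complex.norm_exp_ofReal_mul_I, norm_neg, Complex.norm_real, Complex.norm_real, mul_one,
    Real.norm_eq_abs, Real.norm_eq_abs, abs_of_pos (div_pos hL hpi)]

lemma gravCoeff_mul_mode (α : ℝ) : gravCoeff Aρ L ϑ * mode 1 α =
    ((-Aρ * (L / Real.pi) : ℝ) : ℂ) * Complex.exp (Complex.I * ((α + mean ϑ : ℝ) : ℂ)) := by
  rw [exp_I_add_eq, gravCoeff]; push_cast; ring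

lemma omega0_eq (α : ℝ) : omega0 Aρ L ϑ α = (gravCoeff Aρ L ϑ * mode 1 α).im := by
  rw [gravCoeff_mul_mode, Complex.im_ofReal_mul, mul_comm Complex.I, Complex.exp_ofReal_mul_I_im,
    omega0]

lemma wiener_gravMode : Wiener fun α => gravCoeff Aρ L ϑ * mode 1 α :=
  (hasExp_const_mul_mode _ _).wiener

lemma wiener_omega0 : Wiener fun α => (omega0 Aρ L ϑ α : ℂ) := by
  simp only [omega0_eq]
  exact (hasExp_im_const_mul_mode _).wiener

lemma fc_omega0 {j : ℤ} (h1 : j ≠ 1) (h2 : j ≠ -1) : fc (fun α => (omega0 Aρ L ϑ α : ℂ)) j = 0 := by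
  simp only [omega0_eq]
  exact fc_im_const_mul_mode _ h1 h2

lemma wn_omega0_le (hL : 0 < L) {W : ℤ → ℝ≥0∞} (hW : ∀ k, W (-k) = W k) :
    wn W (fun α => (omega0 Aρ L ϑ α : ℂ)) ≤ ENNReal.ofReal (|Aρ| * (L / Real.pi)) * W 1 := by
  simp only [omega0_eq]
  refine ((wn_im_le W hW wiener_gravMode).2.trans (wn_const_mul_mode_le W _ 1)).trans (le_of_eq ?_)
  rw [enorm_gravCoeff hL]

lemma norm_mult_omega0_le (j : ℤ) (hj : fc (fun α => (omega0 Aρ L ϑ α : ℂ)) j ≠ 0)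
    (κ : Fin 1 → ℤ) : ‖mult j κ‖ ≤ Real.pi * 1 := by
  rw [mul_one]
  refine norm_mult_one_le ?_ κ
  by_contra! h
  exact hj (fc_omega0 h.1 h.2)

lemma tsum_cos_tail (y : ℝ) :
    ∑' j : ℕ, (-1 : ℝ) ^ (j + 1) * y ^ (2 * (j + 1)) / ((2 * (j + 1)).factorial : ℝ) =
      Real.cos y - 1 := by
  have h := (hasSum_nat_add_iff' 1).2 (Real.hasSum_cos y)
  simpa using h.tsum_eq

lemma tsum_sin_tail (y : ℝ) :
    ∑' j : ℕ, (-1 : ℝ) ^ (j + 1) * y ^ (1 + 2 * (j + 1)) / ((1 + 2 * (j + 1)).factorial : ℝ) =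
      Real.sin y - y := by
  have h := (hasSum_nat_add_iff' 1).2 (Real.hasSum_sin y)
  simpa [add_comm] using h.tsum_eq

/-- The gravity part of `ω_{≥2}`. -/
def gravGe2 (Aρ L : ℝ) (ϑ : ℝ → ℝ) (α : ℝ) : ℝ :=
  (gravCoeff Aρ L ϑ * mode 1 α * expRem 2 (fun x => (theta ϑ x : ℂ)) α).im

/-- The real and imaginary parts of `e^{iθ} - 1 - iθ` are `cos θ - 1` and `sin θ - θ`, the sums of
the two Taylor tails in `ω_{≥2}`. -/
lemma gravGe2_eq (α : ℝ) : gravGe2 Aρ L ϑ α =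
    -(Aρ * (L / Real.pi)) * (Real.sin (α + mean ϑ) * (Real.cos (theta ϑ α) - 1) +
      Real.cos (α + mean ϑ) * (Real.sin (theta ϑ α) - theta ϑ α)) := by
  rw [gravGe2, gravCoeff_mul_mode, expRem_two, mul_assoc, Complex.im_ofReal_mul, Complex.mul_im,
    mul_comm Complex.I, mul_comm Complex.I, Complex.exp_ofReal_mul_I_im,
    Complex.exp_ofReal_mul_I_re]
  have h1 : (Complex.exp ((theta ϑ α : ℂ) * Complex.I) - 1 - (theta ϑ α : ℂ) * Complex.I).re =
      Real.cos (theta ϑ α) - 1 := by simp [Complex.exp_ofReal_mul_I_re]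
  have h2 : (Complex.exp ((theta ϑ α : ℂ) * Complex.I) - 1 - (theta ϑ α : ℂ) * Complex.I).im =
      Real.sin (theta ϑ α) - theta ϑ α := by simp [Complex.exp_ofReal_mul_I_im]
  rw [h1, h2]
  ring

lemma wn_gravGe2_le_aux (hθ : Wiener fun x => (theta ϑ x : ℂ)) {W : ℤ → ℝ≥0∞}
    (hW : ∀ k, W (-k) = W k) :
    Wiener (fun α => (gravGe2 Aρ L ϑ α : ℂ)) ∧ wn W (fun α => (gravGe2 Aρ L ϑ α : ℂ)) ≤
      convNorm W (fun α => gravCoeff Aρ L ϑ * mode 1 α) (expRem 2 fun x => (theta ϑ x : ℂ)) := by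
  have h1 := wiener_expRem hθ 2
  have h2 := wn_im_le W hW ((wiener_gravMode (Aρ := Aρ) (L := L) (ϑ := ϑ)).mul h1)
  exact ⟨h2.1, h2.2.trans (wn_mul_le_convNorm W wiener_gravMode h1)⟩

lemma wn_gravGe2_le (hL : 0 < L) (hw : IsWeight w φ) (hθ : Wiener fun x => (theta ϑ x : ℂ))
    (hx : 0 ≤ x) (hθx : wn w (fun x => (theta ϑ x : ℂ)) ≤ ENNReal.ofReal x) :
    wn w (fun α => (gravGe2 Aρ L ϑ α : ℂ)) ≤ ENNReal.ofReal (C6 x * x ^ 2) *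
      (ENNReal.ofReal (|Aρ| * (L / Real.pi)) * w 1) := by
  refine ((wn_gravGe2_le_aux hθ hw.w_neg).2.trans
    (hw.convNorm_expRem_two_le hθ hx hθx _)).trans ?_
  rw [← C1breve_mul_sq]
  refine (mul_le_mul_right (wn_const_mul_mode_le w _ 1) _).trans (le_of_eq ?_)
  rw [enorm_gravCoeff hL]
  rfl

lemma wn_wpow_gravGe2_le (hL : 0 < L) (hw : IsWeight w φ) (hs : 0 < s)
    (hθ : Wiener fun x => (theta ϑ x : ℂ)) (hx : 0 ≤ x) (ht : 0 ≤ t)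
    (hθx : wn w (fun x => (theta ϑ x : ℂ)) ≤ ENNReal.ofReal x)
    (hθt : wn (wpow w φ s) (fun x => (theta ϑ x : ℂ)) ≤ ENNReal.ofReal t) :
    wn (wpow w φ s) (fun α => (gravGe2 Aρ L ϑ α : ℂ)) ≤
      ENNReal.ofReal (C3breve s x * x ^ 2) * (ENNReal.ofReal (|Aρ| * (L / Real.pi)) * wpow w φ s 1) +
      ENNReal.ofReal (C4breve s x * (x * t)) * (ENNReal.ofReal (|Aρ| * (L / Real.pi)) * w 1) := by
  refine ((wn_gravGe2_le_aux hθ (hw.wpow_neg s)).2.trans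
    (hw.convNorm_wpow_expRem_two_le hs hθ hx ht hθx hθt _)).trans ?_
  rw [← enorm_gravCoeff (ϑ := ϑ) hL]
  gcongr
  · exact wn_const_mul_mode_le _ _ 1
  · exact wn_const_mul_mode_le _ _ 1

end Gravity

/-! ### Exponential weights -/

/-- The weight `e^{νφ}`. -/
def expWeight (ν : ℝ) (φ : ℤ → ℝ) (k : ℤ) : ℝ≥0∞ := ENNReal.ofReal (Real.exp (ν * φ k))

/-- The gauge `|k|`. -/
def absGauge (k : ℤ) : ℝ := |(k : ℝ)|

/-- The truncated gauge `min(|k|, N)`. -/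
def truncGauge (N : ℕ) (k : ℤ) : ℝ := min |(k : ℝ)| N

lemma isWeight_expWeight {ν : ℝ} (hν : 0 ≤ ν) {φ : ℤ → ℝ} (h0 : φ 0 = 0) (hnn : ∀ k, 0 ≤ φ k)
    (hadd : ∀ j k, φ (j + k) ≤ φ j + φ k) (hneg : ∀ k, φ (-k) = φ k) :
    IsWeight (expWeight ν φ) fun k => ENNReal.ofReal (φ k) where
  w_zero := by simp [expWeight, h0]
  w_add j k := by
    rw [expWeight, expWeight, expWeight, ← ENNReal.ofReal_mul (Real.exp_nonneg _), ← Real.exp_add,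
      ← mul_add]
    gcongr
    exact hadd j k
  w_neg k := by rw [expWeight, expWeight, hneg]
  φ_zero := by simp [h0]
  φ_add j k := by
    rw [← ENNReal.ofReal_add (hnn j) (hnn k)]
    exact ENNReal.ofReal_le_ofReal (hadd j k)
  φ_neg k := by rw [hneg]

lemma isWeight_abs {ν : ℝ} (hν : 0 ≤ ν) :
    IsWeight (expWeight ν absGauge) fun k => ENNReal.ofReal (absGauge k) :=
  isWeight_expWeight hν (by simp [absGauge]) (fun k => abs_nonneg _)
    (fun j k => by simpa [absGauge] using abs_add_le (j : ℝ) k) (fun k => by simp [absGauge])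

/-- Truncation preserves the weight axioms but makes the weight bounded. Every function in the
Wiener algebra then has finite norm, with all operator constants unchanged. -/
lemma isWeight_trunc {ν : ℝ} (hν : 0 ≤ ν) (N : ℕ) :
    IsWeight (expWeight ν (truncGauge N)) fun k => ENNReal.ofReal (truncGauge N k) :=
  isWeight_expWeight hν (by simp [truncGauge])
    (fun k => le_min (abs_nonneg _) (Nat.cast_nonneg _))
    (fun j k => by
      unfold truncGauge
      have h1 := abs_add_le (j : ℝ) k
      have h2 := abs_nonneg (j : ℝ)
      have h3 := abs_nonneg (k : ℝ)
      have h4 : (0 : ℝ) ≤ N := Nat.cast_nonneg _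
      push_cast
      rcases le_total |(j : ℝ)| N with h | h <;> rcases le_total |(k : ℝ)| N with h' | h' <;>
        simp only [min_eq_left, min_eq_right, h, h'] <;>
        first
        | exact (min_le_left _ _).trans h1
        | exact (min_le_right _ _).trans (by linarith))
    (fun k => by simp [truncGauge])

lemma truncGauge_le (N : ℕ) (k : ℤ) : truncGauge N k ≤ absGauge k := min_le_left _ _

lemma truncGauge_one {N : ℕ} (hN : 1 ≤ N) : truncGauge N 1 = 1 := by
  have : (1 : ℝ) ≤ N := by exact_mod_cast hN
  simp [truncGauge, this]

lemma expWeight_mono {ν : ℝ} (hν : 0 ≤ ν) {φ ψ : ℤ → ℝ} (h : ∀ k, φ k ≤ ψ k) (k : ℤ) :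
    expWeight ν φ k ≤ expWeight ν ψ k := by
  unfold expWeight
  gcongr
  exact h k

lemma wpow_mono {w w' φ φ' : ℤ → ℝ≥0∞} (hw : ∀ k, w k ≤ w' k) (hφ : ∀ k, φ k ≤ φ' k) {s : ℝ}
    (hs : 0 ≤ s) (k : ℤ) : wpow w φ s k ≤ wpow w' φ' s k :=
  mul_le_mul' (hw k) (ENNReal.rpow_le_rpow (hφ k) hs)

lemma wpow_trunc_le {ν s : ℝ} (hν : 0 ≤ ν) (hs : 0 ≤ s) (N : ℕ) (k : ℤ) :
    wpow (expWeight ν (truncGauge N)) (fun k => ENNReal.ofReal (truncGauge N k)) s k ≤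
      wpow (expWeight ν absGauge) (fun k => ENNReal.ofReal (absGauge k)) s k :=
  wpow_mono (expWeight_mono hν (truncGauge_le N))
    (fun k => ENNReal.ofReal_le_ofReal (truncGauge_le N k)) hs k

/-- A finite set of frequencies eventually sees the limiting weight, and the norm is the supremum of
its finite partial sums. -/
lemma wn_le_of_eventually {W : ℤ → ℝ≥0∞} {V : ℕ → ℤ → ℝ≥0∞} {G : ℝ → ℂ} {B : ℝ≥0∞}
    (hV : ∀ k, ∀ᶠ N in atTop, V N k = W k) (hB : ∀ᶠ N in atTop, wn (V N) G ≤ B) : wn W G ≤ B := by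
  rw [wn, ENNReal.tsum_eq_iSup_sum]
  refine iSup_le fun S => ?_
  have h1 : ∀ᶠ N in atTop, ∀ k ∈ S, V N k = W k := (Filter.eventually_all_finset S).2 fun k _ => hV k
  obtain ⟨N, hN, hN'⟩ := (h1.and hB).exists
  refine le_trans (le_of_eq (Finset.sum_congr rfl fun k hk => ?_)) ((ENNReal.sum_le_tsum S).trans hN')
  rw [hN k hk]

lemma eventually_truncGauge (k : ℤ) : ∀ᶠ N : ℕ in atTop, truncGauge N k = absGauge k := by
  filter_upwards [eventually_ge_atTop k.natAbs] with N hN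
  refine min_eq_left ?_
  rw [← Int.cast_abs, Int.abs_eq_natAbs]
  exact_mod_cast hN

lemma wn_trunc_ne_top {ν : ℝ} (hν : 0 ≤ ν) {G : ℝ → ℂ} (hG : Wiener G) (N : ℕ) :
    wn (expWeight ν (truncGauge N)) G ≠ ∞ := by
  have h1 : ∀ k, expWeight ν (truncGauge N) k ≤ ENNReal.ofReal (Real.exp (ν * N)) := fun k => by
    unfold expWeight
    gcongr
    exact min_le_right _ _
  refine ne_top_of_le_ne_top ?_ (wn_mono h1)
  rw [wn, ENNReal.tsum_mul_left]
  exact ENNReal.mul_ne_top ENNReal.ofReal_ne_top (tsum_enorm_ne_top hG.summable)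

lemma wn_wpow_trunc_ne_top {ν s : ℝ} (hν : 0 ≤ ν) (hs : 0 ≤ s) {G : ℝ → ℂ} (hG : Wiener G) (N : ℕ) :
    wn (wpow (expWeight ν (truncGauge N)) (fun k => ENNReal.ofReal (truncGauge N k)) s) G ≠ ∞ := by
  have h1 : ∀ k, wpow (expWeight ν (truncGauge N)) (fun k => ENNReal.ofReal (truncGauge N k)) s k ≤
      ENNReal.ofReal (Real.exp (ν * N)) * ENNReal.ofReal N ^ s := fun k => by
    unfold wpow expWeight
    gcongr
    · exact min_le_right |(k : ℝ)| (N : ℝ)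
    · exact ENNReal.ofReal_le_ofReal (min_le_right |(k : ℝ)| (N : ℝ))
  refine ne_top_of_le_ne_top ?_ (wn_mono h1)
  rw [wn, ENNReal.tsum_mul_left]
  exact ENNReal.mul_ne_top (ENNReal.mul_ne_top ENNReal.ofReal_ne_top
    (ENNReal.rpow_ne_top_of_nonneg hs ENNReal.ofReal_ne_top)) (tsum_enorm_ne_top hG.summable)

/-! ### The norms of the spaces as weighted norms -/

lemma continuous_of_ofReal {f : ℝ → ℝ} (h : Continuous fun x => (f x : ℂ)) : Continuous f := by
  exact Complex.continuous_re.comp h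

lemma periodic_of_ofReal {f : ℝ → ℝ} {c : ℝ} (h : Function.Periodic (fun x => (f x : ℂ)) c) :
    Function.Periodic f c := fun x => Complex.ofReal_injective (h x)

section Norms

variable {ν s : ℝ} {f : ℝ → ℝ}

lemma normF_term (k : ℤ) : Real.exp (ν * |(k : ℝ)|) * ‖fhat f k‖ =
    (expWeight ν absGauge k * ‖fc (fun x => (f x : ℂ)) k‖ₑ).toReal := by
  rw [ENNReal.toReal_mul, expWeight, ENNReal.toReal_ofReal (Real.exp_nonneg _), toReal_enorm]
  rfl

/-- The excluded zero frequency agrees with the weight because `0^s = 0` for `s > 0`. -/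
lemma normFdot_term (hs : 0 < s) (k : ℤ) :
    (if k = 0 then 0 else Real.exp (ν * |(k : ℝ)|) * |(k : ℝ)| ^ s * ‖fhat f k‖) =
    (wpow (expWeight ν absGauge) (fun k => ENNReal.ofReal (absGauge k)) s k *
      ‖fc (fun x => (f x : ℂ)) k‖ₑ).toReal := by
  split_ifs with h
  · simp [h, wpow, absGauge, hs]
  · rw [ENNReal.toReal_mul, wpow, ENNReal.toReal_mul, expWeight,
      ENNReal.toReal_ofReal (Real.exp_nonneg _), toReal_enorm, ← ENNReal.toReal_rpow,
      ENNReal.toReal_ofReal (r := absGauge k) (abs_nonneg _)]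
    rfl

lemma expWeight_ne_top {φ : ℤ → ℝ} (k : ℤ) : expWeight ν φ k ≠ ∞ := ENNReal.ofReal_ne_top

lemma wpow_ne_top (hs : 0 < s) {φ : ℤ → ℝ} (k : ℤ) :
    wpow (expWeight ν φ) (fun k => ENNReal.ofReal (φ k)) s k ≠ ∞ :=
  ENNReal.mul_ne_top ENNReal.ofReal_ne_top (ENNReal.rpow_ne_top_of_nonneg hs.le ENNReal.ofReal_ne_top)

lemma normF_eq (ν : ℝ) (f : ℝ → ℝ) :
    normF ν f = (wn (expWeight ν absGauge) fun x => (f x : ℂ)).toReal := by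
  rw [normF, wn, ENNReal.tsum_toReal_eq fun k =>
    ENNReal.mul_ne_top (expWeight_ne_top k) enorm_ne_top]
  exact tsum_congr normF_term

lemma normFdot_eq (ν : ℝ) (hs : 0 < s) (f : ℝ → ℝ) :
    normFdot ν s f = (wn (wpow (expWeight ν absGauge) (fun k => ENNReal.ofReal (absGauge k)) s)
      fun x => (f x : ℂ)).toReal := by
  rw [normFdot, wn, ENNReal.tsum_toReal_eq fun k =>
    ENNReal.mul_ne_top (wpow_ne_top hs k) enorm_ne_top]
  exact tsum_congr (normFdot_term hs)

lemma summable_toReal_iff {ι : Type} {g : ι → ℝ≥0∞} (hg : ∀ i, g i ≠ ∞) :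
    (Summable fun i => (g i).toReal) ↔ ∑' i, g i ≠ ∞ := by
  refine ⟨fun h => ?_, ENNReal.summable_toReal⟩
  have := h.tsum_ofReal_ne_top
  simpa only [ENNReal.ofReal_toReal (hg _)] using this

lemma memF_iff : MemF ν f ↔ Continuous f ∧ Function.Periodic f (2 * Real.pi) ∧
    wn (expWeight ν absGauge) (fun x => (f x : ℂ)) ≠ ∞ := by
  rw [MemF, funext normF_term, summable_toReal_iff fun k =>
    ENNReal.mul_ne_top (expWeight_ne_top k) enorm_ne_top]
  rfl

lemma memFdot_iff (hs : 0 < s) : MemFdot ν s f ↔ Continuous f ∧ Function.Periodic f (2 * Real.pi) ∧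
    wn (wpow (expWeight ν absGauge) (fun k => ENNReal.ofReal (absGauge k)) s)
      (fun x => (f x : ℂ)) ≠ ∞ := by
  rw [MemFdot, funext (normFdot_term hs), summable_toReal_iff fun k =>
    ENNReal.mul_ne_top (wpow_ne_top hs k) enorm_ne_top]
  rfl

lemma memF_and_norm_le {B : ℝ} (hf : Wiener fun x => (f x : ℂ)) (hB : 0 ≤ B)
    (h : wn (expWeight ν absGauge) (fun x => (f x : ℂ)) ≤ ENNReal.ofReal B) :
    MemF ν f ∧ normF ν f ≤ B := by
  refine ⟨memF_iff.2 ⟨continuous_of_ofReal hf.continuous, periodic_of_ofReal hf.periodic,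
    ne_top_of_le_ne_top ENNReal.ofReal_ne_top h⟩, ?_⟩
  rw [normF_eq]
  exact ENNReal.toReal_le_of_le_ofReal hB h

lemma memFdot_and_norm_le (hs : 0 < s) {B : ℝ} (hf : Wiener fun x => (f x : ℂ)) (hB : 0 ≤ B)
    (h : wn (wpow (expWeight ν absGauge) (fun k => ENNReal.ofReal (absGauge k)) s)
      (fun x => (f x : ℂ)) ≤ ENNReal.ofReal B) :
    MemFdot ν s f ∧ normFdot ν s f ≤ B := by
  refine ⟨(memFdot_iff hs).2 ⟨continuous_of_ofReal hf.continuous, periodic_of_ofReal hf.periodic,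
    ne_top_of_le_ne_top ENNReal.ofReal_ne_top h⟩, ?_⟩
  rw [normFdot_eq ν hs]
  exact ENNReal.toReal_le_of_le_ofReal hB h

/-- Homogeneous weights vanish at frequency zero, so that single coefficient is added by hand. -/
lemma Wiener.of_wn {W : ℤ → ℝ≥0∞} {G : ℝ → ℂ} (hc : Continuous G)
    (hp : Function.Periodic G (2 * Real.pi)) (hW : ∀ k, k ≠ 0 → 1 ≤ W k) (h : wn W G ≠ ∞) :
    Wiener G := by
  refine ⟨hc, hp, summable_norm_of_enorm ?_⟩
  have h1 : ∀ k, ‖fc G k‖ₑ ≤ (if k = 0 then ‖fc G 0‖ₑ else 0) + W k * ‖fc G k‖ₑ := by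
    intro k
    split_ifs with h
    · rw [h]; exact le_self_add
    · rw [zero_add]; exact le_mul_of_one_le_left' (hW k h)
  refine ne_top_of_le_ne_top ?_ (ENNReal.tsum_le_tsum h1)
  rw [ENNReal.tsum_add, tsum_ite_eq]
  exact ENNReal.add_ne_top.2 ⟨enorm_ne_top, h⟩

lemma one_le_absGauge {k : ℤ} (hk : k ≠ 0) : 1 ≤ absGauge k := by
  unfold absGauge
  rw [← Int.cast_abs]
  exact_mod_cast Int.one_le_abs hk

lemma one_le_wpow_abs (hν : 0 ≤ ν) (hs : 0 ≤ s) {k : ℤ} (hk : k ≠ 0) :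
    1 ≤ wpow (expWeight ν absGauge) (fun k => ENNReal.ofReal (absGauge k)) s k := by
  refine one_le_mul ((isWeight_abs hν).one_le_w k) ?_
  rw [← ENNReal.one_rpow s, ← ENNReal.ofReal_one]
  exact ENNReal.rpow_le_rpow (ENNReal.ofReal_le_ofReal (one_le_absGauge hk)) hs

end Norms

/-! ### Interpolation of the weighted norms -/

section Interpolation

variable {w φ : ℤ → ℝ≥0∞} {G : ℝ → ℂ} {s r : ℝ}

lemma wn_wpow_mono_exponent (h0 : fc G 0 = 0) (hφ : ∀ k, k ≠ 0 → 1 ≤ φ k) (hrs : r ≤ s) :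
    wn (wpow w φ r) G ≤ wn (wpow w φ s) G := by
  refine ENNReal.tsum_le_tsum fun k => ?_
  by_cases hk : k = 0
  · simp [hk, h0]
  · unfold wpow
    gcongr
    exact hφ k hk

lemma wn_le_wpow (h0 : fc G 0 = 0) (hφ : ∀ k, k ≠ 0 → 1 ≤ φ k) (hs : 0 ≤ s) :
    wn w G ≤ wn (wpow w φ s) G := by
  have : w = wpow w φ 0 := by ext k; simp [wpow]
  conv_lhs => rw [this]
  exact wn_wpow_mono_exponent h0 hφ hs

/-- Rearrangement: the difference of the sides is `(q^s - p^s)(q^r - p^r)`, a product of increments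
of the same sign. For `p ≤ q` both increments are named explicitly, avoiding subtraction in `ℝ≥0∞`.
-/
lemma rpow_mul_add_le (p q : ℝ≥0∞) (hs : 0 ≤ s) (hr : 0 ≤ r) :
    p ^ s * q ^ r + q ^ s * p ^ r ≤ p ^ (r + s) + q ^ (r + s) := by
  rw [ENNReal.rpow_add_of_nonneg _ _ hr hs, ENNReal.rpow_add_of_nonneg _ _ hr hs]
  wlog h : p ≤ q generalizing p q
  · have := this q p (le_of_not_ge h)
    rwa [add_comm, add_comm (p ^ r * _)]
  obtain ⟨c, hc⟩ := exists_add_of_le (ENNReal.rpow_le_rpow h hs)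
  obtain ⟨d, hd⟩ := exists_add_of_le (ENNReal.rpow_le_rpow h hr)
  rw [hc, hd]
  calc _ = p ^ r * p ^ s + p ^ r * p ^ s + d * p ^ s + p ^ r * c := by ring
    _ ≤ p ^ r * p ^ s + p ^ r * p ^ s + d * p ^ s + p ^ r * c + d * c := le_self_add
    _ = _ := by ring

/-- A Chebyshev-type inequality: the symmetrized double sums are compared pair by pair. It replaces
Hölder interpolation and has constant `1`. -/
lemma wn_wpow_mul_le (hs : 0 ≤ s) (hr : 0 ≤ r) :
    wn (wpow w φ s) G * wn (wpow w φ r) G ≤ wn w G * wn (wpow w φ (r + s)) G := by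
  have e : ∀ u v : ℤ → ℝ≥0∞, wn u G * wn v G =
      ∑' p : ℤ × ℤ, (u p.1 * ‖fc G p.1‖ₑ) * (v p.2 * ‖fc G p.2‖ₑ) := by
    intro u v
    rw [ENNReal.tsum_prod', wn, ← ENNReal.tsum_mul_right]
    exact tsum_congr fun j => ENNReal.tsum_mul_left.symm
  have h2 : (2 : ℝ≥0∞) * (wn (wpow w φ s) G * wn (wpow w φ r) G) ≤
      2 * (wn w G * wn (wpow w φ (r + s)) G) := by
    have e1 : (2 : ℝ≥0∞) * (wn (wpow w φ s) G * wn (wpow w φ r) G) =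
        wn (wpow w φ s) G * wn (wpow w φ r) G + wn (wpow w φ r) G * wn (wpow w φ s) G := by ring
    have e2 : (2 : ℝ≥0∞) * (wn w G * wn (wpow w φ (r + s)) G) =
        wn w G * wn (wpow w φ (r + s)) G + wn (wpow w φ (r + s)) G * wn w G := by ring
    rw [e1, e2, e, e, e, e, ← ENNReal.tsum_add, ← ENNReal.tsum_add]
    refine ENNReal.tsum_le_tsum fun p => ?_
    calc _ = w p.1 * ‖fc G p.1‖ₑ * (w p.2 * ‖fc G p.2‖ₑ) *
          (φ p.1 ^ s * φ p.2 ^ r + φ p.2 ^ s * φ p.1 ^ r) := by unfold wpow; ring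
      _ ≤ w p.1 * ‖fc G p.1‖ₑ * (w p.2 * ‖fc G p.2‖ₑ) *
          (φ p.1 ^ (r + s) + φ p.2 ^ (r + s)) := mul_le_mul_right (rpow_mul_add_le _ _ hs hr) _
      _ = _ := by unfold wpow; ring
  exact (ENNReal.mul_le_mul_iff_right (by norm_num) (by norm_num)).1 h2

end Interpolation

/-! ### Derivatives -/

section Deriv

lemma hasDerivAt_mode (k : ℤ) (α : ℝ) :
    HasDerivAt (mode k) (Complex.I * (k : ℂ) * mode k α) α := by
  have h1 : HasDerivAt (fun y : ℝ => Complex.I * (k : ℂ) * (y : ℂ)) (Complex.I * (k : ℂ)) α := by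
    simpa using (Complex.ofRealCLM.hasDerivAt (x := α)).const_mul (Complex.I * (k : ℂ))
  have h2 := h1.cexp
  refine h2.congr_deriv ?_
  rw [mode, mul_comm]

lemma HasExp.hasDerivAt {c : ℤ → ℂ} {G : ℝ → ℂ} (h : HasExp c id G)
    (hs : Summable fun k : ℤ => ‖Complex.I * (k : ℂ) * c k‖) :
    HasExp (fun k : ℤ => Complex.I * (k : ℂ) * c k) id (deriv G) ∧
      ∀ α, HasDerivAt G (deriv G α) α := by
  have key : ∀ α, HasDerivAt G (∑' k : ℤ, Complex.I * (k : ℂ) * c k * mode k α) α := by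
    intro α
    have hd : ∀ (k : ℤ) (y : ℝ), HasDerivAt (fun y => c k * mode k y)
        (Complex.I * (k : ℂ) * c k * mode k y) y := fun k y => by
      refine ((hasDerivAt_mode k y).const_mul (c k)).congr_deriv ?_
      ring
    have := hasDerivAt_tsum hs hd (fun k y => by rw [norm_mul, norm_mode, mul_one])
      (h.hasSum 0).summable α
    rwa [funext h.eq]
  refine ⟨⟨hs, fun α => ?_⟩, fun α => (key α).differentiableAt.hasDerivAt⟩
  rw [(key α).deriv]
  apply Summable.hasSum
  apply Summable.of_norm
  simpa only [norm_mul _ (mode _ _), norm_mode, mul_one] using hs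

lemma deriv_ofReal_comp {f : ℝ → ℝ} (h : ∀ α, HasDerivAt (fun x => (f x : ℂ))
    (deriv (fun x => (f x : ℂ)) α) α) :
    (deriv fun x => (f x : ℂ)) = fun x => ((deriv f x : ℝ) : ℂ) := by
  ext α
  have h1 : HasDerivAt f ((deriv (fun x => (f x : ℂ)) α).re) α := by
    have := Complex.reCLM.hasFDerivAt.comp_hasDerivAt α (h α)
    simpa [Function.comp_def] using this
  rw [h1.ofReal_comp.deriv, h1.deriv]

lemma hasExp_deriv_deriv {f : ℝ → ℝ} (hf : Wiener fun x => (f x : ℂ))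
    (hs : Summable fun k : ℤ => (k : ℝ) ^ 2 * ‖fc (fun x => (f x : ℂ)) k‖) :
    HasExp (fun k : ℤ => -((k : ℂ) ^ 2 * fc (fun x => (f x : ℂ)) k)) id
      (fun x => ((deriv (deriv f) x : ℝ) : ℂ)) := by
  have hs1 : Summable fun k : ℤ => ‖Complex.I * (k : ℂ) * fc (fun x => (f x : ℂ)) k‖ := by
    -- For integers `|k| ≤ k²`, so second-order summability justifies the first derivative as well.
    refine Summable.of_nonneg_of_le (fun _ => norm_nonneg _) (fun k => ?_) hs
    rw [norm_mul, norm_mul, Complex.norm_I, one_mul, Complex.norm_intCast]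
    gcongr
    rw [← Int.cast_abs, ← Int.cast_pow]
    rw [← sq_abs]
    exact_mod_cast Int.le_self_sq |k|
  obtain ⟨h1, h1d⟩ := hf.hasExp.hasDerivAt hs1
  rw [deriv_ofReal_comp h1d] at h1
  have hs2 : Summable fun k : ℤ => ‖Complex.I * (k : ℂ) * (Complex.I * (k : ℂ) *
      fc (fun x => (f x : ℂ)) k)‖ := by
    refine hs.congr fun k => ?_
    simp only [norm_mul, Complex.norm_I, one_mul, Complex.norm_intCast]
    rw [← mul_assoc, ← sq, sq_abs]
  obtain ⟨h2, h2d⟩ := h1.hasDerivAt hs2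
  rw [deriv_ofReal_comp h2d] at h2
  have : (fun k : ℤ => -((k : ℂ) ^ 2 * fc (fun x => (f x : ℂ)) k)) = fun k : ℤ =>
      Complex.I * (k : ℂ) * (Complex.I * (k : ℂ) * fc (fun x => (f x : ℂ)) k) := by
    ext k
    linear_combination (-((k : ℂ) ^ 2 * fc (fun x => (f x : ℂ)) k)) * Complex.I_sq
  rwa [this]

end Deriv

/-! ### The tangent angle -/

section Angle

variable {ν r : ℝ} {ϑ : ℝ → ℝ}

lemma memFdot_wiener (hν : 0 ≤ ν) (hr : 0 < r) (h : MemFdot ν r ϑ) : Wiener fun x => (ϑ x : ℂ) := by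
  obtain ⟨h1, h2, h3⟩ := (memFdot_iff hr).1 h
  exact Wiener.of_wn (Complex.continuous_ofReal.comp h1) (fun x => congrArg _ (h2 x))
    (fun k hk => one_le_wpow_abs hν hr.le hk) h3

lemma memF_wiener (hν : 0 ≤ ν) (h : MemF ν ϑ) : Wiener fun x => (ϑ x : ℂ) := by
  obtain ⟨h1, h2, h3⟩ := memF_iff.1 h
  exact Wiener.of_wn (Complex.continuous_ofReal.comp h1) (fun x => congrArg _ (h2 x))
    (fun k _ => (isWeight_abs hν).one_le_w k) h3

lemma fc_zero_eq (f : ℝ → ℝ) : fc (fun x => (f x : ℂ)) 0 = (mean f : ℂ) := by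
  rw [fc_eq, mean]
  simp only [neg_zero, mode_zero, one_mul]
  rw [intervalIntegral.integral_ofReal]
  push_cast; rfl

lemma fc_const (c : ℂ) (k : ℤ) : fc (fun _ => c) k = if k = 0 then c else 0 := by
  rw [(hasExp_const c).fc_eq, tsum_fintype]
  simp [eq_comm]

lemma theta_ofReal (ϑ : ℝ → ℝ) : (fun x => (theta ϑ x : ℂ)) = fun x => (ϑ x : ℂ) - (mean ϑ : ℂ) := by
  ext x; rw [theta]; push_cast; rfl

lemma wiener_theta (h : Wiener fun x => (ϑ x : ℂ)) : Wiener fun x => (theta ϑ x : ℂ) := by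
  rw [theta_ofReal]
  exact h.sub (hasExp_const _).wiener

lemma fc_theta (h : Wiener fun x => (ϑ x : ℂ)) (k : ℤ) :
    fc (fun x => (theta ϑ x : ℂ)) k = if k = 0 then 0 else fc (fun x => (ϑ x : ℂ)) k := by
  rw [theta_ofReal, fc_sub h.continuous continuous_const, fc_const]
  split_ifs with hk
  · rw [hk, fc_zero_eq, sub_self]
  · rw [sub_zero]

lemma fc_theta_zero (h : Wiener fun x => (ϑ x : ℂ)) : fc (fun x => (theta ϑ x : ℂ)) 0 = 0 := by
  rw [fc_theta h, if_pos rfl]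

lemma wn_theta_le (h : Wiener fun x => (ϑ x : ℂ)) (W : ℤ → ℝ≥0∞) :
    wn W (fun x => (theta ϑ x : ℂ)) ≤ wn W fun x => (ϑ x : ℂ) := by
  refine ENNReal.tsum_le_tsum fun k => ?_
  rw [fc_theta h]
  split_ifs <;> simp

lemma deriv_theta (ϑ : ℝ → ℝ) : deriv (theta ϑ) = deriv ϑ := by
  ext α
  exact deriv_sub_const _

lemma memFdot_theta (hν : 0 ≤ ν) (hr : 0 < r) (h : MemFdot ν r ϑ) : MemFdot ν r (theta ϑ) := by
  have hw := memFdot_wiener hν hr h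
  obtain ⟨h1, h2, h3⟩ := (memFdot_iff hr).1 h
  have hθ := wiener_theta hw
  exact (memFdot_iff hr).2 ⟨continuous_of_ofReal hθ.continuous, periodic_of_ofReal hθ.periodic,
    ne_top_of_le_ne_top h3 (wn_theta_le hw _)⟩

lemma one_le_ofReal_absGauge (k : ℤ) (hk : k ≠ 0) : 1 ≤ ENNReal.ofReal (absGauge k) := by
  rw [← ENNReal.ofReal_one]
  exact ENNReal.ofReal_le_ofReal (one_le_absGauge hk)

lemma wn_eq_ofReal_normFdot (hr : 0 < r) {f : ℝ → ℝ} (h : MemFdot ν r f) :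
    wn (wpow (expWeight ν absGauge) (fun k => ENNReal.ofReal (absGauge k)) r)
      (fun x => (f x : ℂ)) = ENNReal.ofReal (normFdot ν r f) := by
  rw [normFdot_eq ν hr, ENNReal.ofReal_toReal ((memFdot_iff hr).1 h).2.2]

lemma wn_eq_ofReal_normF {f : ℝ → ℝ} (h : MemF ν f) :
    wn (expWeight ν absGauge) (fun x => (f x : ℂ)) = ENNReal.ofReal (normF ν f) := by
  rw [normF_eq, ENNReal.ofReal_toReal (memF_iff.1 h).2.2]

variable {f : ℝ → ℝ} {s : ℝ}

lemma memF_of_memFdot (hr : 0 < r) (h0 : fc (fun x => (f x : ℂ)) 0 = 0)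
    (h : MemFdot ν r f) : MemF ν f := by
  obtain ⟨h1, h2, h3⟩ := (memFdot_iff hr).1 h
  exact memF_iff.2 ⟨h1, h2, ne_top_of_le_ne_top h3 (wn_le_wpow h0 one_le_ofReal_absGauge hr.le)⟩

lemma memFdot_of_le (hs : 0 < s) (hsr : s ≤ r) (h0 : fc (fun x => (f x : ℂ)) 0 = 0)
    (h : MemFdot ν r f) : MemFdot ν s f := by
  obtain ⟨h1, h2, h3⟩ := (memFdot_iff (hs.trans_le hsr)).1 h
  exact (memFdot_iff hs).2 ⟨h1, h2,
    ne_top_of_le_ne_top h3 (wn_wpow_mono_exponent h0 one_le_ofReal_absGauge hsr)⟩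

lemma normF_nonneg (ν : ℝ) (f : ℝ → ℝ) : 0 ≤ normF ν f := by
  rw [normF_eq]; exact ENNReal.toReal_nonneg

lemma normFdot_nonneg (hr : 0 < r) (f : ℝ → ℝ) : 0 ≤ normFdot ν r f := by
  rw [normFdot_eq ν hr]; exact ENNReal.toReal_nonneg

lemma normF_le_normFdot (hr : 0 < r) (h0 : fc (fun x => (f x : ℂ)) 0 = 0) (h : MemFdot ν r f) :
    normF ν f ≤ normFdot ν r f := by
  rw [normF_eq, normFdot_eq ν hr]
  exact ENNReal.toReal_mono ((memFdot_iff hr).1 h).2.2 (wn_le_wpow h0 one_le_ofReal_absGauge hr.le)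

lemma normFdot_mul_le (hs : 0 < s) (h0 : fc (fun x => (f x : ℂ)) 0 = 0)
    (h : MemFdot ν (2 + s) f) :
    normFdot ν s f * normFdot ν 2 f ≤ normF ν f * normFdot ν (2 + s) f := by
  rw [normF_eq, normFdot_eq ν hs, normFdot_eq ν two_pos, normFdot_eq ν (by positivity),
    ← ENNReal.toReal_mul, ← ENNReal.toReal_mul]
  refine ENNReal.toReal_mono (ENNReal.mul_ne_top ?_ ?_) (wn_wpow_mul_le hs.le two_pos.le)
  · exact (memF_iff.1 (memF_of_memFdot (by positivity) h0 h)).2.2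
  · exact ((memFdot_iff (by positivity)).1 h).2.2

lemma absSum_le_normF (hν : 0 ≤ ν) (h : MemF ν f) : absSum (fun x => (f x : ℂ)) ≤ normF ν f := by
  refine Summable.tsum_le_tsum (fun k => ?_) (memF_wiener hν h).summable h.2.2
  exact le_mul_of_one_le_left (norm_nonneg _) (Real.one_le_exp (by positivity))

lemma hasExp_deriv_deriv_of_memFdot (hν : 0 ≤ ν) (h : MemFdot ν 2 f) :
    HasExp (fun k : ℤ => -((k : ℂ) ^ 2 * fc (fun x => (f x : ℂ)) k)) id
      (fun x => ((deriv (deriv f) x : ℝ) : ℂ)) := by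
  refine hasExp_deriv_deriv (memFdot_wiener hν two_pos h) ?_
  refine Summable.of_nonneg_of_le (fun _ => by positivity) (fun k => ?_) h.2.2
  split_ifs with hk
  · simp [hk]
  · rw [mul_assoc, Real.rpow_two, sq_abs]
    exact le_mul_of_one_le_left (by positivity) (Real.one_le_exp (by positivity))

lemma wn_deriv_deriv_le (hν : 0 ≤ ν) (h : MemFdot ν 2 f) (W : ℤ → ℝ≥0∞) :
    wn W (fun x => ((deriv (deriv f) x : ℝ) : ℂ)) ≤
      ∑' k : ℤ, W k * ENNReal.ofReal (absGauge k) ^ (2 : ℝ) * ‖fc (fun x => (f x : ℂ)) k‖ₑ := by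
  refine ((hasExp_deriv_deriv_of_memFdot hν h).wn_le W).trans (le_of_eq (tsum_congr fun k => ?_))
  have : ‖((k : ℂ) ^ 2)‖ₑ = ENNReal.ofReal (absGauge k) ^ (2 : ℝ) := by
    rw [ENNReal.rpow_two, ← ENNReal.ofReal_pow (p := absGauge k) (abs_nonneg _), ← ofReal_norm,
      norm_pow, Complex.norm_intCast]
    rfl
  rw [enorm_neg, enorm_mul, this, id, mul_assoc]

lemma wn_deriv_deriv_le_wpow (hν : 0 ≤ ν) (h : MemFdot ν 2 f) :
    wn (expWeight ν absGauge) (fun x => ((deriv (deriv f) x : ℝ) : ℂ)) ≤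
      ENNReal.ofReal (normFdot ν 2 f) := by
  rw [← wn_eq_ofReal_normFdot two_pos h]
  exact wn_deriv_deriv_le hν h _

lemma wn_wpow_deriv_deriv_le_wpow (hν : 0 ≤ ν) (hs : 0 < s) (h2 : MemFdot ν 2 f)
    (h : MemFdot ν (2 + s) f) :
    wn (wpow (expWeight ν absGauge) (fun k => ENNReal.ofReal (absGauge k)) s)
      (fun x => ((deriv (deriv f) x : ℝ) : ℂ)) ≤ ENNReal.ofReal (normFdot ν (2 + s) f) := by
  rw [← wn_eq_ofReal_normFdot (by positivity) h]
  refine (wn_deriv_deriv_le hν h2 _).trans (le_of_eq (tsum_congr fun k => ?_))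
  rw [wpow, wpow, ENNReal.rpow_add_of_nonneg _ _ two_pos.le hs.le]
  ring

end Angle

/-! ### The parts of the vorticity strength -/

section Parts

variable {Aμ Aρ Aσ L : ℝ} {ϑ ω : ℝ → ℝ}

/-- The gravity part of `ω₁`. -/
def gravLin (Aρ L : ℝ) (ϑ : ℝ → ℝ) (α : ℝ) : ℝ :=
  (Complex.I * gravCoeff Aρ L ϑ * mode 1 α * (theta ϑ α : ℂ)).im

lemma gravLin_eq (α : ℝ) :
    gravLin Aρ L ϑ α = -(Aρ * (L / Real.pi) * Real.cos (α + mean ϑ) * theta ϑ α) := by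
  rw [gravLin, mul_assoc Complex.I, gravCoeff_mul_mode, Complex.im_mul_ofReal,
    mul_left_comm Complex.I, Complex.im_ofReal_mul, Complex.I_mul_im, mul_comm Complex.I,
    Complex.exp_ofReal_mul_I_re]
  ring

lemma omega1_eq (hL : 0 < L) (α : ℝ) : omega1 Aμ Aρ Aσ L ϑ α =
    -Aμ * linOp (theta ϑ) (omega0 Aρ L ϑ) α + Aσ * (4 * Real.pi / L) * deriv (deriv (theta ϑ)) α +
      gravLin Aρ L ϑ α := by
  have hpi := Real.pi_ne_zero
  have hL' := hL.ne'
  rw [omega1, opD1, gravLin_eq, linOp]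
  field_simp
  ring

lemma omegaGe2_eq (hL : 0 < L) (α : ℝ) : omegaGe2 Aμ Aρ L ϑ ω α =
    -Aμ * (linOp (theta ϑ) (fun x => ω x - omega0 Aρ L ϑ x) α + (opS (theta ϑ) ω α).im) +
      gravGe2 Aρ L ϑ α := by
  have hpi := Real.pi_ne_zero
  have hL' := hL.ne'
  rw [omegaGe2, opDge2, gravGe2_eq, linOp, tsum_cos_tail, tsum_sin_tail]
  field_simp
  ring

/-- The implicit equation is expanded by `opD_eq`, and the linear operator is split along `ω = ω₀ +
(ω - ω₀)`. The gravity term splits by the addition formula for the sine. -/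
lemma omega_eq_add (hL : 0 < L) (hθ : Wiener fun x => (theta ϑ x : ℂ))
    (hω : Wiener fun x => (ω x : ℂ)) (h0 : fc (fun x => (ω x : ℂ)) 0 = 0)
    (hsmall : Real.pi / 2 * absSum (expRem 1 fun x => (theta ϑ x : ℂ)) < 1)
    (heq : IsVorticityStrength Aμ Aρ Aσ L ϑ ω) (α : ℝ) :
    ω α = omega0 Aρ L ϑ α + omega1 Aμ Aρ Aσ L ϑ α + omegaGe2 Aμ Aρ L ϑ ω α := by
  have hpi := Real.pi_ne_zero
  have hL' := hL.ne'
  have h := linOp_sub hω h0 (wiener_omega0 (Aρ := Aρ) (L := L) (ϑ := ϑ))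
    (fc_omega0 (by norm_num) (by norm_num)) hθ α
  have hD : opD L ϑ ω α = -Real.pi / L * (linOp (theta ϑ) ω α + (opS (theta ϑ) ω α).im) := by
    rw [opD_eq hθ hω h0 hsmall, linOp]
  have hsin : Real.sin (α + ϑ α) = Real.sin (α + mean ϑ) * Real.cos (theta ϑ α) +
      Real.cos (α + mean ϑ) * Real.sin (theta ϑ α) := by
    rw [← Real.sin_add, theta]; congr 1; ring
  rw [omega1_eq hL, omegaGe2_eq hL, h, gravGe2_eq, gravLin_eq, omega0, heq.equation, hD, hsin,
    deriv_theta]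
  field_simp
  ring

lemma wiener_vorticity (h : IsVorticityStrength Aμ Aρ Aσ L ϑ ω) : Wiener fun x => (ω x : ℂ) :=
  memF_wiener le_rfl h.mem

lemma fc_vorticity_zero (h : IsVorticityStrength Aμ Aρ Aσ L ϑ ω) :
    fc (fun x => (ω x : ℂ)) 0 = 0 := by
  rw [fc_zero_eq, mean, h.mean_zero]; simp

variable {w φ : ℤ → ℝ≥0∞} {s x t : ℝ}

lemma wn_real_const_mul (W : ℤ → ℝ≥0∞) (c : ℝ) (f : ℝ → ℝ) :
    wn W (fun x => ((c * f x : ℝ) : ℂ)) = ENNReal.ofReal |c| * wn W fun x => (f x : ℂ) := by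
  have h : ‖(c : ℂ)‖ₑ = ENNReal.ofReal |c| := by
    rw [← ofReal_norm, Complex.norm_real, Real.norm_eq_abs]
  rw [← h, ← wn_const_mul]
  congr 1; ext x; push_cast; rfl

lemma Wiener.real_const_mul {f : ℝ → ℝ} (h : Wiener fun x => (f x : ℂ)) (c : ℝ) :
    Wiener fun x => ((c * f x : ℝ) : ℂ) := by
  simp only [Complex.ofReal_mul]; exact h.const_mul _

lemma Wiener.real_add {f g : ℝ → ℝ} (hf : Wiener fun x => (f x : ℂ))
    (hg : Wiener fun x => (g x : ℂ)) : Wiener fun x => ((f x + g x : ℝ) : ℂ) := by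
  simp only [Complex.ofReal_add]; exact hf.add hg

lemma Wiener.real_sub {f g : ℝ → ℝ} (hf : Wiener fun x => (f x : ℂ))
    (hg : Wiener fun x => (g x : ℂ)) : Wiener fun x => ((f x - g x : ℝ) : ℂ) := by
  simp only [Complex.ofReal_sub]; exact hf.sub hg

lemma wn_real_add_le (W : ℤ → ℝ≥0∞) {f g : ℝ → ℝ} (hf : Wiener fun x => (f x : ℂ))
    (hg : Wiener fun x => (g x : ℂ)) :
    wn W (fun x => ((f x + g x : ℝ) : ℂ)) ≤ wn W (fun x => (f x : ℂ)) + wn W fun x => (g x : ℂ) := by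
  simp only [Complex.ofReal_add]; exact wn_add_le W hf.continuous hg.continuous

lemma wn_gravLin_le (hθ : Wiener fun x => (theta ϑ x : ℂ)) {W : ℤ → ℝ≥0∞}
    (hW : ∀ k, W (-k) = W k) :
    Wiener (fun α => (gravLin Aρ L ϑ α : ℂ)) ∧ wn W (fun α => (gravLin Aρ L ϑ α : ℂ)) ≤
      convNorm W (fun α => Complex.I * gravCoeff Aρ L ϑ * mode 1 α) fun x => (theta ϑ x : ℂ) := by
  have h1 : Wiener fun α => Complex.I * gravCoeff Aρ L ϑ * mode 1 α :=
    (hasExp_const_mul_mode _ _).wiener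
  have h2 := wn_im_le W hW (h1.mul hθ)
  exact ⟨h2.1, h2.2.trans (wn_mul_le_convNorm W h1 hθ)⟩

lemma wn_I_gravMode_le (hL : 0 < L) (W : ℤ → ℝ≥0∞) :
    wn W (fun α => Complex.I * gravCoeff Aρ L ϑ * mode 1 α) ≤
      ENNReal.ofReal (|Aρ| * (L / Real.pi)) * W 1 := by
  refine (wn_const_mul_mode_le W _ 1).trans (le_of_eq ?_)
  rw [enorm_mul, ← ofReal_norm Complex.I, Complex.norm_I, ENNReal.ofReal_one, one_mul,
    enorm_gravCoeff hL]

lemma wn_omega1_le_aux (hL : 0 < L) (hAσ : 0 < Aσ) (hθ : Wiener fun x => (theta ϑ x : ℂ))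
    (hθ2 : Wiener fun x => ((deriv (deriv (theta ϑ)) x : ℝ) : ℂ)) :
    Wiener (fun x => (omega1 Aμ Aρ Aσ L ϑ x : ℂ)) ∧ ∀ W : ℤ → ℝ≥0∞,
    wn W (fun x => (omega1 Aμ Aρ Aσ L ϑ x : ℂ)) ≤
      ENNReal.ofReal |Aμ| * wn W (fun x => (linOp (theta ϑ) (omega0 Aρ L ϑ) x : ℂ)) +
      ENNReal.ofReal (Aσ * (4 * Real.pi / L)) *
        wn W (fun x => ((deriv (deriv (theta ϑ)) x : ℝ) : ℂ)) +
      wn W fun x => (gravLin Aρ L ϑ x : ℂ) := by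
  have hpi := Real.pi_pos
  have h1 := wiener_linOp (wiener_omega0 (Aρ := Aρ) (L := L) (ϑ := ϑ))
    (fc_omega0 (by norm_num) (by norm_num)) hθ
  have h3 := (wn_gravLin_le (Aρ := Aρ) (L := L) hθ (W := fun _ => 1) fun _ => rfl).1
  simp only [omega1_eq hL]
  refine ⟨((h1.real_const_mul _).real_add (hθ2.real_const_mul _)).real_add h3, fun W => ?_⟩
  refine (wn_real_add_le W ((h1.real_const_mul _).real_add (hθ2.real_const_mul _)) h3).trans ?_
  refine add_le_add ((wn_real_add_le W (h1.real_const_mul _) (hθ2.real_const_mul _)).trans ?_) le_rfl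
  rw [wn_real_const_mul, wn_real_const_mul, abs_neg, abs_of_pos (by positivity : 0 < Aσ * (4 * Real.pi / L))]

lemma wn_omegaGe2_le_aux (hL : 0 < L) (hθ : Wiener fun x => (theta ϑ x : ℂ))
    (hω : Wiener fun x => (ω x : ℂ)) (h0 : fc (fun x => (ω x : ℂ)) 0 = 0)
    (hS : Wiener (opS (theta ϑ) ω)) :
    Wiener (fun x => (omegaGe2 Aμ Aρ L ϑ ω x : ℂ)) ∧ ∀ W : ℤ → ℝ≥0∞, (∀ k, W (-k) = W k) →
    wn W (fun x => (omegaGe2 Aμ Aρ L ϑ ω x : ℂ)) ≤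
      ENNReal.ofReal |Aμ| * (wn W (fun x =>
        (linOp (theta ϑ) (fun x => ω x - omega0 Aρ L ϑ x) x : ℂ)) + wn W (opS (theta ϑ) ω)) +
      wn W fun x => (gravGe2 Aρ L ϑ x : ℂ) := by
  have hω0 := wiener_omega0 (Aρ := Aρ) (L := L) (ϑ := ϑ)
  have hd0 : fc (fun x => ((ω x - omega0 Aρ L ϑ x : ℝ) : ℂ)) 0 = 0 := by
    simp only [Complex.ofReal_sub]
    rw [fc_sub hω.continuous hω0.continuous, h0, fc_omega0 (by norm_num) (by norm_num), sub_zero]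
  have h1 := wiener_linOp (hω.real_sub hω0) hd0 hθ
  have h2 := fun W hW => wn_im_le W hW hS
  have h2' := (h2 (fun _ => 1) fun _ => rfl).1
  have h3 := (wn_gravGe2_le_aux (Aρ := Aρ) (L := L) hθ (W := fun _ => 1) fun _ => rfl).1
  simp only [omegaGe2_eq hL]
  refine ⟨((h1.real_add h2').real_const_mul _).real_add h3, fun W hW => ?_⟩
  refine (wn_real_add_le W ((h1.real_add h2').real_const_mul _) h3).trans ?_
  rw [wn_real_const_mul, abs_neg]
  gcongr
  exact (wn_real_add_le W h1 h2').trans (add_le_add le_rfl (h2 W hW).2)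

end Parts

/-! ### Bounds for `ω₁` -/

lemma C11_eq (s x : ℝ) : C11 s x = C3breve s x + C4breve s x := by
  rw [C11, C3breve, C4breve]
  congr 1 <;> exact tsum_congr fun j => by ring

lemma C3_nonneg (s : ℝ) {x : ℝ} (hx : 0 ≤ x) : 0 ≤ C3 s x := by
  have h1 := C3breve_nonneg s hx
  have h2 := CR_nonneg
  have h3 : 0 ≤ C3tilde s x := tsum_nonneg fun p => by
    have hb := b_nonneg (p.2 + p.1 + 1) s
    have ha := a_nonneg p.1
    have hy := exp_sub_one_nonneg hx
    split_ifs <;> positivity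
  unfold C3; positivity

lemma C4_nonneg (s : ℝ) {x : ℝ} (hx : 0 ≤ x) : 0 ≤ C4 s x := by
  have h1 := C4breve_nonneg s hx
  have h2 := CR_nonneg
  have h3 : 0 ≤ C4tilde s x := tsum_nonneg fun p => by
    have hb := b_nonneg (p.2 + p.1 + 1) s
    have ha := a_nonneg p.1
    have hy := exp_sub_one_nonneg hx
    have hE := expConst_nonneg s hx
    unfold C5tilde
    unfold expConst at hE
    split_ifs <;> positivity
  unfold C4; positivity

lemma C6_nonneg {x : ℝ} : 0 ≤ C6 x := by
  have := Real.add_one_le_exp x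
  exact div_nonneg (by linarith) (sq_nonneg x)

section Omega1

variable {Aμ Aρ Aσ L ν s : ℝ} {ϑ : ℝ → ℝ}

lemma expWeight_one : expWeight ν absGauge 1 = ENNReal.ofReal (Real.exp ν) := by
  simp [expWeight, absGauge]

lemma wpow_expWeight_one :
    wpow (expWeight ν absGauge) (fun k => ENNReal.ofReal (absGauge k)) s 1 =
      ENNReal.ofReal (Real.exp ν) := by
  simp [wpow, expWeight, absGauge]

/-- The coefficient `1 + 2|A_μ|` collects `1` from the linear gravity term and `|A_μ|` twice, from
`θ𝓗ω₀` and from `ℛ(ω₀)` with the sharp multiplier constant. -/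
lemma wn_omega1_le (hν : 0 ≤ ν) (hL : 0 < L) (hAσ : 0 < Aσ) (hϑ : MemFdot ν 2 ϑ) :
    Wiener (fun x => (omega1 Aμ Aρ Aσ L ϑ x : ℂ)) ∧
    wn (expWeight ν absGauge) (fun x => (omega1 Aμ Aρ Aσ L ϑ x : ℂ)) ≤
      ENNReal.ofReal (Aσ * (4 * Real.pi / L) * normFdot ν 2 (theta ϑ) +
        (1 + 2 * |Aμ|) * |Aρ| * (L / Real.pi) * Real.exp ν * normF ν (theta ϑ)) := by
  have hpi := Real.pi_pos
  have hw := isWeight_abs hν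
  have hθ := wiener_theta (memFdot_wiener hν two_pos hϑ)
  have hθ0 := fc_theta_zero (memFdot_wiener hν two_pos hϑ)
  have hθm := memFdot_theta hν two_pos hϑ
  have hθx := (wn_eq_ofReal_normF (memF_of_memFdot two_pos hθ0 hθm)).le
  have hx := normF_nonneg ν (theta ϑ)
  have hT := normFdot_nonneg (ν := ν) two_pos (theta ϑ)
  obtain ⟨h1, h2⟩ := wn_omega1_le_aux (Aμ := Aμ) (Aρ := Aρ) hL hAσ hθ
    (hasExp_deriv_deriv_of_memFdot hν hθm).wiener
  refine ⟨h1, (h2 _).trans ?_⟩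
  have hlin := wn_linOp_le hw (wiener_omega0 (Aρ := Aρ) (L := L) (ϑ := ϑ))
    (fc_omega0 (by norm_num) (by norm_num)) hθ zero_le_one norm_mult_omega0_le hθx
  have hω0 := wn_omega0_le (Aρ := Aρ) (ϑ := ϑ) hL hw.w_neg
  have hg := (wn_gravLin_le (Aρ := Aρ) (L := L) hθ hw.w_neg).2.trans (convNorm_w_le hw _ _)
  have hm := wn_I_gravMode_le (Aρ := Aρ) (ϑ := ϑ) hL (expWeight ν absGauge)
  rw [expWeight_one] at hω0 hm
  have hd := wn_deriv_deriv_le_wpow hν hθm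
  calc _ ≤ ENNReal.ofReal |Aμ| * (ENNReal.ofReal ((1 + 1) * normF ν (theta ϑ)) *
          (ENNReal.ofReal (|Aρ| * (L / Real.pi)) * ENNReal.ofReal (Real.exp ν))) +
        ENNReal.ofReal (Aσ * (4 * Real.pi / L)) * ENNReal.ofReal (normFdot ν 2 (theta ϑ)) +
        (ENNReal.ofReal (|Aρ| * (L / Real.pi)) * ENNReal.ofReal (Real.exp ν)) *
          ENNReal.ofReal (normF ν (theta ϑ)) := by
        refine add_le_add (add_le_add ?_ ?_) (hg.trans (mul_le_mul' hm hθx))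
        · exact mul_le_mul_right (hlin.trans (mul_le_mul_right hω0 _)) _
        · exact mul_le_mul_right hd _
    _ = _ := by
        simp (disch := positivity) only [← ENNReal.ofReal_mul, ← ENNReal.ofReal_add]
        congr 1; ring

lemma wn_wpow_omega1_le (hν : 0 ≤ ν) (hL : 0 < L) (hAσ : 0 < Aσ) (hs : 0 < s)
    (hϑ : MemFdot ν 2 ϑ) (hϑs : MemFdot ν (2 + s) ϑ) :
    wn (wpow (expWeight ν absGauge) (fun k => ENNReal.ofReal (absGauge k)) s)
      (fun x => (omega1 Aμ Aρ Aσ L ϑ x : ℂ)) ≤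
      ENNReal.ofReal (Aσ * (4 * Real.pi / L) * normFdot ν (2 + s) (theta ϑ) +
        (1 + 2 * |Aμ|) * |Aρ| * (L / Real.pi) * (2 * b 2 s) * Real.exp ν *
          normFdot ν s (theta ϑ)) := by
  have hpi := Real.pi_pos
  have hb := b_nonneg 2 s
  have h2s : 0 < 2 + s := by positivity
  have hw := isWeight_abs hν
  have hθ := wiener_theta (memFdot_wiener hν two_pos hϑ)
  have hθ0 := fc_theta_zero (memFdot_wiener hν two_pos hϑ)
  have hθm := memFdot_theta hν two_pos hϑ
  have hθms := memFdot_theta hν h2s hϑs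
  have hθs := memFdot_of_le hs (by linarith) hθ0 hθms
  have hxt := normF_le_normFdot hs hθ0 hθs
  have hθt := (wn_eq_ofReal_normFdot hs hθs).le
  -- Since `θ` has mean zero, its norm of order `0` is bounded by that of order `s`. Both summands
  -- of each product estimate are then equal, which gives the factor `2 b(2,s)`.
  have hθx := (wn_eq_ofReal_normF (memF_of_memFdot two_pos hθ0 hθm)).le.trans
    (ENNReal.ofReal_le_ofReal hxt)
  have ht := normFdot_nonneg (ν := ν) hs (theta ϑ)
  have hT := normFdot_nonneg (ν := ν) h2s (theta ϑ)
  obtain ⟨-, h2⟩ := wn_omega1_le_aux (Aμ := Aμ) (Aρ := Aρ) hL hAσ hθ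
    (hasExp_deriv_deriv_of_memFdot hν hθm).wiener
  refine (h2 _).trans ?_
  have hlin := wn_wpow_linOp_le hw hs (wiener_omega0 (Aρ := Aρ) (L := L) (ϑ := ϑ))
    (fc_omega0 (by norm_num) (by norm_num)) hθ zero_le_one norm_mult_omega0_le hθx hθt
  have hω0 := wn_omega0_le (Aρ := Aρ) (ϑ := ϑ) hL hw.w_neg
  have hω0s := wn_omega0_le (Aρ := Aρ) (ϑ := ϑ) hL (hw.wpow_neg s)
  have hg := (wn_gravLin_le (Aρ := Aρ) (L := L) hθ (hw.wpow_neg s)).2.trans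
    (convNorm_wpow_le hw hs _ _)
  have hm := wn_I_gravMode_le (Aρ := Aρ) (ϑ := ϑ) hL (expWeight ν absGauge)
  have hms := wn_I_gravMode_le (Aρ := Aρ) (ϑ := ϑ) hL
    (wpow (expWeight ν absGauge) (fun k => ENNReal.ofReal (absGauge k)) s)
  rw [expWeight_one] at hω0 hm
  rw [wpow_expWeight_one] at hω0s hms
  have hd := wn_wpow_deriv_deriv_le_wpow hν hs hθm hθms
  calc _ ≤ ENNReal.ofReal |Aμ| * (ENNReal.ofReal (b 2 s * (1 + 1) * normFdot ν s (theta ϑ)) *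
          (ENNReal.ofReal (|Aρ| * (L / Real.pi)) * ENNReal.ofReal (Real.exp ν)) +
          ENNReal.ofReal (b 2 s * (1 + 1) * normFdot ν s (theta ϑ)) *
          (ENNReal.ofReal (|Aρ| * (L / Real.pi)) * ENNReal.ofReal (Real.exp ν))) +
        ENNReal.ofReal (Aσ * (4 * Real.pi / L)) * ENNReal.ofReal (normFdot ν (2 + s) (theta ϑ)) +
        ENNReal.ofReal (b 2 s) * ((ENNReal.ofReal (|Aρ| * (L / Real.pi)) *
          ENNReal.ofReal (Real.exp ν)) * ENNReal.ofReal (normFdot ν s (theta ϑ)) +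
          (ENNReal.ofReal (|Aρ| * (L / Real.pi)) *
          ENNReal.ofReal (Real.exp ν)) * ENNReal.ofReal (normFdot ν s (theta ϑ))) := by
        refine add_le_add (add_le_add ?_ ?_) (hg.trans (mul_le_mul_right
          (add_le_add (mul_le_mul' hm hθt) (mul_le_mul' hms hθx)) _))
        · exact mul_le_mul_right (hlin.trans (add_le_add (mul_le_mul_right hω0s _)
            (mul_le_mul_right hω0 _))) _
        · exact mul_le_mul_right hd _
    _ = _ := by
        simp (disch := positivity) only [← ENNReal.ofReal_mul, ← ENNReal.ofReal_add]
        congr 1; ring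

end Omega1

/-! ### Absorption -/

/-- Finiteness of `X` is essential: the assumed inequality holds trivially for `X = ∞` when `q > 0`.
-/
lemma le_ofReal_of_absorb {X : ℝ≥0∞} {A q : ℝ} (hX : X ≠ ∞) (hA : 0 ≤ A) (hq : 0 ≤ q) (hq1 : q < 1)
    (h : X ≤ ENNReal.ofReal A + ENNReal.ofReal q * X) : X ≤ ENNReal.ofReal (A / (1 - q)) := by
  lift X to NNReal using hX
  lift A to NNReal using hA
  lift q to NNReal using hq
  rw [ENNReal.ofReal_coe_nnreal, ENNReal.ofReal_coe_nnreal] at h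
  have h' : (X : ℝ) ≤ A + q * X := by exact_mod_cast h
  rw [← ENNReal.ofReal_coe_nnreal]
  refine ENNReal.ofReal_le_ofReal ?_
  rw [le_div_iff₀ (by linarith)]
  linarith

/-! ### Bounds for `ω_{≥2}` -/

section OmegaGe2

variable {Aμ Aρ Aσ L ν s : ℝ} {ϑ ω : ℝ → ℝ} {w φ : ℤ → ℝ≥0∞} {x t N₀ N₁ : ℝ}

lemma fc_omega_sub_omega0 (h : Wiener fun x => (ω x : ℂ)) (h0 : fc (fun x => (ω x : ℂ)) 0 = 0) :
    fc (fun x => ((ω x - omega0 Aρ L ϑ x : ℝ) : ℂ)) 0 = 0 := by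
  have hω0 := wiener_omega0 (Aρ := Aρ) (L := L) (ϑ := ϑ)
  simp only [Complex.ofReal_sub]
  rw [fc_sub h.continuous hω0.continuous, h0, fc_omega0 (by norm_num) (by norm_num), sub_zero]

lemma wn_split_le (hω0 : Wiener fun x => (omega0 Aρ L ϑ x : ℂ))
    (h1 : Wiener fun x => (omega1 Aμ Aρ Aσ L ϑ x : ℂ))
    (h2 : Wiener fun x => (omegaGe2 Aμ Aρ L ϑ ω x : ℂ))
    (hsplit : ∀ α, ω α = omega0 Aρ L ϑ α + omega1 Aμ Aρ Aσ L ϑ α + omegaGe2 Aμ Aρ L ϑ ω α)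
    (W : ℤ → ℝ≥0∞) :
    wn W (fun x => ((ω x - omega0 Aρ L ϑ x : ℝ) : ℂ)) ≤
      wn W (fun x => (omega1 Aμ Aρ Aσ L ϑ x : ℂ)) + wn W (fun x => (omegaGe2 Aμ Aρ L ϑ ω x : ℂ)) ∧
    wn W (fun x => (ω x : ℂ)) ≤ wn W (fun x => (omega0 Aρ L ϑ x : ℂ)) +
      (wn W (fun x => (omega1 Aμ Aρ Aσ L ϑ x : ℂ)) +
        wn W (fun x => (omegaGe2 Aμ Aρ L ϑ ω x : ℂ))) := by
  have e1 : (fun x => ((ω x - omega0 Aρ L ϑ x : ℝ) : ℂ)) =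
      fun x => ((omega1 Aμ Aρ Aσ L ϑ x + omegaGe2 Aμ Aρ L ϑ ω x : ℝ) : ℂ) := by
    ext x
    congr 1
    linarith [hsplit x]
  have e2 : (fun x => (ω x : ℂ)) = fun x => ((omega0 Aρ L ϑ x +
      (omega1 Aμ Aρ Aσ L ϑ x + omegaGe2 Aμ Aρ L ϑ ω x) : ℝ) : ℂ) := by
    ext x
    congr 1
    linarith [hsplit x]
  have k := wn_real_add_le W h1 h2
  refine ⟨by rwa [e1], ?_⟩
  conv_lhs => rw [e2]
  exact (wn_real_add_le W hω0 (h1.real_add h2)).trans (add_le_add le_rfl k)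

/-- Let `X` be the norm of `ω_{≥2}`. The linear operator acts on `ω₁ + ω_{≥2}` and `𝒮` on all of
`ω`, so the bracket multiplying `|A_μ|` is `C₇x(N₁ + X) + C₁x²N₀`, and the term in `X` is absorbed.
-/
lemma wn_omegaGe2_le (hL : 0 < L) (hw : IsWeight w φ) (hθ : Wiener fun x => (theta ϑ x : ℂ))
    (hω : Wiener fun x => (ω x : ℂ)) (h0 : fc (fun x => (ω x : ℂ)) 0 = 0)
    (h1 : Wiener fun x => (omega1 Aμ Aρ Aσ L ϑ x : ℂ))
    (hsplit : ∀ α, ω α = omega0 Aρ L ϑ α + omega1 Aμ Aρ Aσ L ϑ α + omegaGe2 Aμ Aρ L ϑ ω α)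
    (hx : 0 ≤ x) (hsmall : Real.pi / 2 * (Real.exp x - 1) < 1)
    (hθx : wn w (fun x => (theta ϑ x : ℂ)) ≤ ENNReal.ofReal x)
    (hωw : wn w (fun x => (ω x : ℂ)) ≠ ∞)
    (hN₀ : 0 ≤ N₀) (hN₁ : 0 ≤ N₁)
    (hM : ENNReal.ofReal (|Aρ| * (L / Real.pi)) * w 1 ≤ ENNReal.ofReal N₀)
    (h1w : wn w (fun x => (omega1 Aμ Aρ Aσ L ϑ x : ℂ)) ≤ ENNReal.ofReal N₁)
    (h7 : |Aμ| * C7 x * x < 1) :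
    Wiener (fun x => (omegaGe2 Aμ Aρ L ϑ ω x : ℂ)) ∧
    wn w (fun x => (omegaGe2 Aμ Aρ L ϑ ω x : ℂ)) ≤ ENNReal.ofReal
      ((|Aμ| * (C7 x * x * N₁ + C1 x * x ^ 2 * N₀) + C6 x * x ^ 2 * N₀) /
        (1 - |Aμ| * C7 x * x)) := by
  have hCR := CR_nonneg
  have hω0 := wiener_omega0 (Aρ := Aρ) (L := L) (ϑ := ϑ)
  have hC3 := C3_nonneg 1 hx
  have hC6 := C6_nonneg (x := x)
  have hC1 : C1 x * x ^ 2 = C3 1 x * x ^ 2 := C1_mul_sq hx hsmall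
  have hC7 : C7 x * x = (1 + CR) * x + C3 1 x * x ^ 2 := by rw [← hC1, C7]; ring
  obtain ⟨hS, hSw⟩ := wn_opS_le hw hω hθ hx hsmall hθx hωw
  obtain ⟨hg, hgw⟩ := wn_omegaGe2_le_aux (Aμ := Aμ) (Aρ := Aρ) hL hθ hω h0 hS
  obtain ⟨s1, s2⟩ := wn_split_le hω0 h1 hg hsplit w
  have hlin := wn_linOp_le hw (hω.real_sub hω0) (fc_omega_sub_omega0 hω h0) hθ hCR
    (fun j _ => norm_mult_le_CR j) hθx
  have hω0w := (wn_omega0_le (Aρ := Aρ) (ϑ := ϑ) hL hw.w_neg).trans hM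
  have hgr := (wn_gravGe2_le (Aρ := Aρ) (ϑ := ϑ) hL hw hθ hx hθx).trans (mul_le_mul_right hM _)
  -- Absorption requires this; it follows by writing `ω_{≥2} = ω - ω₀ - ω₁` with three finite norms.
  have hfin : wn w (fun x => (omegaGe2 Aμ Aρ L ϑ ω x : ℂ)) ≠ ∞ := by
    have e : (fun x => (omegaGe2 Aμ Aρ L ϑ ω x : ℂ)) = fun x =>
        ((ω x + -1 * (omega0 Aρ L ϑ x + omega1 Aμ Aρ Aσ L ϑ x) : ℝ) : ℂ) := by
      ext x
      congr 1
      linarith [hsplit x]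
    rw [e]
    refine ne_top_of_le_ne_top ?_ (wn_real_add_le w hω ((hω0.real_add h1).real_const_mul (-1)))
    rw [wn_real_const_mul]
    refine ENNReal.add_ne_top.2 ⟨hωw, ENNReal.mul_ne_top ENNReal.ofReal_ne_top ?_⟩
    exact ne_top_of_le_ne_top (ENNReal.add_ne_top.2 ⟨ENNReal.ofReal_ne_top, ENNReal.ofReal_ne_top⟩)
      ((wn_real_add_le w hω0 h1).trans (add_le_add hω0w h1w))
  refine ⟨hg, ?_⟩
  have key := (hgw w hw.w_neg).trans (add_le_add (mul_le_mul_right (add_le_add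
    (hlin.trans (mul_le_mul_right (s1.trans (add_le_add h1w le_rfl)) _))
    (hSw.trans (mul_le_mul_right (s2.trans (add_le_add hω0w (add_le_add h1w le_rfl))) _))) _) hgr)
  generalize wn w (fun x => (omegaGe2 Aμ Aρ L ϑ ω x : ℂ)) = X at *
  have hAa := abs_nonneg Aμ
  rw [hC1, mul_assoc |Aμ|, hC7]
  rw [mul_assoc, hC7] at h7
  refine le_ofReal_of_absorb hfin (by positivity) (by positivity) h7 (key.trans (le_of_eq ?_))
  have e1 : |Aμ| * (((1 + CR) * x + C3 1 x * x ^ 2) * N₁ + C3 1 x * x ^ 2 * N₀) + C6 x * x ^ 2 * N₀ =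
      |Aμ| * ((1 + CR) * x * N₁ + C3 1 x * x ^ 2 * (N₀ + N₁)) + C6 x * x ^ 2 * N₀ := by ring
  rw [e1]
  simp (disch := positivity) only [ENNReal.ofReal_mul, ENNReal.ofReal_add]
  ring

/-- The same absorption in order `s`. Whenever the `s`-weight falls on `θ`, the norm of `ω_{≥2}` of
order `0` appears; its bound `N₂` is an input, so only the coefficient `C₂x` has to be absorbed. -/
lemma wn_wpow_omegaGe2_le {N₂ N₁s : ℝ} (hL : 0 < L) (hw : IsWeight w φ) (hs : 0 < s)
    (hθ : Wiener fun x => (theta ϑ x : ℂ))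
    (hω : Wiener fun x => (ω x : ℂ)) (h0 : fc (fun x => (ω x : ℂ)) 0 = 0)
    (h1 : Wiener fun x => (omega1 Aμ Aρ Aσ L ϑ x : ℂ))
    (hsplit : ∀ α, ω α = omega0 Aρ L ϑ α + omega1 Aμ Aρ Aσ L ϑ α + omegaGe2 Aμ Aρ L ϑ ω α)
    (hx : 0 ≤ x) (ht : 0 ≤ t) (hsmall : Real.pi / 2 * (Real.exp x - 1) < 1)
    (hθx : wn w (fun x => (theta ϑ x : ℂ)) ≤ ENNReal.ofReal x)
    (hθt : wn (wpow w φ s) (fun x => (theta ϑ x : ℂ)) ≤ ENNReal.ofReal t)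
    (hωw : wn w (fun x => (ω x : ℂ)) ≠ ∞) (hωs : wn (wpow w φ s) (fun x => (ω x : ℂ)) ≠ ∞)
    (hN₀ : 0 ≤ N₀) (hN₁ : 0 ≤ N₁) (hN₁s : 0 ≤ N₁s) (hN₂ : 0 ≤ N₂)
    (hM : ENNReal.ofReal (|Aρ| * (L / Real.pi)) * w 1 ≤ ENNReal.ofReal N₀)
    (hMs : ENNReal.ofReal (|Aρ| * (L / Real.pi)) * wpow w φ s 1 ≤ ENNReal.ofReal N₀)
    (h1w : wn w (fun x => (omega1 Aμ Aρ Aσ L ϑ x : ℂ)) ≤ ENNReal.ofReal N₁)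
    (h1s : wn (wpow w φ s) (fun x => (omega1 Aμ Aρ Aσ L ϑ x : ℂ)) ≤ ENNReal.ofReal N₁s)
    (h2w : wn w (fun x => (omegaGe2 Aμ Aρ L ϑ ω x : ℂ)) ≤ ENNReal.ofReal N₂)
    (h2 : |Aμ| * C2 s x * x < 1) :
    wn (wpow w φ s) (fun x => (omegaGe2 Aμ Aρ L ϑ ω x : ℂ)) ≤ ENNReal.ofReal
      ((|Aμ| * (C2 s x * x * N₁s + C3 s x * x ^ 2 * N₀ + C12 s x * t * (N₁ + N₂) +
          C4 s x * x * t * N₀) + (C3breve s x * x ^ 2 + C4breve s x * (x * t)) * N₀) /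
        (1 - |Aμ| * C2 s x * x)) := by
  have hCR := CR_nonneg
  have hb := b_nonneg 2 s
  have hω0 := wiener_omega0 (Aρ := Aρ) (L := L) (ϑ := ϑ)
  have hC3 := C3_nonneg s hx
  have hC4 := C4_nonneg s hx
  have hb3 := C3breve_nonneg s hx
  have hb4 := C4breve_nonneg s hx
  have hC2 : C2 s x * x = b 2 s * (1 + CR) * x + C3 s x * x ^ 2 := by rw [C2]; ring
  have hC12 : C12 s x * t = b 2 s * (1 + CR) * t + C4 s x * x * t := by rw [C12]; ring
  obtain ⟨hS, -⟩ := wn_opS_le hw hω hθ hx hsmall hθx hωw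
  have hSs := wn_wpow_opS_le hw hs hω hθ hx ht hsmall hθx hθt hωw
  obtain ⟨hg, hgw⟩ := wn_omegaGe2_le_aux (Aμ := Aμ) (Aρ := Aρ) hL hθ hω h0 hS
  obtain ⟨s1, s2⟩ := wn_split_le hω0 h1 hg hsplit w
  obtain ⟨s1s, s2s⟩ := wn_split_le hω0 h1 hg hsplit (wpow w φ s)
  have hlin := wn_wpow_linOp_le hw hs (hω.real_sub hω0) (fc_omega_sub_omega0 hω h0) hθ hCR
    (fun j _ => norm_mult_le_CR j) hθx hθt
  have hω0w := (wn_omega0_le (Aρ := Aρ) (ϑ := ϑ) hL hw.w_neg).trans hM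
  have hω0s := (wn_omega0_le (Aρ := Aρ) (ϑ := ϑ) hL (hw.wpow_neg s)).trans hMs
  have hgr := (wn_wpow_gravGe2_le (Aρ := Aρ) (ϑ := ϑ) hL hw hs hθ hx ht hθx hθt).trans
    (add_le_add (mul_le_mul_right hMs _) (mul_le_mul_right hM _))
  have hfin : wn (wpow w φ s) (fun x => (omegaGe2 Aμ Aρ L ϑ ω x : ℂ)) ≠ ∞ := by
    have e : (fun x => (omegaGe2 Aμ Aρ L ϑ ω x : ℂ)) = fun x =>
        ((ω x + -1 * (omega0 Aρ L ϑ x + omega1 Aμ Aρ Aσ L ϑ x) : ℝ) : ℂ) := by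
      ext x
      congr 1
      linarith [hsplit x]
    rw [e]
    refine ne_top_of_le_ne_top ?_ (wn_real_add_le _ hω ((hω0.real_add h1).real_const_mul (-1)))
    rw [wn_real_const_mul]
    refine ENNReal.add_ne_top.2 ⟨hωs, ENNReal.mul_ne_top ENNReal.ofReal_ne_top ?_⟩
    exact ne_top_of_le_ne_top (ENNReal.add_ne_top.2 ⟨ENNReal.ofReal_ne_top, ENNReal.ofReal_ne_top⟩)
      ((wn_real_add_le _ hω0 h1).trans (add_le_add hω0s h1s))
  have key := (hgw _ (hw.wpow_neg s)).trans (add_le_add (mul_le_mul_right (add_le_add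
    (hlin.trans (add_le_add (mul_le_mul_right (s1s.trans (add_le_add h1s le_rfl)) _)
      (mul_le_mul_right (s1.trans (add_le_add h1w h2w)) _)))
    (hSs.trans (add_le_add
      (mul_le_mul_right (s2s.trans (add_le_add hω0s (add_le_add h1s le_rfl))) _)
      (mul_le_mul_right (s2.trans (add_le_add hω0w (add_le_add h1w h2w))) _)))) _) hgr)
  generalize wn (wpow w φ s) (fun x => (omegaGe2 Aμ Aρ L ϑ ω x : ℂ)) = X at *
  have hAa := abs_nonneg Aμ
  rw [mul_assoc |Aμ|, hC2, hC12]
  rw [mul_assoc, hC2] at h2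
  refine le_ofReal_of_absorb hfin (by positivity) (by positivity) h2 (key.trans (le_of_eq ?_))
  simp (disch := positivity) only [ENNReal.ofReal_mul, ENNReal.ofReal_add]
  ring

end OmegaGe2

/-! ### The nonlinear part of a vorticity strength -/

lemma C7_mul_eq {x : ℝ} (hx : 0 ≤ x) (h : Real.pi / 2 * (Real.exp x - 1) < 1) :
    C7 x * x = (1 + CR) * x + C3 1 x * x ^ 2 := by
  rw [← C1_mul_sq hx h, C7]; ring

/-- Consequently the smallness condition in order `s` implies the one in order `0`, whose estimate
is needed first. -/
lemma C7_mul_le_C2_mul {s x : ℝ} (hx : 0 ≤ x) (h : Real.pi / 2 * (Real.exp x - 1) < 1) :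
    C7 x * x ≤ C2 s x * x := by
  have h1 : 1 ≤ b 2 s := one_le_b (by norm_num) s
  have h2 := CR_nonneg
  have h3 := C3_mono (s := s) hx h
  have h4 : (1 + CR) * x ≤ b 2 s * ((1 + CR) * x) := le_mul_of_one_le_left (by positivity) h1
  rw [C7_mul_eq hx h, C2]
  linarith

lemma C12_nonneg (s : ℝ) {x : ℝ} (hx : 0 ≤ x) : 0 ≤ C12 s x := by
  have h1 := b_nonneg 2 s
  have h2 := CR_nonneg
  have h3 := C4_nonneg s hx
  unfold C12; positivity

section Vorticity

variable {Aμ Aρ Aσ L ν s x : ℝ} {ϑ ω : ℝ → ℝ}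

lemma omega_splitting (hν : 0 ≤ ν) (hL : 0 < L) (hϑ : MemFdot ν 2 ϑ)
    (hω : IsVorticityStrength Aμ Aρ Aσ L ϑ ω)
    (hsmall : Real.pi / 2 * (Real.exp (normF ν (theta ϑ)) - 1) < 1) (α : ℝ) :
    ω α = omega0 Aρ L ϑ α + omega1 Aμ Aρ Aσ L ϑ α + omegaGe2 Aμ Aρ L ϑ ω α := by
  have hpi := Real.pi_pos
  have hθ := wiener_theta (memFdot_wiener hν two_pos hϑ)
  have hθm := memF_of_memFdot two_pos (fc_theta_zero (memFdot_wiener hν two_pos hϑ))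
    (memFdot_theta hν two_pos hϑ)
  refine omega_eq_add hL hθ (wiener_vorticity hω) (fc_vorticity_zero hω) ?_ hω α
  refine lt_of_le_of_lt ?_ hsmall
  gcongr
  refine (absSum_expRem_one_le hθ).trans ?_
  gcongr
  exact absSum_le_normF hν hθm

lemma omega1_bound_nonneg (hL : 0 < L) (hAσ : 0 < Aσ) :
    0 ≤ Aσ * (4 * Real.pi / L) * normFdot ν 2 (theta ϑ) +
        (1 + 2 * |Aμ|) * |Aρ| * (L / Real.pi) * Real.exp ν * normF ν (theta ϑ) := by
  have hpi := Real.pi_pos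
  have hx := normF_nonneg ν (theta ϑ)
  have hT := normFdot_nonneg (ν := ν) two_pos (theta ϑ)
  positivity

lemma expWeight_trunc_one {N : ℕ} (hN : 1 ≤ N) :
    expWeight ν (truncGauge N) 1 = ENNReal.ofReal (Real.exp ν) := by
  rw [expWeight, truncGauge_one hN, mul_one]

lemma wpow_trunc_one {N : ℕ} (hN : 1 ≤ N) :
    wpow (expWeight ν (truncGauge N)) (fun k => ENNReal.ofReal (truncGauge N k)) s 1 =
      ENNReal.ofReal (Real.exp ν) := by
  rw [wpow, expWeight_trunc_one hN, truncGauge_one hN]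
  simp

/-- The bound for `ω_{≥2}` in `F^{0,1}_ν`. -/
lemma memF_omegaGe2 (hν : 0 ≤ ν) (hL : 0 < L) (hAσ : 0 < Aσ) (hϑ : MemFdot ν 2 ϑ)
    (hω : IsVorticityStrength Aμ Aρ Aσ L ϑ ω) (hx : x = normF ν (theta ϑ))
    (hsmall : Real.pi / 2 * (Real.exp x - 1) < 1) (h7 : |Aμ| * C7 x * x < 1) :
    (Wiener fun y => (omegaGe2 Aμ Aρ L ϑ ω y : ℂ)) ∧
    MemF ν (omegaGe2 Aμ Aρ L ϑ ω) ∧ normF ν (omegaGe2 Aμ Aρ L ϑ ω) ≤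
      |Aμ| * Aσ * (4 * Real.pi / L) * C9 Aμ x * x * normFdot ν 2 (theta ϑ)
        + |Aρ| * (L / Real.pi) * Real.exp ν * C10 Aμ x * x ^ 2 := by
  have hpi := Real.pi_pos
  have hx0 : 0 ≤ x := hx ▸ normF_nonneg ν (theta ϑ)
  have hϑw := memFdot_wiener hν two_pos hϑ
  have hθ := wiener_theta hϑw
  have hθm := memF_of_memFdot two_pos (fc_theta_zero hϑw) (memFdot_theta hν two_pos hϑ)
  have hωw := wiener_vorticity hω
  have hsplit := omega_splitting hν hL hϑ hω (hx ▸ hsmall)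
  obtain ⟨h1, h1w⟩ := wn_omega1_le (Aμ := Aμ) (Aρ := Aρ) hν hL hAσ hϑ
  have hN₀ : 0 ≤ |Aρ| * (L / Real.pi) * Real.exp ν := by positivity
  have hN₁ := omega1_bound_nonneg (Aμ := Aμ) (Aρ := Aρ) (ν := ν) (ϑ := ϑ) hL hAσ
  -- Absorption at truncation level `N`. The restriction `N ≥ 1` leaves the weight at frequency `1`,
  -- and hence the factor `e^ν` of the gravity terms, unchanged.
  have key : ∀ N : ℕ, 1 ≤ N → _ := fun N hN =>
    wn_omegaGe2_le (N₀ := |Aρ| * (L / Real.pi) * Real.exp ν) hL (isWeight_trunc hν N) hθ hωw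
      (fc_vorticity_zero hω) h1 hsplit hx0 hsmall
      ((wn_mono (expWeight_mono hν (truncGauge_le N))).trans
        ((wn_eq_ofReal_normF hθm).le.trans (by rw [hx])))
      (wn_trunc_ne_top hν hωw N) hN₀ hN₁
      (by rw [expWeight_trunc_one hN, ← ENNReal.ofReal_mul (by positivity)])
      ((wn_mono (expWeight_mono hν (truncGauge_le N))).trans h1w) h7
  have hW := (key 1 le_rfl).1
  have hlim := wn_le_of_eventually (W := expWeight ν absGauge)
    (V := fun N => expWeight ν (truncGauge N))
    (fun k => (eventually_truncGauge k).mono fun N hN => by rw [expWeight, expWeight, hN])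
    ((eventually_ge_atTop 1).mono fun N hN => (key N hN).2)
  have hD : 0 < 1 - |Aμ| * C7 x * x := by linarith
  have hB : 0 ≤ (|Aμ| * (C7 x * x * (Aσ * (4 * Real.pi / L) * normFdot ν 2 (theta ϑ) +
        (1 + 2 * |Aμ|) * |Aρ| * (L / Real.pi) * Real.exp ν * normF ν (theta ϑ)) +
        C1 x * x ^ 2 * (|Aρ| * (L / Real.pi) * Real.exp ν)) +
        C6 x * x ^ 2 * (|Aρ| * (L / Real.pi) * Real.exp ν)) / (1 - |Aμ| * C7 x * x) := by
    have h3 := C3_nonneg 1 hx0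
    have hCR := CR_nonneg
    have h6 := C6_nonneg (x := x)
    rw [C1_mul_sq hx0 hsmall]
    refine div_nonneg ?_ hD.le
    rw [C7_mul_eq hx0 hsmall]
    positivity
  refine ⟨hW, ?_⟩
  obtain ⟨r1, r2⟩ := memF_and_norm_le hW hB hlim
  refine ⟨r1, r2.trans (le_of_eq ?_)⟩
  rw [C10, C9, C8, ← hx]
  ring

/-- The bound for `ω_{≥2}` in the homogeneous space of order `s`. -/
lemma memFdot_omegaGe2 (hν : 0 ≤ ν) (hL : 0 < L) (hAσ : 0 < Aσ) (hs : 0 < s) (hϑ : MemFdot ν 2 ϑ)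
    (hϑs : MemFdot ν (2 + s) ϑ)
    (hω : IsVorticityStrength Aμ Aρ Aσ L ϑ ω) (hx : x = normF ν (theta ϑ))
    (hsmall : Real.pi / 2 * (Real.exp x - 1) < 1) (h2 : |Aμ| * C2 s x * x < 1) :
    MemFdot ν s (omegaGe2 Aμ Aρ L ϑ ω) ∧ normFdot ν s (omegaGe2 Aμ Aρ L ϑ ω) ≤
      |Aμ| * Aσ * (4 * Real.pi / L) * C13 Aμ s x * x * normFdot ν (2 + s) (theta ϑ)
        + |Aρ| * (L / Real.pi) * Real.exp ν * C14 Aμ s x * x * normFdot ν s (theta ϑ) := by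
  have hpi := Real.pi_pos
  have hx0 : 0 ≤ x := hx ▸ normF_nonneg ν (theta ϑ)
  have hb := b_nonneg 2 s
  have hϑw := memFdot_wiener hν two_pos hϑ
  have hθ := wiener_theta hϑw
  have hθ0 := fc_theta_zero hϑw
  have hθms := memFdot_theta hν (by positivity) hϑs
  have hθs := memFdot_of_le hs (by linarith) hθ0 hθms
  have hθm := memF_of_memFdot hs hθ0 hθs
  have hxt := hx ▸ normF_le_normFdot hs hθ0 hθs
  have hcheb := hx ▸ normFdot_mul_le hs hθ0 hθms
  have ht := normFdot_nonneg (ν := ν) hs (theta ϑ)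
  have hT := normFdot_nonneg (ν := ν) two_pos (theta ϑ)
  have hTs := normFdot_nonneg (ν := ν) (by positivity : 0 < 2 + s) (theta ϑ)
  have hωw := wiener_vorticity hω
  have hsplit := omega_splitting hν hL hϑ hω (hx ▸ hsmall)
  have hC7 := C7_mul_le_C2_mul (s := s) hx0 hsmall
  have h7 : |Aμ| * C7 x * x < 1 := by
    rw [mul_assoc] at h2 ⊢
    exact (mul_le_mul_of_nonneg_left hC7 (abs_nonneg _)).trans_lt h2
  obtain ⟨hW, hm2, hn2⟩ := memF_omegaGe2 hν hL hAσ hϑ hω hx hsmall h7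
  obtain ⟨h1, h1w⟩ := wn_omega1_le (Aμ := Aμ) (Aρ := Aρ) hν hL hAσ hϑ
  have h1s := wn_wpow_omega1_le (Aμ := Aμ) (Aρ := Aρ) hν hL hAσ hs hϑ hϑs
  have hN₀ : 0 ≤ |Aρ| * (L / Real.pi) * Real.exp ν := by positivity
  have hN₁ := omega1_bound_nonneg (Aμ := Aμ) (Aρ := Aρ) (ν := ν) (ϑ := ϑ) hL hAσ
  have hN₁s : 0 ≤ Aσ * (4 * Real.pi / L) * normFdot ν (2 + s) (theta ϑ) +
        (1 + 2 * |Aμ|) * |Aρ| * (L / Real.pi) * (2 * b 2 s) * Real.exp ν *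
          normFdot ν s (theta ϑ) := by positivity
  have hN₂ := normF_nonneg ν (omegaGe2 Aμ Aρ L ϑ ω)
  -- Both gauge and exponential weight are truncated, so the a priori norms of `ω` are finite. The
  -- bounds for `θ`, `ω₁` and `ω_{≥2}` come from the full weights.
  have key : ∀ N : ℕ, 1 ≤ N → _ := fun N hN =>
    wn_wpow_omegaGe2_le (N₀ := |Aρ| * (L / Real.pi) * Real.exp ν) hL (isWeight_trunc hν N) hs hθ hωw
      (fc_vorticity_zero hω) h1 hsplit hx0 ht hsmall
      ((wn_mono (expWeight_mono hν (truncGauge_le N))).trans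
        ((wn_eq_ofReal_normF hθm).le.trans (by rw [hx])))
      ((wn_mono (wpow_trunc_le hν hs.le N)).trans (wn_eq_ofReal_normFdot hs hθs).le)
      (wn_trunc_ne_top hν hωw N) (wn_wpow_trunc_ne_top hν hs.le hωw N) hN₀ hN₁ hN₁s hN₂
      (by rw [expWeight_trunc_one hN, ← ENNReal.ofReal_mul (by positivity)])
      (by rw [wpow_trunc_one hN, ← ENNReal.ofReal_mul (by positivity)])
      ((wn_mono (expWeight_mono hν (truncGauge_le N))).trans h1w)
      ((wn_mono (wpow_trunc_le hν hs.le N)).trans h1s)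
      ((wn_mono (expWeight_mono hν (truncGauge_le N))).trans (wn_eq_ofReal_normF hm2).le) h2
  have hlim := wn_le_of_eventually
    (W := wpow (expWeight ν absGauge) (fun k => ENNReal.ofReal (absGauge k)) s)
    (V := fun N => wpow (expWeight ν (truncGauge N)) (fun k => ENNReal.ofReal (truncGauge N k)) s)
    (fun k => (eventually_truncGauge k).mono fun N hN => by
      rw [wpow, wpow, expWeight, expWeight, hN])
    ((eventually_ge_atTop 1).mono fun N hN => key N hN)
  have hD : 0 < 1 - |Aμ| * C2 s x * x := by linarith
  have hD7 : 0 < 1 - |Aμ| * C7 x * x := by linarith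
  have hC3 := C3_nonneg s hx0
  have hC4 := C4_nonneg s hx0
  have hb3 := C3breve_nonneg s hx0
  have hb4 := C4breve_nonneg s hx0
  have hC12 := C12_nonneg s hx0
  have hCR := CR_nonneg
  have hC2 : 0 ≤ C2 s x := by unfold C2; positivity
  have hC9 : 0 ≤ C9 Aμ x * x := by
    have h3 := C3_nonneg 1 hx0
    rw [C9, C8, mul_right_comm, C7_mul_eq hx0 hsmall]
    exact mul_nonneg (by positivity) (one_div_nonneg.2 hD7.le)
  have ha := abs_nonneg Aμ
  obtain ⟨r1, r2⟩ := memFdot_and_norm_le hs hW (div_nonneg (by positivity) hD.le) hlim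
  refine ⟨r1, r2.trans ?_⟩
  rw [C14, C13, C8tilde, C11_eq]
  have e : ∀ p q r : ℝ, |Aμ| * Aσ * (4 * Real.pi / L) * (1 / (1 - |Aμ| * C2 s x * x) * p) * x *
      normFdot ν (2 + s) (theta ϑ) + |Aρ| * (L / Real.pi) * Real.exp ν *
      (|Aμ| * (1 / (1 - |Aμ| * C2 s x * x)) * q + r * (1 / (1 - |Aμ| * C2 s x * x))) * x *
      normFdot ν s (theta ϑ) =
      (|Aμ| * Aσ * (4 * Real.pi / L) * p * x * normFdot ν (2 + s) (theta ϑ) +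
        |Aρ| * (L / Real.pi) * Real.exp ν * (|Aμ| * q + r) * x * normFdot ν s (theta ϑ)) /
      (1 - |Aμ| * C2 s x * x) := fun p q r => by ring
  rw [e]
  refine div_le_div_of_nonneg_right ?_ hD.le
  rw [← hx]
  have hS : 0 ≤ Aσ * (4 * Real.pi / L) := by positivity
  rw [mul_assoc |Aμ| Aσ] at hn2 ⊢
  generalize Aσ * (4 * Real.pi / L) = S at *
  have e2 : (1 + 2 * |Aμ|) * |Aρ| * (L / Real.pi) * Real.exp ν * x =
      (1 + 2 * |Aμ|) * (|Aρ| * (L / Real.pi) * Real.exp ν) * x := by ring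
  have e3 : (1 + 2 * |Aμ|) * |Aρ| * (L / Real.pi) * (2 * b 2 s) * Real.exp ν *
      normFdot ν s (theta ϑ) = (1 + 2 * |Aμ|) * (|Aρ| * (L / Real.pi) * Real.exp ν) * (2 * b 2 s) *
      normFdot ν s (theta ϑ) := by ring
  rw [e2, e3]
  generalize |Aρ| * (L / Real.pi) * Real.exp ν = N₀ at *
  generalize normFdot ν s (theta ϑ) = t at *
  generalize normFdot ν (2 + s) (theta ϑ) = T' at *
  generalize normFdot ν 2 (theta ϑ) = T at *
  generalize normF ν (omegaGe2 Aμ Aρ L ϑ ω) = N₂ at *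
  -- Inserts the bound for `ω_{≥2}` in order `0`; this brings `C₉` and `C₁₀` into `C₁₃` and `C₁₄`.
  have k1 : 0 ≤ |Aμ| * C12 s x * t * (|Aμ| * S * C9 Aμ x * x * T + N₀ * C10 Aμ x * x ^ 2 - N₂) :=
    mul_nonneg (by positivity) (by linarith)
  -- Interpolation `t T ≤ x T'` replaces the norms of orders `s` and `2` by those of orders `0` and
  -- `2 + s`.
  have k2 : 0 ≤ |Aμ| * C12 s x * S * (1 + |Aμ| * (C9 Aμ x * x)) * (x * T' - t * T) :=
    mul_nonneg (by positivity) (by linarith)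
  -- The estimate produces `x²` with these constants, where the claim has `x t`; mean zero gives `x
  -- ≤ t`.
  have k3 : 0 ≤ (|Aμ| * C3 s x + C3breve s x) * N₀ * x * (t - x) :=
    mul_nonneg (by positivity) (by linarith)
  linarith

end Vorticity

end MuskatBubble

end

theorem proposition6 (Aμ Aρ Aσ L ν : ℝ) (hAμ : Aμ ∈ Set.Icc (-1 : ℝ) 1) (hAσ : 0 < Aσ)
    (hL : 0 < L) (hν : 0 ≤ ν) (ϑ : ℝ → ℝ) (hϑ : MuskatBubble.MemFdot ν 2 ϑ) :
    -- the linear part in `F^{0,1}_ν`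
    (MuskatBubble.MemF ν (MuskatBubble.omega1 Aμ Aρ Aσ L ϑ) ∧
      MuskatBubble.normF ν (MuskatBubble.omega1 Aμ Aρ Aσ L ϑ) ≤
        Aσ * (4 * Real.pi / L) * MuskatBubble.normFdot ν 2 (MuskatBubble.theta ϑ)
          + (1 + 2 * |Aμ|) * |Aρ| * (L / Real.pi) * Real.exp ν *
            MuskatBubble.normF ν (MuskatBubble.theta ϑ)) ∧
    -- the linear part in `Ḟ^{s,1}_ν`
    (∀ s : ℝ, 0 < s → MuskatBubble.MemFdot ν (2 + s) ϑ →
      MuskatBubble.MemFdot ν s (MuskatBubble.omega1 Aμ Aρ Aσ L ϑ) ∧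
      MuskatBubble.normFdot ν s (MuskatBubble.omega1 Aμ Aρ Aσ L ϑ) ≤
        Aσ * (4 * Real.pi / L) * MuskatBubble.normFdot ν (2 + s) (MuskatBubble.theta ϑ)
          + (1 + 2 * |Aμ|) * |Aρ| * (L / Real.pi) * (2 * MuskatBubble.b 2 s) * Real.exp ν *
            MuskatBubble.normFdot ν s (MuskatBubble.theta ϑ)) ∧
    -- the nonlinear part, for every vorticity strength
    (∀ ω : ℝ → ℝ, MuskatBubble.IsVorticityStrength Aμ Aρ Aσ L ϑ ω →
      ∀ x : ℝ, x = MuskatBubble.normF ν (MuskatBubble.theta ϑ) →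
      Real.pi / 2 * (Real.exp x - 1) < 1 →
      -- the splitting of the vorticity strength
      (∀ α : ℝ, ω α = MuskatBubble.omega0 Aρ L ϑ α + MuskatBubble.omega1 Aμ Aρ Aσ L ϑ α
        + MuskatBubble.omegaGe2 Aμ Aρ L ϑ ω α) ∧
      -- the nonlinear part in `F^{0,1}_ν`
      (|Aμ| * MuskatBubble.C7 x * x < 1 →
        MuskatBubble.MemF ν (MuskatBubble.omegaGe2 Aμ Aρ L ϑ ω) ∧
        MuskatBubble.normF ν (MuskatBubble.omegaGe2 Aμ Aρ L ϑ ω) ≤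
          |Aμ| * Aσ * (4 * Real.pi / L) * MuskatBubble.C9 Aμ x *
              MuskatBubble.normF ν (MuskatBubble.theta ϑ) *
              MuskatBubble.normFdot ν 2 (MuskatBubble.theta ϑ)
            + |Aρ| * (L / Real.pi) * Real.exp ν * MuskatBubble.C10 Aμ x *
              MuskatBubble.normF ν (MuskatBubble.theta ϑ) ^ 2) ∧
      -- the nonlinear part in `Ḟ^{s,1}_ν`
      (∀ s : ℝ, 0 < s → MuskatBubble.MemFdot ν (2 + s) ϑ →
        |Aμ| * MuskatBubble.C2 s x * x < 1 →
        MuskatBubble.MemFdot ν s (MuskatBubble.omegaGe2 Aμ Aρ L ϑ ω) ∧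
        MuskatBubble.normFdot ν s (MuskatBubble.omegaGe2 Aμ Aρ L ϑ ω) ≤
          |Aμ| * Aσ * (4 * Real.pi / L) * MuskatBubble.C13 Aμ s x *
              MuskatBubble.normF ν (MuskatBubble.theta ϑ) *
              MuskatBubble.normFdot ν (2 + s) (MuskatBubble.theta ϑ)
            + |Aρ| * (L / Real.pi) * Real.exp ν * MuskatBubble.C14 Aμ s x *
              MuskatBubble.normF ν (MuskatBubble.theta ϑ) *
              MuskatBubble.normFdot ν s (MuskatBubble.theta ϑ))) := by
  obtain ⟨h1, h1w⟩ := MuskatBubble.wn_omega1_le (Aμ := Aμ) (Aρ := Aρ) hν hL hAσ hϑ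
  refine ⟨MuskatBubble.memF_and_norm_le h1 (MuskatBubble.omega1_bound_nonneg hL hAσ) h1w,
    fun s hs hϑs => ?_, fun ω hω x hx hsmall => ⟨?_, fun h7 => ?_, fun s hs hϑs h2 => ?_⟩⟩
  · have hpi := Real.pi_pos
    have hb := MuskatBubble.b_nonneg 2 s
    have ht := MuskatBubble.normFdot_nonneg (ν := ν) hs (MuskatBubble.theta ϑ)
    have hT := MuskatBubble.normFdot_nonneg (ν := ν) (by positivity : 0 < 2 + s)
      (MuskatBubble.theta ϑ)
    exact MuskatBubble.memFdot_and_norm_le hs h1 (by positivity)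
      (MuskatBubble.wn_wpow_omega1_le hν hL hAσ hs hϑ hϑs)
  · exact MuskatBubble.omega_splitting hν hL hϑ hω (hx ▸ hsmall)
  · rw [← hx]
    exact (MuskatBubble.memF_omegaGe2 hν hL hAσ hϑ hω hx hsmall h7).2
  · rw [← hx]
    exact MuskatBubble.memFdot_omegaGe2 hν hL hAσ hs hϑ hϑs hω hx hsmall h2
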